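/- **Polynomials.** Fix a set $V$ of variables, all subject to $y^2=y$, so that every polynomial has a unique expanded multilinear form; $\operatorname{Var}$ denotes the variables and $\operatorname{mon}$ the number of monomials occurring in that form. Boolean polynomials have coefficients in $\mathbb F_2$ (sum written $\oplus$); phase polynomials have coefficients in $\mathbb R/\mathbb Z$. For a boolean polynomial $Q$ let $\widehat Q$ be the integer polynomial with $\widehat y=y$, $\widehat{pq}=\widehat p\,\widehat q$, $\widehat{p\oplus q}=\widehat p+\widehat q-2\widehat p\,\widehat q$. **Morphisms.** A morphism $t:n\to m$ of $\mathbf{SOP}^{⏚}$ is a term $$t=s\sum_{\vec y}e^{2i\pi P}\,|\vec O\rangle\,!\vec D\,\langle\vec I|,$$ where $s\in\mathbb R$, $\vec y\subseteq V$ is a finite set of summation variables, $P$ is a phase polynomial, $\vec O$ and $\vec I$ are lists of $m$ and $n$ boolean polynomials and $\vec D$ is a finite set of boolean polynomials, all in the variables $\vec y$. It is a morphism of $\mathbf{SOP}^{⏚}_{\mathrm{Clif}}$ if $s=\sqrt2^{\,-p}$ with $p\in\mathbb Z$, $P=\frac18P^{(0)}+\frac14P^{(1)}+\frac12P^{(2)}$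 with $P^{(i)}$ of integer coefficients and degree at most $i$, and all polynomials in $\vec O,\vec D,\vec I$ have degree at most $1$. Two terms are equal up to $\alpha$-conversion if they differ by a renaming of the summation variables. **Interpretation.** For a term without discards, $[\![s\sum_{\vec y}e^{2i\pi P}|\vec O\rangle\langle\vec I|]\!]=s\sum_{\vec y\in\{0,1\}^k}e^{2i\pi P(\vec y)}|\vec O(\vec y)\rangle\langle\vec I(\vec y)|$, a linear map between tensor powers of $\mathbb C^2$. In general $[\![t]\!]:=[\![\mathrm{CPM}(t)]\!]$, where $\mathrm{CPM}(t)$ is $$\frac{s^2}{2^{|\vec D|}}\sum_{\vec y_1,\vec y_2,\vec z}e^{2i\pi\left(P(\vec y_1)-P(\vec y_2)+\frac{\widehat{\vec D}(\vec y_1)\cdot\vec z+\widehat{\vec D}(\vec y_2)\cdot\vec z}{2}\right)}|\vec O(\vec y_1),\vec O(\vec y_2)\rangle\langle\vec I(\vec y_1),\vec I(\vec y_2)|.$$ **Rewrite system $\mathrm{Clif}^{⏚}$.** The rules are the following; $y_0\neq y_0'$ are summation variables, every factor on the right multiplies $s$, and $p\ge0$, the empty product being $1$. A sum in a left-hand side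 is a splitting of the expanded polynomial into summands without common monomials. * (Elim) $\sum_{\vec y}e^{2i\pi P}|\vec O\rangle!\vec D\langle\vec I|\to2\sum_{\vec y\setminus\{y_0\}}e^{2i\pi P}|\vec O\rangle!\vec D\langle\vec I|$ if $y_0\notin\operatorname{Var}(P,\vec D,\vec O,\vec I)$. * (HH) $\sum_{\vec y}e^{2i\pi(\frac{y_0}2(y_0'+\widehat Q)+R)}|\vec O\rangle!\vec D\langle\vec I|\to2\sum_{\vec y\setminus\{y_0,y_0'\}}e^{2i\pi R[y_0'\leftarrow\widehat Q]}(|\vec O\rangle!\vec D\langle\vec I|)[y_0'\leftarrow Q]$ if $y_0\notin\operatorname{Var}(R,Q,\vec D,\vec O,\vec I)$ and $y_0'\notin\operatorname{Var}(Q)$. * ($\omega$) $\sum_{\vec y}e^{2i\pi(\frac{y_0}4+\frac{y_0}2\widehat Q+R)}|\vec O\rangle!\vec D\langle\vec I|\to\sqrt2\sum_{\vec y\setminus\{y_0\}}e^{2i\pi(\frac18-\frac14\widehat Q+R)}|\vec O\rangle!\vec D\langle\vec I|$ if $y_0\notin\operatorname{Var}(Q,R,\vec D,\vec O,\vec I)$.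 * (Z⏚) $\sum e^{2i\pi(P+\alpha\widehat{D_1\cdots D_p})}|\vec O\rangle!\vec D\langle\vec I|\to\sum e^{2i\pi P}|\vec O\rangle!\vec D\langle\vec I|$ if $D_1,\dots,D_p\in\vec D$ and $\alpha\widehat{D_1\cdots D_p}\ne0$ modulo $1$. * (H⏚) $\sum_{\vec y}e^{2i\pi(P+\frac{y_0}2\widehat Q)}|\vec O\rangle!(\vec D\cup\{y_0\})\langle\vec I|\to\sqrt2\sum_{\vec y\setminus\{y_0\}}e^{2i\pi P}|\vec O\rangle!(\vec D\cup\{Q\})\langle\vec I|$ if $y_0\notin\operatorname{Var}(P,Q,\vec O,\vec I,\vec D)$. * ($\oplus$⏚) in the discarded set, replace an element $D_1\cdots D_p\oplus E$ by $E$, if $D_1,\dots,D_p$ are other elements of the set and $D_1\cdots D_p\neq0$. * (Cst⏚) remove a constant $c\in\{0,1\}$ from the discarded set. * (disc) if the discarded set is $\vec D\cup\{D_i\}$ with $D_i\notin\vec D$, $D_i=y_0\oplus D_i'$, $D_i'\ne0$, $y_0\notin\operatorname{Var}(D_i')$, and $\vec D[y_0\leftarrow D_i]$ has at most as many elements with $\operatorname{mon}\ge2$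 as $\vec D$: substitute $y_0\leftarrow\widehat{D_i}$ in $P$ and $y_0\leftarrow D_i$ in $\vec O$, $\vec D\cup\{D_i\}$ and $\vec I$. * (ket) if $O_i=y_0\oplus O_i'\oplus O_i''$ with $O_i'\ne0$, $y_0\notin\operatorname{Var}(O_1,\dots,O_{i-1},O_i',O_i'')$, and $y_0\notin\operatorname{Var}(\vec D)$ or $\{y_0,O_i'\}\subseteq\vec D\cup\{1\}$: substitute $y_0\leftarrow\widehat{y_0\oplus O_i'}$ in $P$ and $y_0\leftarrow y_0\oplus O_i'$ in $\vec O$ and $\vec I$, leaving $\vec D$ unchanged. * (bra) if $I_i=y_0\oplus I_i'\oplus I_i''$ with $I_i'\ne0$, $y_0\notin\operatorname{Var}(\vec O,I_1,\dots,I_{i-1},I_i',I_i'')$, and $y_0\notin\operatorname{Var}(\vec D)$ or $\{y_0,I_i'\}\subseteq\vec D\cup\{1\}$: substitute $y_0\leftarrow\widehat{y_0\oplus I_i'}$ in $P$ and $y_0\leftarrow y_0\oplus I_i'$ in $\vec I$, leaving $\vec O$ and $\vec D$ unchanged. * (Z) $s\sum_{\vec y}e^{2i\pi(\frac{y_0}2+R)}|\vec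 O\rangle!\vec D\langle\vec I|\to\sum_{y_0}e^{2i\pi\frac{y_0}2}|0,\dots,0\rangle!\{\}\langle0,\dots,0|$ if $y_0\notin\operatorname{Var}(R,\vec D,\vec O,\vec I)$ and ($s\ne1$ or $R\neq0$ or $\vec O\vec I\ne\vec0$). A term is terminal if no rule applies to it; $\to^*$ denotes reduction in finitely many (possibly zero) steps. **Theorem (Completeness for Clifford).** Let $t_1,t_2:n\to m$ be morphisms of $\mathbf{SOP}^{⏚}_{\mathrm{Clif}}$ such that $[\![t_1]\!]=[\![t_2]\!]$. If $t_1'$ and $t_2'$ are terminal with $t_1\to^*t_1'$ and $t_2\to^*t_2'$, then $t_1'=t_2'$ up to $\alpha$-conversion. -/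

import Mathlib

noncomputable section

open scoped Classical

namespace SumOverPaths

universe u w

/-! ### Multilinear polynomials -/

/-- A monomial in variables that satisfy `X ^ 2 = X`: the finite set of variables in it. -/
def Mon (V : Type u) : Type u := Finset V

/-- The monomial whose variables are the elements of a finite set. -/
def Mon.of {V : Type u} (S : Finset V) : Mon V := S

/-- The variables of a monomial. -/
def Mon.vars {V : Type u} (S : Mon V) : Finset V := S

instance (V : Type u) : CommMonoid (Mon V) where
  mul S T := Mon.of (S.vars ∪ T.vars)
  one := Mon.of ∅
  mul_assoc S T U := Finset.union_assoc (α := V) S T U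
  mul_comm S T := Finset.union_comm (α := V) S T
  one_mul S := Finset.empty_union (α := V) S
  mul_one S := Finset.union_empty (α := V) S

/-- `R[X_v : v ∈ V] / (X_v ^ 2 - X_v)`: the algebra of the monoid of multilinear monomials. An
element is given by its coefficients, i.e. in expanded and simplified form. -/
abbrev Poly (V : Type u) (R : Type w) [CommRing R] : Type (max u w) := MonoidAlgebra R (Mon V)

/-- Boolean polynomials; their sum is the exclusive or. -/
abbrev BPoly (V : Type u) : Type u := Poly V (ZMod 2)

/-- Polynomials with integer coefficients. -/
abbrev IPoly (V : Type u) : Type u := Poly V ℤ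

/-- Phase polynomials: `ℝ[X_v : v ∈ V] / (1, X_v ^ 2 - X_v)`, that is, multilinear polynomials
whose coefficients are real numbers modulo `1`. -/
abbrev Phase (V : Type u) : Type u := Mon V →₀ UnitAddCircle

/-- The variables that occur in a family of coefficients. -/
def coeffVars {V : Type u} {R : Type w} [Zero R] (f : Mon V →₀ R) : Finset V :=
  f.support.biUnion Mon.vars

namespace Poly

variable {V W : Type u} {R : Type w} [CommRing R]

/-- The variables of a polynomial. -/
def vars (p : Poly V R) : Finset V := coeffVars p.coeff

/-- The set of monomials of a polynomial (those with a nonzero coefficient). -/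
def monomials (p : Poly V R) : Finset (Mon V) := p.coeff.support

/-- The number of monomials of a polynomial. -/
def mon (p : Poly V R) : ℕ := (monomials p).card

/-- The degree of `p` is at most `d`. -/
def DegreeLE (p : Poly V R) (d : ℕ) : Prop := ∀ S ∈ monomials p, S.vars.card ≤ d

/-- The polynomial `X_v`. -/
def X (v : V) : Poly V R := MonoidAlgebra.single (Mon.of {v}) 1

/-- Simultaneous substitution of polynomials for the variables. -/
def bind (f : V → Poly W R) (p : Poly V R) : Poly W R :=
  p.coeff.sum fun S c => c • ∏ v ∈ S.vars, f v

/-- `p[y ← q]`. -/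
def subst (y : V) (q : Poly V R) (p : Poly V R) : Poly V R := bind (Function.update X y q) p

/-- Renaming of variables. -/
def rename (f : V → W) (p : Poly V R) : Poly W R := bind (fun v => X (f v)) p

/-- The value of a polynomial. -/
def eval (a : V → R) (p : Poly V R) : R := p.coeff.sum fun S c => c * ∏ v ∈ S.vars, a v

end Poly

/-- The operation `p + q - 2 p q` that represents the exclusive or. -/
def xorOp {V : Type u} (p q : IPoly V) : IPoly V := p + q - 2 * (p * q)

instance (V : Type u) : Std.Commutative (xorOp (V := V)) := ⟨fun p q => by unfold xorOp; ring⟩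

instance (V : Type u) : Std.Associative (xorOp (V := V)) := ⟨fun p q r => by unfold xorOp; ring⟩

/-- The integer polynomial `Q̂` of a boolean polynomial `Q`: monomials are kept, and `⊕` becomes
`p + q - 2 p q`. -/
def BPoly.hat {V : Type u} (Q : BPoly V) : IPoly V :=
  (Poly.monomials Q).fold xorOp 0 fun S => MonoidAlgebra.single S 1

namespace Phase

variable {V W : Type u}

/-- The phase polynomial `α p`, for a polynomial `p` with integer coefficients. -/
def scale (α : UnitAddCircle) (p : IPoly V) : Phase V :=
  p.coeff.mapRange (fun z : ℤ => z • α) (zero_smul ℤ α)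

/-- The variables of a phase polynomial. -/
def vars (P : Phase V) : Finset V := coeffVars P

/-- Simultaneous substitution of integer polynomials for the variables. -/
def bind (f : V → IPoly W) (P : Phase V) : Phase W :=
  P.sum fun S c => scale c (∏ v ∈ S.vars, f v)

/-- `P[y ← q]`. -/
def subst (y : V) (q : IPoly V) (P : Phase V) : Phase V := bind (Function.update Poly.X y q) P

/-- Renaming of variables. -/
def rename (f : V → W) (P : Phase V) : Phase W := bind (fun v => Poly.X (f v)) P

/-- The value, modulo `1`, of a phase polynomial at bits. -/
def eval (a : V → ZMod 2) (P : Phase V) : UnitAddCircle :=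
  P.sum fun S c => (∏ v ∈ S.vars, (a v).val) • c

end Phase

/-! ### Bookkeeping of variables -/

section VarLemmas

variable {V W : Type u} {R : Type w}

theorem mem_coeffVars [Zero R] {f : Mon V →₀ R} {v : V} :
    v ∈ coeffVars f ↔ ∃ S, f S ≠ 0 ∧ v ∈ S.vars := by
  simp [coeffVars]

theorem coeffVars_zero [Zero R] : coeffVars (0 : Mon V →₀ R) = ∅ := by
  simp [coeffVars]

theorem coeffVars_add [AddZeroClass R] (f g : Mon V →₀ R) :
    coeffVars (f + g) ⊆ coeffVars f ∪ coeffVars g := by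
  intro v hv
  obtain ⟨S, hS, hvS⟩ := mem_coeffVars.1 hv
  rw [Finset.mem_union, mem_coeffVars, mem_coeffVars]
  by_cases hf : f S = 0
  · exact Or.inr ⟨S, fun hg => hS (by rw [Finsupp.add_apply, hf, hg, add_zero]), hvS⟩
  · exact Or.inl ⟨S, hf, hvS⟩

theorem coeffVars_neg [AddGroup R] (f : Mon V →₀ R) : coeffVars (-f) = coeffVars f := by
  simp [coeffVars]

theorem coeffVars_sum [AddCommMonoid R] {ι : Type*} (s : Finset ι) (f : ι → Mon V →₀ R)
    (A : Finset V) (h : ∀ i ∈ s, coeffVars (f i) ⊆ A) : coeffVars (∑ i ∈ s, f i) ⊆ A := by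
  induction s using Finset.induction_on with
  | empty => simp [coeffVars_zero]
  | insert i s hi ih =>
    rw [Finset.sum_insert hi]
    exact (coeffVars_add _ _).trans (Finset.union_subset (h i (Finset.mem_insert_self i s))
      (ih fun j hj => h j (Finset.mem_insert_of_mem hj)))

theorem Poly.vars_single [CommRing R] (S : Mon V) (c : R) :
    Poly.vars (MonoidAlgebra.single S c : Poly V R) ⊆ S.vars := by
  intro v hv
  obtain ⟨T, hT, hvT⟩ := mem_coeffVars.1 hv
  rw [MonoidAlgebra.coeff_single, Finsupp.single_apply] at hT
  split_ifs at hT with h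
  · rwa [h]
  · exact absurd rfl hT

theorem Poly.vars_X [CommRing R] (v : V) : Poly.vars (Poly.X v : Poly V R) ⊆ {v} :=
  Poly.vars_single _ _

theorem Poly.vars_add [CommRing R] (p q : Poly V R) :
    Poly.vars (p + q) ⊆ Poly.vars p ∪ Poly.vars q := by
  simpa [Poly.vars] using coeffVars_add p.coeff q.coeff

theorem Poly.vars_neg [CommRing R] (p : Poly V R) : Poly.vars (-p) = Poly.vars p := by
  simpa [Poly.vars] using coeffVars_neg p.coeff

theorem Poly.vars_sum [CommRing R] {ι : Type*} (s : Finset ι) (f : ι → Poly V R)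
    (A : Finset V) (h : ∀ i ∈ s, Poly.vars (f i) ⊆ A) : Poly.vars (∑ i ∈ s, f i) ⊆ A := by
  induction s using Finset.induction_on with
  | empty => simp [Poly.vars, coeffVars_zero]
  | insert i s hi ih =>
    rw [Finset.sum_insert hi]
    exact (Poly.vars_add _ _).trans (Finset.union_subset (h i (Finset.mem_insert_self i s))
      (ih fun j hj => h j (Finset.mem_insert_of_mem hj)))

theorem Poly.vars_mul [CommRing R] (p q : Poly V R) :
    Poly.vars (p * q) ⊆ Poly.vars p ∪ Poly.vars q := by
  rw [MonoidAlgebra.mul_def]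
  refine Poly.vars_sum _ _ _ fun S hS => Poly.vars_sum _ _ _ fun T hT => ?_
  refine (Poly.vars_single _ _).trans ?_
  exact Finset.union_subset_union (Finset.subset_biUnion_of_mem Mon.vars hS)
    (Finset.subset_biUnion_of_mem Mon.vars hT)

theorem Poly.vars_prod [CommRing R] {ι : Type*} (s : Finset ι) (f : ι → Poly V R)
    (A : Finset V) (h : ∀ i ∈ s, Poly.vars (f i) ⊆ A) : Poly.vars (∏ i ∈ s, f i) ⊆ A := by
  induction s using Finset.induction_on with
  | empty =>
    rw [Finset.prod_empty, MonoidAlgebra.one_def]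
    exact (Poly.vars_single _ _).trans (Finset.empty_subset A)
  | insert i s hi ih =>
    rw [Finset.prod_insert hi]
    exact (Poly.vars_mul _ _).trans (Finset.union_subset (h i (Finset.mem_insert_self i s))
      (ih fun j hj => h j (Finset.mem_insert_of_mem hj)))

theorem Poly.vars_smul [CommRing R] (c : R) (p : Poly V R) :
    Poly.vars (c • p) ⊆ Poly.vars p := by
  intro v hv
  obtain ⟨S, hS, hvS⟩ := mem_coeffVars.1 hv
  refine mem_coeffVars.2 ⟨S, fun h => hS ?_, hvS⟩
  simp [h]

theorem Poly.vars_rename [CommRing R] (f : V → W) (p : Poly V R) (B : Finset W)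
    (h : ∀ v ∈ Poly.vars p, f v ∈ B) : Poly.vars (Poly.rename f p) ⊆ B := by
  refine Poly.vars_sum _ _ _ fun S hS => (Poly.vars_smul _ _).trans ?_
  refine Poly.vars_prod _ _ _ fun v hv => (Poly.vars_X _).trans ?_
  exact Finset.singleton_subset_iff.2 (h v (Finset.mem_biUnion.2 ⟨S, hS, hv⟩))

theorem Phase.vars_scale (α : UnitAddCircle) (p : IPoly V) :
    Phase.vars (Phase.scale α p) ⊆ Poly.vars p := by
  intro v hv
  obtain ⟨S, hS, hvS⟩ := mem_coeffVars.1 hv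
  refine mem_coeffVars.2 ⟨S, fun h => hS ?_, hvS⟩
  simp [Phase.scale, h]

theorem Phase.vars_rename (f : V → W) (P : Phase V) (B : Finset W)
    (h : ∀ v ∈ P.vars, f v ∈ B) : Phase.vars (Phase.rename f P) ⊆ B := by
  refine coeffVars_sum _ _ _ fun S hS => (Phase.vars_scale _ _).trans ?_
  refine Poly.vars_prod _ _ _ fun v hv => (Poly.vars_X _).trans ?_
  exact Finset.singleton_subset_iff.2 (h v (Finset.mem_biUnion.2 ⟨S, hS, hv⟩))

theorem vars_xorOp (p q : IPoly V) : Poly.vars (xorOp p q) ⊆ Poly.vars p ∪ Poly.vars q := by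
  have h2 : Poly.vars (2 * (p * q)) ⊆ Poly.vars p ∪ Poly.vars q := by
    rw [two_mul]
    exact (Poly.vars_add _ _).trans (Finset.union_subset (Poly.vars_mul p q) (Poly.vars_mul p q))
  unfold xorOp
  rw [sub_eq_add_neg]
  refine (Poly.vars_add _ _).trans (Finset.union_subset (Poly.vars_add p q) ?_)
  rwa [Poly.vars_neg]

theorem BPoly.vars_hat (Q : BPoly V) : Poly.vars (BPoly.hat Q) ⊆ Poly.vars Q := by
  have key : ∀ s : Finset (Mon V), s ⊆ Poly.monomials Q →
      Poly.vars (s.fold xorOp 0 fun S => (MonoidAlgebra.single S 1 : IPoly V)) ⊆ Poly.vars Q := by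
    intro s
    induction s using Finset.induction_on with
    | empty => intro _; simp [Poly.vars, coeffVars_zero]
    | insert S s hS ih =>
      intro h
      rw [Finset.fold_insert hS]
      refine (vars_xorOp _ _).trans (Finset.union_subset ((Poly.vars_single _ _).trans ?_)
        (ih fun T hT => h (Finset.mem_insert_of_mem hT)))
      exact Finset.subset_biUnion_of_mem Mon.vars (h (Finset.mem_insert_self S s))
  exact key _ (Finset.Subset.refl _)

end VarLemmas

/-! ### Sums over paths -/

/-- A morphism `s ∑_y e^{2iπP} |O⟩⟨I|` from `n` to `m`, with variables taken in `V`; the sum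
ranges over the variables in `bound`. -/
structure SOP (V : Type u) (n m : ℕ) where
  s : ℝ
  bound : Finset V
  P : Phase V
  O : Fin m → BPoly V
  I : Fin n → BPoly V
  vars_P : P.vars ⊆ bound
  vars_O : ∀ i, Poly.vars (O i) ⊆ bound
  vars_I : ∀ i, Poly.vars (I i) ⊆ bound

/-- An assignment of bits to the variables of a finite set, extended by `0`. -/
def extend {V : Type u} (B : Finset V) (a : B → ZMod 2) : V → ZMod 2 :=
  fun v => if h : v ∈ B then a ⟨v, h⟩ else 0

/-- The interpretation `s ∑_{y ∈ {0,1}^k} e^{2iπP(y)} |O(y)⟩⟨I(y)|`, as the matrix of a linear map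
from `ℂ^(2^n)` to `ℂ^(2^m)` in the computational bases. -/
def SOP.interp {V : Type u} {n m : ℕ} (t : SOP V n m) :
    Matrix (Fin m → ZMod 2) (Fin n → ZMod 2) ℂ :=
  (t.s : ℂ) • ∑ a : t.bound → ZMod 2,
    Matrix.single (fun i => Poly.eval (extend t.bound a) (t.O i))
      (fun i => Poly.eval (extend t.bound a) (t.I i))
      (AddCircle.toCircle (Phase.eval (extend t.bound a) t.P) : ℂ)

/-- A morphism `s ∑_y e^{2iπP} |O⟩ !D ⟨I|` from `n` to `m` of sums over paths with discards; `D` is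
the set of discarded polynomials. -/
structure DSOP (V : Type u) (n m : ℕ) where
  s : ℝ
  bound : Finset V
  P : Phase V
  O : Fin m → BPoly V
  D : Finset (BPoly V)
  I : Fin n → BPoly V
  vars_P : P.vars ⊆ bound
  vars_O : ∀ i, Poly.vars (O i) ⊆ bound
  vars_D : ∀ d ∈ D, Poly.vars d ⊆ bound
  vars_I : ∀ i, Poly.vars (I i) ⊆ bound

/-- The phase `1/2` modulo `1`. -/
def half : UnitAddCircle := ((1 / 2 : ℝ) : UnitAddCircle)

/-- The phase `1/4` modulo `1`. -/
def quarter : UnitAddCircle := ((1 / 4 : ℝ) : UnitAddCircle)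

/-- The phase `1/8` modulo `1`. -/
def eighth : UnitAddCircle := ((1 / 8 : ℝ) : UnitAddCircle)

namespace DSOP

variable {V : Type u} {n m : ℕ}

/-- The variables of the CPM construction: two copies of those of the morphism, and a fresh one for
each discarded polynomial. -/
def CPMVar (V : Type u) : Type u := V ⊕ V ⊕ BPoly V

/-- The first copy of a variable. -/
def copy₁ (v : V) : CPMVar V := Sum.inl v

/-- The second copy of a variable. -/
def copy₂ (v : V) : CPMVar V := Sum.inr (Sum.inl v)

/-- The fresh variable of a discarded polynomial. -/
def fresh (d : BPoly V) : CPMVar V := Sum.inr (Sum.inr d)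

/-- The summation variables of the CPM construction. -/
def cpmBound (t : DSOP V n m) : Finset (CPMVar V) := t.bound.disjSum (t.bound.disjSum t.D)

/-- `P(y₁) - P(y₂) + (D(y₁) ⬝ y + D(y₂) ⬝ y) / 2`. -/
def cpmPhase (t : DSOP V n m) : Phase (CPMVar V) :=
  t.P.rename copy₁ - t.P.rename copy₂ +
    ∑ d ∈ t.D, Phase.scale half
      (Poly.rename copy₁ (BPoly.hat d) * Poly.X (fresh d) +
        Poly.rename copy₂ (BPoly.hat d) * Poly.X (fresh d))

theorem copy₁_mem (t : DSOP V n m) {A : Finset V} (h : A ⊆ t.bound) :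
    ∀ v ∈ A, copy₁ v ∈ t.cpmBound :=
  fun _ hv => Finset.inl_mem_disjSum.2 (h hv)

theorem copy₂_mem (t : DSOP V n m) {A : Finset V} (h : A ⊆ t.bound) :
    ∀ v ∈ A, copy₂ v ∈ t.cpmBound :=
  fun _ hv => Finset.inr_mem_disjSum.2 (Finset.inl_mem_disjSum.2 (h hv))

theorem vars_cpmPhase (t : DSOP V n m) : t.cpmPhase.vars ⊆ t.cpmBound := by
  refine (coeffVars_add _ _).trans (Finset.union_subset ?_ ?_)
  · rw [sub_eq_add_neg]
    refine (coeffVars_add _ _).trans (Finset.union_subset ?_ ?_)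
    · exact Phase.vars_rename _ _ _ (t.copy₁_mem t.vars_P)
    · rw [coeffVars_neg]
      exact Phase.vars_rename _ _ _ (t.copy₂_mem t.vars_P)
  · refine coeffVars_sum _ _ _ fun d hd => (Phase.vars_scale _ _).trans ?_
    have hf : Poly.vars (Poly.X (fresh d) : IPoly (CPMVar V)) ⊆ t.cpmBound :=
      (Poly.vars_X _).trans (Finset.singleton_subset_iff.2
        (Finset.inr_mem_disjSum.2 (Finset.inr_mem_disjSum.2 hd)))
    have hd' := (BPoly.vars_hat d).trans (t.vars_D d hd)
    refine (Poly.vars_add _ _).trans (Finset.union_subset ?_ ?_)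
    · exact (Poly.vars_mul _ _).trans (Finset.union_subset
        (Poly.vars_rename _ _ _ (t.copy₁_mem hd')) hf)
    · exact (Poly.vars_mul _ _).trans (Finset.union_subset
        (Poly.vars_rename _ _ _ (t.copy₂_mem hd')) hf)

theorem vars_append (t : DSOP V n m) {k : ℕ} (A : Fin k → BPoly V)
    (h : ∀ i, Poly.vars (A i) ⊆ t.bound) (i : Fin (k + k)) :
    Poly.vars (Fin.append (fun j => Poly.rename copy₁ (A j))
      (fun j => Poly.rename copy₂ (A j)) i) ⊆ t.cpmBound := by
  refine Fin.addCases (fun j => ?_) (fun j => ?_) i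
  · rw [Fin.append_left]
    exact Poly.vars_rename _ _ _ (t.copy₁_mem (h j))
  · rw [Fin.append_right]
    exact Poly.vars_rename _ _ _ (t.copy₂_mem (h j))

/-- The CPM construction. -/
def cpm (t : DSOP V n m) : SOP (CPMVar V) (n + n) (m + m) where
  s := t.s ^ 2 / 2 ^ t.D.card
  bound := t.cpmBound
  P := t.cpmPhase
  O := Fin.append (fun j => Poly.rename copy₁ (t.O j)) (fun j => Poly.rename copy₂ (t.O j))
  I := Fin.append (fun j => Poly.rename copy₁ (t.I j)) (fun j => Poly.rename copy₂ (t.I j))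
  vars_P := t.vars_cpmPhase
  vars_O := t.vars_append t.O t.vars_O
  vars_I := t.vars_append t.I t.vars_I

/-- The standard interpretation of morphisms with discards. -/
def interp (t : DSOP V n m) : Matrix (Fin (m + m) → ZMod 2) (Fin (n + n) → ZMod 2) ℂ :=
  t.cpm.interp

/-- The morphisms of the Clifford fragment with discards:
`1 / √2 ^ p ∑ e^{2iπ(P₀/8 + P₁/4 + P₂/2)} |O⟩ !D ⟨I|` where `p` is an integer, `Pᵢ` has integer
coefficients and degree at most `i`, and all polynomials of `O`, `D` and `I` are linear (of degree
at most one, constants being allowed). -/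
def IsClifford (t : DSOP V n m) : Prop :=
  (∃ p : ℤ, t.s = 1 / Real.sqrt 2 ^ p) ∧
  (∃ P₀ P₁ P₂ : IPoly V, Poly.DegreeLE P₀ 0 ∧ Poly.DegreeLE P₁ 1 ∧ Poly.DegreeLE P₂ 2 ∧
    t.P = Phase.scale eighth P₀ + Phase.scale quarter P₁ + Phase.scale half P₂) ∧
  (∀ i, Poly.DegreeLE (t.O i) 1) ∧ (∀ d ∈ t.D, Poly.DegreeLE d 1) ∧
  (∀ i, Poly.DegreeLE (t.I i) 1)

/-- `y` does not occur in `D`. -/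
def FreshD (y : V) (D : Finset (BPoly V)) : Prop := ∀ d ∈ D, y ∉ Poly.vars d

/-- `y` does not occur in a list of polynomials. -/
def FreshL {k : ℕ} (y : V) (A : Fin k → BPoly V) : Prop := ∀ i, y ∉ Poly.vars (A i)

/-- The number of polynomials in `D` that have at least two monomials. -/
def compound (D : Finset (BPoly V)) : ℕ := (D.filter fun d => 2 ≤ Poly.mon d).card

/-- One step of the rewrite system `Clif⏚`. A sum on the left-hand side of a rule is a splitting of
the expanded polynomial: the summands have no monomial in common (where a variable occurs in only
one of them this is automatic, otherwise it is stated), and a summand that the rule removes is not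
zero. -/
inductive Step : DSOP V n m → DSOP V n m → Prop
  | elim (t t' : DSOP V n m) (y₀ : V) (hy₀ : y₀ ∈ t.bound)
      (freshP : y₀ ∉ t.P.vars) (freshD : FreshD y₀ t.D)
      (freshO : FreshL y₀ t.O) (freshI : FreshL y₀ t.I)
      (s' : t'.s = 2 * t.s) (bound' : t'.bound = t.bound.erase y₀)
      (P' : t'.P = t.P) (O' : t'.O = t.O) (D' : t'.D = t.D) (I' : t'.I = t.I) : Step t t'
  | hh (t t' : DSOP V n m) (y₀ y₁ : V) (Q : BPoly V) (R : Phase V)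
      (hy₀ : y₀ ∈ t.bound) (hy₁ : y₁ ∈ t.bound) (hne : y₀ ≠ y₁)
      (hP : t.P = Phase.scale half (Poly.X y₀ * (Poly.X y₁ + BPoly.hat Q)) + R)
      (freshR : y₀ ∉ R.vars) (freshQ : y₀ ∉ Poly.vars Q) (freshD : FreshD y₀ t.D)
      (freshO : FreshL y₀ t.O) (freshI : FreshL y₀ t.I) (freshQ₁ : y₁ ∉ Poly.vars Q)
      (s' : t'.s = 2 * t.s) (bound' : t'.bound = (t.bound.erase y₀).erase y₁)
      (P' : t'.P = R.subst y₁ (BPoly.hat Q))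
      (O' : t'.O = fun i => Poly.subst y₁ Q (t.O i))
      (D' : t'.D = t.D.image (Poly.subst y₁ Q))
      (I' : t'.I = fun i => Poly.subst y₁ Q (t.I i)) : Step t t'
  | omega (t t' : DSOP V n m) (y₀ : V) (Q : BPoly V) (R : Phase V) (hy₀ : y₀ ∈ t.bound)
      (hP : t.P = Phase.scale quarter (Poly.X y₀) +
        Phase.scale half (Poly.X y₀ * BPoly.hat Q) + R)
      (freshQ : y₀ ∉ Poly.vars Q) (freshR : y₀ ∉ R.vars) (freshD : FreshD y₀ t.D)
      (freshO : FreshL y₀ t.O) (freshI : FreshL y₀ t.I)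
      (s' : t'.s = Real.sqrt 2 * t.s) (bound' : t'.bound = t.bound.erase y₀)
      (P' : t'.P = Phase.scale eighth 1 - Phase.scale quarter (BPoly.hat Q) + R)
      (O' : t'.O = t.O) (D' : t'.D = t.D) (I' : t'.I = t.I) : Step t t'
  | zGround (t t' : DSOP V n m) (E : Finset (BPoly V)) (α : UnitAddCircle) (R : Phase V)
      (hE : E ⊆ t.D)
      (hP : t.P = R + Phase.scale α (BPoly.hat (∏ d ∈ E, d)))
      (hne : Phase.scale α (BPoly.hat (∏ d ∈ E, d)) ≠ 0)
      (split : Disjoint R.support (Phase.scale α (BPoly.hat (∏ d ∈ E, d))).support)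
      (s' : t'.s = t.s) (bound' : t'.bound = t.bound)
      (P' : t'.P = R) (O' : t'.O = t.O) (D' : t'.D = t.D) (I' : t'.I = t.I) : Step t t'
  | hGround (t t' : DSOP V n m) (y₀ : V) (Q : BPoly V) (R : Phase V) (D₀ : Finset (BPoly V))
      (hy₀ : y₀ ∈ t.bound)
      (hP : t.P = R + Phase.scale half (Poly.X y₀ * BPoly.hat Q))
      (hD : t.D = insert (Poly.X y₀) D₀)
      (freshQ : y₀ ∉ Poly.vars Q) (freshR : y₀ ∉ R.vars) (freshO : FreshL y₀ t.O)
      (freshI : FreshL y₀ t.I) (freshD : FreshD y₀ D₀)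
      (s' : t'.s = Real.sqrt 2 * t.s) (bound' : t'.bound = t.bound.erase y₀)
      (P' : t'.P = R) (O' : t'.O = t.O) (D' : t'.D = insert Q D₀) (I' : t'.I = t.I) : Step t t'
  | xorGround (t t' : DSOP V n m) (E : Finset (BPoly V)) (d q : BPoly V)
      (hd : d ∈ t.D) (hE : E ⊆ t.D.erase d)
      (hsum : d = ∏ e ∈ E, e + q) (hne : ∏ e ∈ E, e ≠ 0)
      (split : Disjoint (Poly.monomials (∏ e ∈ E, e)) (Poly.monomials q))
      (s' : t'.s = t.s) (bound' : t'.bound = t.bound) (P' : t'.P = t.P) (O' : t'.O = t.O)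
      (D' : t'.D = insert q (t.D.erase d)) (I' : t'.I = t.I) : Step t t'
  | cstGround (t t' : DSOP V n m) (c : BPoly V) (hc : c = 0 ∨ c = 1) (hcD : c ∈ t.D)
      (s' : t'.s = t.s) (bound' : t'.bound = t.bound) (P' : t'.P = t.P) (O' : t'.O = t.O)
      (D' : t'.D = t.D.erase c) (I' : t'.I = t.I) : Step t t'
  | disc (t t' : DSOP V n m) (y₀ : V) (d q : BPoly V) (hy₀ : y₀ ∈ t.bound)
      (hd : d ∈ t.D) (hsum : d = Poly.X y₀ + q) (hne : q ≠ 0) (freshq : y₀ ∉ Poly.vars q)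
      (hcount : compound ((t.D.erase d).image (Poly.subst y₀ d)) ≤ compound (t.D.erase d))
      (s' : t'.s = t.s) (bound' : t'.bound = t.bound)
      (P' : t'.P = t.P.subst y₀ (BPoly.hat d))
      (O' : t'.O = fun i => Poly.subst y₀ d (t.O i))
      (D' : t'.D = t.D.image (Poly.subst y₀ d))
      (I' : t'.I = fun i => Poly.subst y₀ d (t.I i)) : Step t t'
  | ket (t t' : DSOP V n m) (y₀ : V) (i : Fin m) (q r : BPoly V) (hy₀ : y₀ ∈ t.bound)
      (hsum : t.O i = Poly.X y₀ + q + r) (hne : q ≠ 0)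
      (split : Disjoint (Poly.monomials q) (Poly.monomials r))
      (freshO : ∀ j < i, y₀ ∉ Poly.vars (t.O j))
      (freshq : y₀ ∉ Poly.vars q) (freshr : y₀ ∉ Poly.vars r)
      (hD : FreshD y₀ t.D ∨ (Poly.X y₀ ∈ insert 1 t.D ∧ q ∈ insert 1 t.D))
      (s' : t'.s = t.s) (bound' : t'.bound = t.bound)
      (P' : t'.P = t.P.subst y₀ (BPoly.hat (Poly.X y₀ + q)))
      (O' : t'.O = fun j => Poly.subst y₀ (Poly.X y₀ + q) (t.O j))
      (D' : t'.D = t.D)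
      (I' : t'.I = fun j => Poly.subst y₀ (Poly.X y₀ + q) (t.I j)) : Step t t'
  | bra (t t' : DSOP V n m) (y₀ : V) (i : Fin n) (q r : BPoly V) (hy₀ : y₀ ∈ t.bound)
      (hsum : t.I i = Poly.X y₀ + q + r) (hne : q ≠ 0)
      (split : Disjoint (Poly.monomials q) (Poly.monomials r))
      (freshO : FreshL y₀ t.O) (freshI : ∀ j < i, y₀ ∉ Poly.vars (t.I j))
      (freshq : y₀ ∉ Poly.vars q) (freshr : y₀ ∉ Poly.vars r)
      (hD : FreshD y₀ t.D ∨ (Poly.X y₀ ∈ insert 1 t.D ∧ q ∈ insert 1 t.D))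
      (s' : t'.s = t.s) (bound' : t'.bound = t.bound)
      (P' : t'.P = t.P.subst y₀ (BPoly.hat (Poly.X y₀ + q)))
      (O' : t'.O = t.O) (D' : t'.D = t.D)
      (I' : t'.I = fun j => Poly.subst y₀ (Poly.X y₀ + q) (t.I j)) : Step t t'
  | zero (t t' : DSOP V n m) (y₀ : V) (R : Phase V) (hy₀ : y₀ ∈ t.bound)
      (hP : t.P = Phase.scale half (Poly.X y₀) + R)
      (hne : t.s ≠ 1 ∨ R ≠ 0 ∨ t.O ≠ 0 ∨ t.I ≠ 0)
      (freshR : y₀ ∉ R.vars) (freshD : FreshD y₀ t.D)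
      (freshO : FreshL y₀ t.O) (freshI : FreshL y₀ t.I)
      (s' : t'.s = 1) (bound' : t'.bound = {y₀}) (P' : t'.P = Phase.scale half (Poly.X y₀))
      (O' : t'.O = 0) (D' : t'.D = ∅) (I' : t'.I = 0) : Step t t'

/-- Reduction in any number of steps. -/
def Reduces : DSOP V n m → DSOP V n m → Prop := Relation.ReflTransGen Step

/-- No rule applies. -/
def IsTerminal (t : DSOP V n m) : Prop := ∀ t', ¬ Step t t'

/-- Equality up to `α`-conversion, i.e. up to a renaming of the summation variables. -/
def AlphaEq (t t' : DSOP V n m) : Prop :=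
  ∃ σ : Equiv.Perm V, t'.s = t.s ∧ t'.bound = t.bound.image σ ∧ t'.P = t.P.rename σ ∧
    (t'.O = fun i => Poly.rename σ (t.O i)) ∧ t'.D = t.D.image (Poly.rename σ) ∧
    (t'.I = fun i => Poly.rename σ (t.I i))

end DSOP

end SumOverPaths

end

/-! Multilinear polynomials are determined by their values at bits, so equalities and occurrences of
variables are tested by evaluation. Summing out the fresh variables of the CPM construction turns
the interpretation into `dens`: its coefficient at `x₁`, `x₂` is `s ^ 2` times the sum of
`e^{2iπ(P(a) - P(b))}` over pairs of paths `a`, `b` whose legs (ket, then bra) take the values `x₁`,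
`x₂` and which agree on every discarded polynomial.

Soundness. The Clifford conditions are relaxed to `Good`: positive scalar, phase with vanishing
third differences, affine legs and discards. The vanishing of third differences is stable under
affine substitution, and on coefficients it says that those of degree 1 are killed by 4, those of
degree 2 by 2, and those of higher degree vanish. `Step.good` shows that each rule preserves both
`Good` and `dens`: a rule sums out one variable, or changes variables by `y ↦ y + q`, or alters only
what the two copies already share, or replaces a term with zero interpretation by another.

Shape of terminal terms. By `IsTerminal.isNormal`, a good terminal term is either the zero form or
normal. In a normal term the discarded polynomials are single variables, no phase monomial lies
entirely in discarded variables, and every summation variable occurs in a leg. At the first leg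
where a variable `y` occurs, the leg is exactly `y` if `y` is not discarded, and otherwise `y` plus
a sum of variables that are not discarded.

Uniqueness. In a normal term each leg introduces at most one variable, so the legs form a triangular
system and determine the path. Each coefficient at a pair of outputs is therefore given by one pair
of paths: the diagonal gives the scalar and the set of possible outputs, the zero pattern gives
agreement on discarded variables, and the arguments give phase differences. From these
`exists_renaming` matches the variables leg by leg. Then `IsNormal.alphaEq` compares a path with the
one obtained by zeroing all variables that are not discarded; the phase vanishes on the latter, so
phase differences become phases. The zero form has zero density while a normal term does not, which
separates the two cases. -/

noncomputable section

open scoped Classical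

namespace SumOverPaths

universe u w

/-! ### Values of multilinear polynomials at bits -/

section Evaluation

variable {V W : Type u} {M : Type w} [AddCommGroup M]

/-- A monomial takes the value `1` at an assignment. -/
def Mon.Holds (a : V → ZMod 2) (S : Mon V) : Prop := ∀ v ∈ S.vars, a v = 1

/-- The value at bits of a multilinear polynomial with coefficients in an abelian group. -/
def ev (a : V → ZMod 2) (f : Mon V →₀ M) : M := f.sum fun S c => if S.Holds a then c else 0

/-- The indicator of a finite set of variables. -/
def ind (T : Finset V) : V → ZMod 2 := fun v => if v ∈ T then 1 else 0

theorem zmod_two_cases (x : ZMod 2) : x = 0 ∨ x = 1 := by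
  revert x; decide

theorem zmod_two_ne_one {x : ZMod 2} : x ≠ 1 ↔ x = 0 := by
  revert x; decide

theorem zmod_two_ne_zero {x : ZMod 2} : x ≠ 0 ↔ x = 1 := by
  revert x; decide

theorem zmod_two_add_self (x : ZMod 2) : x + x = 0 := by
  revert x; decide

theorem Mon.holds_congr {a b : V → ZMod 2} {S : Mon V} (h : ∀ v ∈ S.vars, a v = b v) :
    S.Holds a ↔ S.Holds b :=
  forall₂_congr fun v hv => by rw [h v hv]

theorem Mon.holds_ind {S : Mon V} {T : Finset V} : S.Holds (ind T) ↔ S.vars ⊆ T := by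
  refine forall₂_congr fun v _ => ?_
  simp [ind]

theorem Mon.holds_one (a : V → ZMod 2) : (1 : Mon V).Holds a := by
  intro v hv
  exact absurd hv (Finset.notMem_empty v)

theorem Mon.holds_mul {a : V → ZMod 2} {S T : Mon V} :
    (S * T).Holds a ↔ S.Holds a ∧ T.Holds a := by
  show (∀ v ∈ S.vars ∪ T.vars, a v = 1) ↔ _
  simp only [Finset.mem_union, or_imp, forall_and]
  rfl

theorem Mon.holds_of_singleton {a : V → ZMod 2} {v : V} : (Mon.of {v}).Holds a ↔ a v = 1 := by
  show (∀ x ∈ ({v} : Finset V), a x = 1) ↔ _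
  simp

theorem Mon.prod_val (a : V → ZMod 2) (S : Mon V) :
    ∏ v ∈ S.vars, (a v).val = if S.Holds a then 1 else 0 := by
  split_ifs with h
  · exact Finset.prod_eq_one fun v hv => by rw [h v hv]; rfl
  · simp only [Mon.Holds, not_forall] at h
    obtain ⟨v, hv, hne⟩ := h
    exact Finset.prod_eq_zero hv (by rw [zmod_two_ne_one.1 hne]; rfl)

theorem ev_zero (a : V → ZMod 2) : ev a (0 : Mon V →₀ M) = 0 := by simp [ev]

theorem ev_single (a : V → ZMod 2) (S : Mon V) (c : M) :
    ev a (Finsupp.single S c) = if S.Holds a then c else 0 := by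
  unfold ev
  rw [Finsupp.sum_single_index]
  simp

theorem ev_add (a : V → ZMod 2) (f g : Mon V →₀ M) : ev a (f + g) = ev a f + ev a g := by
  unfold ev
  rw [Finsupp.sum_add_index']
  · simp
  · intro S b c; split_ifs <;> simp

/-- Evaluation as a homomorphism. -/
def evHom (a : V → ZMod 2) : (Mon V →₀ M) →+ M := ⟨⟨ev a, ev_zero a⟩, ev_add a⟩

theorem ev_sub (a : V → ZMod 2) (f g : Mon V →₀ M) : ev a (f - g) = ev a f - ev a g :=
  map_sub (evHom a) f g

theorem ev_sum {ι : Type*} (a : V → ZMod 2) (s : Finset ι) (f : ι → Mon V →₀ M) :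
    ev a (∑ i ∈ s, f i) = ∑ i ∈ s, ev a (f i) := map_sum (evHom a) f s

theorem ev_congr {a b : V → ZMod 2} {f : Mon V →₀ M} (h : ∀ v ∈ coeffVars f, a v = b v) :
    ev a f = ev b f := by
  refine Finset.sum_congr rfl fun S hS => ?_
  have : S.Holds a ↔ S.Holds b :=
    Mon.holds_congr fun v hv => h v (Finset.mem_biUnion.2 ⟨S, hS, hv⟩)
  simp only [this]

/-- Evaluate at the indicator of a monomial `S` of least size in the support: a monomial that holds
there is contained in `S`, hence equal to it by minimality, so the value is the coefficient of `S`.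
-/
theorem eq_zero_of_ev {f : Mon V →₀ M} (h : ∀ a, ev a f = 0) : f = 0 := by
  by_contra hf
  obtain ⟨S, hS, hmin⟩ := Finset.exists_min_image f.support (fun S => S.vars.card)
    (Finsupp.support_nonempty_iff.2 hf)
  refine Finsupp.mem_support_iff.1 hS ?_
  rw [← h (ind S.vars), ev, Finsupp.sum, Finset.sum_eq_single S]
  · rw [if_pos (Mon.holds_ind.2 subset_rfl)]
  · intro T hT hne
    rw [if_neg]
    intro hle
    exact hne (Finset.eq_of_subset_of_card_le (Mon.holds_ind.1 hle) (hmin T hT))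
  · intro hS'; exact absurd hS hS'

theorem ev_injective {f g : Mon V →₀ M} (h : ∀ a, ev a f = ev a g) : f = g :=
  sub_eq_zero.1 (eq_zero_of_ev fun a => by rw [ev_sub, h a, sub_self])

/-- The quotient of a polynomial by a variable. -/
def deriv (v : V) (f : Mon V →₀ M) : Mon V →₀ M :=
  f.sum fun S c => if v ∈ S.vars then Finsupp.single (Mon.of (S.vars.erase v)) c else 0

theorem ev_deriv (a : V → ZMod 2) (v : V) (f : Mon V →₀ M) :
    ev a (deriv v f) = ev (Function.update a v 1) f - ev (Function.update a v 0) f := by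
  rw [deriv, Finsupp.sum, ev_sum]
  unfold ev
  rw [Finsupp.sum, Finsupp.sum, ← Finset.sum_sub_distrib]
  refine Finset.sum_congr rfl fun S _ => ?_
  by_cases hv : v ∈ S.vars
  · have h0 : ¬ S.Holds (Function.update a v 0) := fun h => by
      have := h v hv
      simp at this
    have h1 : S.Holds (Function.update a v 1) ↔ (Mon.of (S.vars.erase v)).Holds a := by
      constructor
      · intro h x hx
        have hx' := Finset.mem_erase.1 hx
        have := h x hx'.2
        rwa [Function.update_of_ne hx'.1] at this
      · intro h x hx
        by_cases hxv : x = v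
        · rw [hxv, Function.update_self]
        · rw [Function.update_of_ne hxv]
          exact h x (Finset.mem_erase.2 ⟨hxv, hx⟩)
    rw [if_pos hv]
    rw [if_neg h0, sub_zero]
    simp only [h1]
    exact ev_single _ _ _
  · have : S.Holds (Function.update a v 1) ↔ S.Holds (Function.update a v 0) :=
      Mon.holds_congr fun x hx => by
        have : x ≠ v := fun h => hv (h ▸ hx)
        simp [this]
    rw [if_neg hv]
    simp only [this, sub_self]
    exact ev_zero a

theorem deriv_apply {v : V} {S : Mon V} (hv : v ∉ S.vars) (f : Mon V →₀ M) :
    deriv v f S = f (Mon.of (insert v S.vars)) := by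
  have key : ∀ T : Mon V, (if v ∈ T.vars then Finsupp.single (Mon.of (T.vars.erase v)) (f T)
      else 0) S = if T = Mon.of (insert v S.vars) then f T else 0 := by
    intro T
    by_cases hT : v ∈ T.vars
    · rw [if_pos hT, Finsupp.single_apply]
      refine if_congr ⟨fun h => ?_, fun h => ?_⟩ rfl rfl
      · subst h; exact (Finset.insert_erase hT).symm
      · subst h; exact Finset.erase_insert hv
    · rw [if_neg hT, if_neg]
      · rfl
      · rintro rfl; exact hT (Finset.mem_insert_self v _)
  rw [deriv, Finsupp.sum, Finsupp.finsetSum_apply, Finset.sum_congr rfl fun T _ => key T,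
    Finset.sum_ite_eq' ]
  split_ifs with h
  · rfl
  · exact (Finsupp.notMem_support_iff.1 h).symm

theorem deriv_apply_of_mem {v : V} {S : Mon V} (hv : v ∈ S.vars) (f : Mon V →₀ M) :
    deriv v f S = 0 := by
  rw [deriv, Finsupp.sum, Finsupp.finsetSum_apply]
  refine Finset.sum_eq_zero fun T _ => ?_
  split_ifs with hT
  · rw [Finsupp.single_apply, if_neg]
    rintro rfl
    exact Finset.notMem_erase v _ hv
  · rfl

theorem apply_eq_deriv {v : V} {S : Mon V} (hv : v ∈ S.vars) (f : Mon V →₀ M) :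
    f S = deriv v f (Mon.of (S.vars.erase v)) := by
  refine Eq.trans (congrArg f ?_)
    (deriv_apply (S := Mon.of (S.vars.erase v)) (Finset.notMem_erase v _) f).symm
  exact (Finset.insert_erase hv).symm

theorem notMem_coeffVars_deriv (v : V) (f : Mon V →₀ M) : v ∉ coeffVars (deriv v f) := fun h => by
  obtain ⟨S, hS, hv⟩ := mem_coeffVars.1 h
  exact hS (deriv_apply_of_mem hv f)

theorem coeffVars_deriv_subset (v : V) (f : Mon V →₀ M) :
    coeffVars (deriv v f) ⊆ coeffVars f := fun x h => by
  obtain ⟨S, hS, hx⟩ := mem_coeffVars.1 h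
  have hv : v ∉ S.vars := fun hv => hS (deriv_apply_of_mem hv f)
  rw [deriv_apply hv] at hS
  exact mem_coeffVars.2 ⟨_, hS, Finset.mem_insert_of_mem hx⟩

/-- Turns syntactic freshness into invariance of values. If the values ignore `v`, the quotient by
`v` evaluates to zero everywhere, hence is zero, and its coefficients are those of the monomials
containing `v`. -/
theorem notMem_coeffVars_iff {f : Mon V →₀ M} {v : V} :
    v ∉ coeffVars f ↔ ∀ a c, ev (Function.update a v c) f = ev a f := by
  constructor
  · intro h a c
    refine ev_congr fun x hx => ?_
    rw [Function.update_of_ne]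
    rintro rfl; exact h hx
  · intro h hv
    obtain ⟨S, hS, hvS⟩ := mem_coeffVars.1 hv
    refine hS ?_
    have h0 : deriv v f = 0 := eq_zero_of_ev fun a => by rw [ev_deriv, h, h, sub_self]
    rw [apply_eq_deriv hvS, h0]
    rfl

theorem coeffVars_subset_iff {f : Mon V →₀ M} {B : Finset V} :
    coeffVars f ⊆ B ↔ ∀ a b : V → ZMod 2, (∀ v ∈ B, a v = b v) → ev a f = ev b f := by
  constructor
  · intro h a b hab
    exact ev_congr fun v hv => hab v (h hv)
  · intro h v hv
    by_contra hvB
    refine notMem_coeffVars_iff.2 (fun a c => h _ _ fun x hx => ?_) hv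
    rw [Function.update_of_ne]
    rintro rfl; exact hvB hx

/-- Only monomials in the variables set to `1` contribute. Used with `p` meaning "discarded", to
kill the phase of a normal term. -/
theorem ev_eq_zero {f : Mon V →₀ M} {p : V → Prop} {a : V → ZMod 2} (ha : ∀ v, a v = 1 → p v)
    (h : ∀ S : Mon V, (∀ v ∈ S.vars, p v) → f S = 0) : ev a f = 0 := by
  refine Finset.sum_eq_zero fun S _ => ?_
  show (if S.Holds a then f S else 0) = 0
  split_ifs with hS
  · exact h S fun v hv => ha v (hS v hv)
  · rfl

end Evaluation

namespace Poly

variable {V W : Type u} {R : Type w} [CommRing R]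

/-- The value of monomials, as a homomorphism. -/
def monHom (a : V → ZMod 2) : Mon V →* R where
  toFun S := if S.Holds a then 1 else 0
  map_one' := if_pos (Mon.holds_one a)
  map_mul' S T := by
    simp only [Mon.holds_mul, ite_and]
    split_ifs <;> simp

/-- The value of polynomials at bits, as a ring homomorphism. -/
def val (a : V → ZMod 2) : Poly V R →ₐ[R] R := MonoidAlgebra.lift R R (Mon V) (monHom a)

theorem val_eq_ev (a : V → ZMod 2) (p : Poly V R) : val a p = ev a p.coeff := by
  rw [val, MonoidAlgebra.lift_apply]
  refine Finset.sum_congr rfl fun S _ => ?_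
  show p.coeff S • (if S.Holds a then (1 : R) else 0) = _
  split_ifs with h <;> simp [h]

theorem val_single (a : V → ZMod 2) (S : Mon V) (c : R) :
    val a (MonoidAlgebra.single S c) = if S.Holds a then c else 0 := by
  rw [val_eq_ev, MonoidAlgebra.coeff_single, ev_single]

theorem val_injective {p q : Poly V R} (h : ∀ a, val a p = val a q) : p = q :=
  MonoidAlgebra.coeff_injective (ev_injective fun a => by rw [← val_eq_ev, ← val_eq_ev, h])

theorem val_X (a : V → ZMod 2) (v : V) : val a (X v : BPoly V) = a v := by
  rw [X, val_single]
  rcases zmod_two_cases (a v) with h | h <;> simp [Mon.holds_of_singleton, h]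

theorem val_X_int (a : V → ZMod 2) (v : V) : val a (X v : IPoly V) = ((a v).val : ℤ) := by
  rw [X, val_single]
  rcases zmod_two_cases (a v) with h | h <;> simp [Mon.holds_of_singleton, h, ZMod.val_one]

theorem eval_eq_val (a : V → ZMod 2) (p : BPoly V) : eval a p = val a p := by
  rw [val_eq_ev]
  refine Finset.sum_congr rfl fun S _ => ?_
  show p.coeff S * _ = _
  have : ∏ v ∈ S.vars, a v = if S.Holds a then 1 else 0 := by
    have h := congrArg (Nat.cast : ℕ → ZMod 2) (Mon.prod_val a S)
    push_cast at h
    simpa using h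
  rw [this]
  split_ifs with h <;> simp [h]

theorem val_congr {a b : V → ZMod 2} {p : Poly V R} (h : ∀ v ∈ vars p, a v = b v) :
    val a p = val b p := by
  rw [val_eq_ev, val_eq_ev]; exact ev_congr h

theorem notMem_vars_iff {p : Poly V R} {v : V} :
    v ∉ vars p ↔ ∀ a c, val (Function.update a v c) p = val a p := by
  simp only [val_eq_ev]; exact notMem_coeffVars_iff

theorem vars_subset_iff {p : Poly V R} {B : Finset V} :
    vars p ⊆ B ↔ ∀ a b : V → ZMod 2, (∀ v ∈ B, a v = b v) → val a p = val b p := by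
  simp only [val_eq_ev]; exact coeffVars_subset_iff

theorem val_bind (a : W → ZMod 2) (f : V → BPoly W) (p : BPoly V) :
    val a (bind f p) = val (fun v => val a (f v)) p := by
  rw [bind, Finsupp.sum, map_sum, val_eq_ev _ p]
  refine Finset.sum_congr rfl fun S _ => ?_
  rw [map_smul, map_prod]
  have : ∏ v ∈ S.vars, val a (f v) = if S.Holds (fun v => val a (f v)) then 1 else 0 := by
    have h := congrArg (Nat.cast : ℕ → ZMod 2) (Mon.prod_val (fun v => val a (f v)) S)
    push_cast at h
    simpa using h
  rw [this]
  split_ifs with h <;> simp [h]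

theorem val_subst (a : V → ZMod 2) (y : V) (q p : BPoly V) :
    val a (subst y q p) = val (Function.update a y (val a q)) p := by
  rw [subst, val_bind]
  congr 2
  funext v
  by_cases h : v = y
  · subst h; simp
  · simp [h, val_X]

theorem val_rename (a : W → ZMod 2) (f : V → W) (p : BPoly V) :
    val a (rename f p) = val (fun v => a (f v)) p := by
  rw [rename, val_bind]
  simp only [val_X]

theorem val_prod_int (a : W → ZMod 2) (f : V → IPoly W) (b : V → ZMod 2)
    (h : ∀ v, val a (f v) = ((b v).val : ℤ)) (S : Mon V) :
    val a (∏ v ∈ S.vars, f v) = if S.Holds b then 1 else 0 := by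
  rw [map_prod, Finset.prod_congr rfl fun v _ => h v]
  exact_mod_cast congrArg (Nat.cast : ℕ → ℤ) (Mon.prod_val b S)

theorem val_rename_int (a : W → ZMod 2) (f : V → W) (p : IPoly V) :
    val a (rename f p) = val (fun v => a (f v)) p := by
  rw [rename, bind, Finsupp.sum, map_sum, val_eq_ev _ p]
  refine Finset.sum_congr rfl fun S _ => ?_
  rw [map_smul, val_prod_int a _ (fun v => a (f v)) fun v => val_X_int _ _]
  split_ifs with h <;> simp [h]

theorem mem_monomials {p : Poly V R} {S : Mon V} : S ∈ monomials p ↔ p.coeff S ≠ 0 :=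
  Finsupp.mem_support_iff

theorem mem_vars {p : Poly V R} {v : V} : v ∈ vars p ↔ ∃ S, p.coeff S ≠ 0 ∧ v ∈ S.vars :=
  mem_coeffVars

end Poly

open SumOverPaths.Poly

/-! ### Values of the integer lift and of phases -/

section Hat

variable {V W : Type u}

theorem BPoly.val_eq_sum (a : V → ZMod 2) (Q : BPoly V) :
    val a Q = ∑ S ∈ monomials Q, if S.Holds a then 1 else 0 := by
  rw [val_eq_ev]
  refine Finset.sum_congr rfl fun S hS => ?_
  rw [zmod_two_ne_zero.1 (mem_monomials.1 hS)]

/-- On the integers `0` and `1` the operation `p + q - 2 p q` is the exclusive or, so the fold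
follows the sum modulo 2 monomial by monomial. -/
theorem BPoly.val_hat (a : V → ZMod 2) (Q : BPoly V) :
    val a (BPoly.hat Q) = ((val a Q).val : ℤ) := by
  have key : ∀ s : Finset (Mon V),
      val a (s.fold xorOp 0 fun S => (MonoidAlgebra.single S 1 : IPoly V)) =
        ((∑ S ∈ s, if S.Holds a then (1 : ZMod 2) else 0).val : ℤ) := by
    intro s
    induction s using Finset.induction_on with
    | empty => simp
    | insert S s hS ih =>
      rw [Finset.fold_insert hS, Finset.sum_insert hS, xorOp, map_sub, map_add, map_mul, map_mul,
        ih, val_single, map_ofNat]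
      generalize (∑ S ∈ s, if S.Holds a then (1 : ZMod 2) else 0) = x
      split_ifs <;> revert x <;> decide
  rw [BPoly.val_eq_sum]
  exact key _

theorem Phase.eval_eq_ev (a : V → ZMod 2) (P : Phase V) : Phase.eval a P = ev a P := by
  refine Finset.sum_congr rfl fun S _ => ?_
  show (∏ v ∈ S.vars, (a v).val) • P S = _
  rw [Mon.prod_val]
  split_ifs with h <;> simp [h]

theorem ev_scale (a : V → ZMod 2) (α : UnitAddCircle) (p : IPoly V) :
    ev a (Phase.scale α p) = val a p • α := by
  rw [val_eq_ev]
  unfold ev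
  rw [Phase.scale, Finsupp.sum_mapRange_index (fun _ => by simp), Finsupp.sum, Finsupp.sum,
    Finset.sum_smul]
  refine Finset.sum_congr rfl fun S _ => ?_
  split_ifs <;> simp

/-- The substituted integer polynomials must take bit values, since monomials carry no exponents;
this is what lifting by `hat` ensures. -/
theorem ev_bind (a : W → ZMod 2) (f : V → IPoly W) (b : V → ZMod 2)
    (hf : ∀ v, val a (f v) = ((b v).val : ℤ)) (P : Phase V) :
    ev a (Phase.bind f P) = ev b P := by
  rw [Phase.bind, Finsupp.sum, ev_sum]
  refine Finset.sum_congr rfl fun S _ => ?_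
  rw [ev_scale, val_prod_int a f b hf]
  split_ifs with h <;> simp [h]

theorem ev_subst (a : V → ZMod 2) (y : V) (q : BPoly V) (P : Phase V) :
    ev a (Phase.subst y (BPoly.hat q) P) = ev (Function.update a y (val a q)) P := by
  refine ev_bind a _ _ (fun v => ?_) P
  by_cases h : v = y
  · subst h; simp [BPoly.val_hat]
  · simp [h, val_X_int]

theorem ev_rename (a : W → ZMod 2) (f : V → W) (P : Phase V) :
    ev a (Phase.rename f P) = ev (fun v => a (f v)) P :=
  ev_bind a _ _ (fun _ => val_X_int _ _) P

end Hat

/-! ### Sums over paths -/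

section PathSum

variable {V W : Type u}

/-- The character `x ↦ e^{2iπx}`. -/
def cis (x : UnitAddCircle) : ℂ := (AddCircle.toCircle x : ℂ)

theorem cis_zero : cis 0 = 1 := by simp [cis]

theorem cis_add (x y : UnitAddCircle) : cis (x + y) = cis x * cis y := by
  simp [cis, AddCircle.toCircle_add]

theorem cis_conj (x : UnitAddCircle) : (starRingEnd ℂ) (cis x) = cis (-x) := by
  rw [cis, cis, AddCircle.toCircle_neg, Circle.coe_inv_eq_conj]

theorem cis_mul_conj (x y : UnitAddCircle) :
    cis x * (starRingEnd ℂ) (cis y) = cis (x - y) := by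
  rw [cis_conj, ← cis_add, sub_eq_add_neg]

theorem cis_ne_zero (x : UnitAddCircle) : cis x ≠ 0 := Circle.coe_ne_zero _

theorem cis_injective : Function.Injective cis := fun _ _ h =>
  AddCircle.injective_toCircle one_ne_zero (Circle.coe_injective h)

theorem cis_sum {ι : Type*} (s : Finset ι) (f : ι → UnitAddCircle) :
    cis (∑ i ∈ s, f i) = ∏ i ∈ s, cis (f i) := by
  induction s using Finset.induction_on with
  | empty => simp [cis_zero]
  | insert i s hi ih => rw [Finset.sum_insert hi, Finset.prod_insert hi, cis_add, ih]

theorem cis_half : cis half = -1 := by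
  rw [cis, half, AddCircle.toCircle_apply_mk, Circle.coe_exp]
  rw [show ((2 * Real.pi / 1 * (1 / 2) : ℝ) : ℂ) = Real.pi by push_cast; ring]
  exact Complex.exp_pi_mul_I

theorem half_add_half : half + half = 0 := by
  rw [half, ← AddCircle.coe_add]
  norm_num

theorem quarter_add_quarter : quarter + quarter = half := by
  rw [quarter, half, ← AddCircle.coe_add]
  norm_num

theorem half_ne_zero : half ≠ 0 := fun h => by
  have := cis_half
  rw [h, cis_zero] at this
  norm_num at this

/-- The sum of a function over the assignments of bits to the variables of a finite set. -/
def psum (B : Finset V) (g : (V → ZMod 2) → ℂ) : ℂ := ∑ T ∈ B.powerset, g (ind T)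

/-- The variables of a finite set to which an assignment gives the value `1`. -/
def trueSet (B : Finset V) (a : B → ZMod 2) : Finset V := B.filter fun v => extend B a v = 1

theorem ind_trueSet (B : Finset V) (a : B → ZMod 2) : ind (trueSet B a) = extend B a := by
  funext v
  have hm : v ∈ trueSet B a ↔ v ∈ B ∧ extend B a v = 1 := Finset.mem_filter
  by_cases hv : v ∈ B
  · rcases zmod_two_cases (extend B a v) with h | h <;> simp [ind, hm, hv, h]
  · simp [ind, hm, extend, hv]

theorem sum_extend (B : Finset V) (g : (V → ZMod 2) → ℂ) :
    ∑ a : B → ZMod 2, g (extend B a) = psum B g := by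
  refine Finset.sum_bij' (fun a _ => trueSet B a) (fun T _ v => ind T v)
    (fun a _ => Finset.mem_powerset.2 (Finset.filter_subset _ _)) (fun _ _ => Finset.mem_univ _)
    ?_ ?_ ?_
  · intro a _
    funext v
    show ind (trueSet B a) v = a v
    rw [ind_trueSet]
    simp [extend]
  · intro T hT
    refine Finset.ext fun v => Finset.mem_filter.trans ?_
    constructor
    · rintro ⟨hv, h⟩
      by_contra hvT
      simp [extend, ind, hv, hvT] at h
    · intro hv
      have := Finset.mem_powerset.1 hT hv
      exact ⟨this, by simp [extend, ind, this, hv]⟩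
  · intro a _
    rw [ind_trueSet]

theorem psum_congr {B : Finset V} {g g' : (V → ZMod 2) → ℂ} (h : ∀ a, g a = g' a) :
    psum B g = psum B g' := by rw [funext h]

theorem psum_mul_left (B : Finset V) (c : ℂ) (g : (V → ZMod 2) → ℂ) :
    psum B (fun a => c * g a) = c * psum B g := (Finset.mul_sum _ _ _).symm

theorem psum_conj (B : Finset V) (g : (V → ZMod 2) → ℂ) :
    (starRingEnd ℂ) (psum B g) = psum B fun a => (starRingEnd ℂ) (g a) := map_sum _ _ _

theorem psum_erase {B : Finset V} {y : V} (hy : y ∈ B) (g : (V → ZMod 2) → ℂ) :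
    psum B g = psum (B.erase y) fun a => g (Function.update a y 0) + g (Function.update a y 1) := by
  unfold psum
  conv_lhs => rw [← Finset.insert_erase hy, Finset.sum_powerset_insert (Finset.notMem_erase y B)]
  rw [← Finset.sum_add_distrib]
  refine Finset.sum_congr rfl fun T hT => ?_
  have hyT : y ∉ T := fun h => Finset.notMem_erase y B (Finset.mem_powerset.1 hT h)
  have h0 : ind T = Function.update (ind T) y 0 := by
    funext v
    by_cases h : v = y
    · subst h; simp [ind, hyT]
    · simp [h]
  have h1 : ind (insert y T) = Function.update (ind T) y 1 := by
    funext v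
    by_cases h : v = y
    · subst h; simp [ind]
    · simp [h, ind]
  show g (ind T) + g (ind (insert y T)) =
    g (Function.update (ind T) y 0) + g (Function.update (ind T) y 1)
  rw [h1, ← h0]

theorem psum_disjSum {V₁ V₂ : Type u} (A : Finset V₁) (B : Finset V₂)
    (g : (V₁ ⊕ V₂ → ZMod 2) → ℂ) :
    psum (A.disjSum B) g = psum A fun a => psum B fun b => g (Sum.elim a b) := by
  unfold psum
  rw [← Finset.sum_product']
  refine Finset.sum_bij' (fun T _ => (T.toLeft, T.toRight)) (fun p _ => p.1.disjSum p.2)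
    ?_ ?_ ?_ ?_ ?_
  · intro T hT
    have := Finset.subset_disjSum.1 (Finset.mem_powerset.1 hT)
    exact Finset.mem_product.2 ⟨Finset.mem_powerset.2 this.1, Finset.mem_powerset.2 this.2⟩
  · intro p hp
    have := Finset.mem_product.1 hp
    exact Finset.mem_powerset.2 (Finset.disjSum_mono (Finset.mem_powerset.1 this.1)
      (Finset.mem_powerset.1 this.2))
  · intro T _; exact Finset.toLeft_disjSum_toRight
  · intro p _; simp
  · intro T _
    congr 1
    funext v
    rcases v with v | v <;> simp [ind]

/-- Carries out the sum over the fresh variables of the CPM construction, whose phases factor over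
the discarded polynomials. -/
theorem psum_prod (B : Finset V) (x : V → ℂ) :
    (psum B fun a => ∏ v ∈ B, if a v = 1 then x v else 1) = ∏ v ∈ B, (1 + x v) := by
  rw [Finset.prod_one_add]
  refine Finset.sum_congr rfl fun T hT => ?_
  have hT' := Finset.mem_powerset.1 hT
  show ∏ v ∈ B, (if ind T v = 1 then x v else 1) = _
  rw [← Finset.prod_subset hT']
  · exact Finset.prod_congr rfl fun v hv => by simp [ind, hv]
  · intro v _ hv
    simp [ind, hv]

end PathSum

/-! ### The interpretation as a density on pairs of paths -/

namespace DSOP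

variable {V : Type u} {n m : ℕ}

/-- The polynomials of the ket followed by those of the bra. -/
def legs (t : DSOP V n m) : Fin (m + n) → BPoly V := Fin.append t.O t.I

/-- The paths `a` and `b` contribute to the coefficient of index `x₁`, `x₂`. -/
def Hit (t : DSOP V n m) (x₁ x₂ : Fin (m + n) → ZMod 2) (a b : V → ZMod 2) : Prop :=
  (∀ i, val a (t.legs i) = x₁ i) ∧ (∀ i, val b (t.legs i) = x₂ i) ∧ ∀ d ∈ t.D, val a d = val b d

/-- The coefficients of the interpretation, as a sum over pairs of paths that agree on the
discarded polynomials. -/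
def dens (t : DSOP V n m) (x₁ x₂ : Fin (m + n) → ZMod 2) : ℂ :=
  (t.s : ℂ) ^ 2 * psum t.bound fun a => psum t.bound fun b =>
    cis (ev a t.P) * (starRingEnd ℂ) (cis (ev b t.P)) * if t.Hit x₁ x₂ a b then 1 else 0

theorem _root_.SumOverPaths.SOP.interp_apply (t : SOP V n m) (z : Fin m → ZMod 2)
    (w : Fin n → ZMod 2) : t.interp z w = (t.s : ℂ) * psum t.bound fun c =>
      if (∀ i, val c (t.O i) = z i) ∧ (∀ i, val c (t.I i) = w i) then cis (ev c t.P) else 0 := by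
  rw [SOP.interp, Matrix.smul_apply, Matrix.sum_apply, ← sum_extend, smul_eq_mul]
  congr 1
  refine Finset.sum_congr rfl fun a _ => ?_
  rw [Matrix.single_apply]
  simp only [funext_iff, eval_eq_val, Phase.eval_eq_ev]
  rfl

/-- The assignment of the CPM construction given by two paths and the bits of the fresh
variables. -/
def cpmPath (a b : V → ZMod 2) (z : BPoly V → ZMod 2) : CPMVar V → ZMod 2 :=
  Sum.elim a (Sum.elim b z)

theorem psum_cpmBound (t : DSOP V n m) (g : (CPMVar V → ZMod 2) → ℂ) :
    psum t.cpmBound g = psum t.bound fun a => psum t.bound fun b => psum t.D fun z =>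
      g (cpmPath a b z) := by
  refine (psum_disjSum t.bound (t.bound.disjSum t.D) g).trans (psum_congr fun a => ?_)
  exact psum_disjSum t.bound t.D fun b => g (Sum.elim a b)

theorem forall_append_iff {k : ℕ} (f : Fin k → BPoly V) (a b : V → ZMod 2)
    (z : BPoly V → ZMod 2) (z₁ z₂ : Fin k → ZMod 2) :
    (∀ i, val (cpmPath a b z) (Fin.append (fun j => Poly.rename copy₁ (f j))
      (fun j => Poly.rename copy₂ (f j)) i) = Fin.append z₁ z₂ i) ↔
    (∀ j, val a (f j) = z₁ j) ∧ ∀ j, val b (f j) = z₂ j := by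
  rw [Fin.forall_fin_add]
  simp only [Fin.append_left, Fin.append_right, val_rename]
  rfl

theorem ev_cpmPhase (t : DSOP V n m) (a b : V → ZMod 2) (z : BPoly V → ZMod 2) :
    ev (cpmPath a b z) t.cpmPhase = ev a t.P - ev b t.P +
        ∑ d ∈ t.D, if z d = 1 then ((val a d).val + (val b d).val) • half else 0 := by
  have ha : (fun v => cpmPath a b z (copy₁ v)) = a := rfl
  have hb : (fun v => cpmPath a b z (copy₂ v)) = b := rfl
  rw [cpmPhase, ev_add, ev_sub, ev_rename, ev_rename, ev_sum, ha, hb]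
  congr 1
  refine Finset.sum_congr rfl fun d _ => ?_
  rw [ev_scale, map_add, map_mul, map_mul, val_rename_int, val_rename_int, val_X_int,
    BPoly.val_hat, BPoly.val_hat, ← add_mul, ha, hb]
  have hz : cpmPath a b z (fresh d) = z d := rfl
  rw [hz]
  rcases zmod_two_cases (z d) with h | h
  · simp [h]
  · simp only [h, ZMod.val_one, if_true]
    push_cast
    rw [mul_one, ← Nat.cast_add, natCast_zsmul]

theorem one_add_cis_half (x y : ZMod 2) :
    1 + cis ((x.val + y.val) • half) = if x = y then 2 else 0 := by
  have h2 : (2 : ℕ) • half = 0 := by rw [two_nsmul, half_add_half]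
  rcases zmod_two_cases x with rfl | rfl <;> rcases zmod_two_cases y with rfl | rfl <;>
    simp [ZMod.val_one, cis_half, cis_zero, h2] <;> norm_num

/-- The fresh variable of `d` contributes `1 + (-1)^{d(a) + d(b)}`, which is `2` if the copies agree
on `d` and `0` otherwise. The indices are regrouped by copy instead of by ket and bra. -/
theorem interp_append (t : DSOP V n m) (x₁ x₂ : Fin (m + n) → ZMod 2) :
    t.interp (Fin.append (fun i => x₁ (Fin.castAdd n i)) fun i => x₂ (Fin.castAdd n i))
      (Fin.append (fun i => x₁ (Fin.natAdd m i)) fun i => x₂ (Fin.natAdd m i)) =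
      t.dens x₁ x₂ := by
  have hit : ∀ a b : V → ZMod 2, t.Hit x₁ x₂ a b ↔
      (((∀ j, val a (t.O j) = x₁ (Fin.castAdd n j)) ∧ ∀ j, val b (t.O j) = x₂ (Fin.castAdd n j)) ∧
      ((∀ j, val a (t.I j) = x₁ (Fin.natAdd m j)) ∧ ∀ j, val b (t.I j) = x₂ (Fin.natAdd m j))) ∧
      ∀ d ∈ t.D, val a d = val b d := by
    intro a b
    rw [Hit, Fin.forall_fin_add, Fin.forall_fin_add]
    simp only [legs, Fin.append_left, Fin.append_right]
    tauto
  rw [interp, SOP.interp_apply]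
  simp only [cpm]
  rw [psum_cpmBound]
  simp only [forall_append_iff]
  rw [dens, ← psum_mul_left, ← psum_mul_left]
  refine psum_congr fun a => ?_
  rw [← psum_mul_left, ← psum_mul_left]
  refine psum_congr fun b => ?_
  have key : ∀ z : BPoly V → ZMod 2, cis (ev (cpmPath a b z) t.cpmPhase) =
      cis (ev a t.P) * (starRingEnd ℂ) (cis (ev b t.P)) *
        ∏ d ∈ t.D, if z d = 1 then cis (((val a d).val + (val b d).val) • half) else 1 := by
    intro z
    rw [ev_cpmPhase, cis_add, cis_mul_conj, cis_sum]
    congr 1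
    exact Finset.prod_congr rfl fun d _ => by split_ifs <;> simp [cis_zero]
  by_cases h : ((∀ j, val a (t.O j) = x₁ (Fin.castAdd n j)) ∧
      ∀ j, val b (t.O j) = x₂ (Fin.castAdd n j)) ∧
      ((∀ j, val a (t.I j) = x₁ (Fin.natAdd m j)) ∧ ∀ j, val b (t.I j) = x₂ (Fin.natAdd m j))
  · simp only [if_pos h, key]
    rw [psum_mul_left, psum_prod, Finset.prod_congr rfl fun d _ => one_add_cis_half _ _]
    by_cases hD : ∀ d ∈ t.D, val a d = val b d
    -- All factors equal `2`, and their product cancels the normalization `2 ^ |D|`.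
    · rw [if_pos ((hit a b).2 ⟨h, hD⟩), Finset.prod_congr rfl fun d hd => if_pos (hD d hd),
        Finset.prod_const]
      push_cast
      field_simp
    · rw [if_neg fun hh => hD ((hit a b).1 hh).2]
      push Not at hD
      obtain ⟨d, hd, hne⟩ := hD
      rw [Finset.prod_eq_zero hd (if_neg hne)]
      simp
  · rw [if_neg fun hh => h ((hit a b).1 hh).1]
    simp only [if_neg h]
    simp [psum]

theorem dens_eq_of_interp_eq {t t' : DSOP V n m} (h : t.interp = t'.interp) :
    t.dens = t'.dens := by
  funext x₁ x₂
  rw [← interp_append, ← interp_append, h]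

end DSOP

/-! ### Affine polynomials and quadratic phases -/

section Quadratic

variable {V : Type u} {M : Type w} [AddCommGroup M]

/-- The homomorphism from bits to phases that sends `1` to `1 / 2`. -/
def chi : ZMod 2 →+ UnitAddCircle where
  toFun x := x.val • half
  map_zero' := by simp
  map_add' x y := by
    have h2 : (2 : ℕ) • half = 0 := by rw [two_nsmul, half_add_half]
    rcases zmod_two_cases x with rfl | rfl <;> rcases zmod_two_cases y with rfl | rfl <;>
      simp [ZMod.val_one, one_add_one_eq_two, half_add_half]
    rfl

theorem chi_apply (x : ZMod 2) : chi x = x.val • half := rfl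

theorem chi_injective : Function.Injective chi := by
  rw [injective_iff_map_eq_zero]
  intro x hx
  rcases zmod_two_cases x with rfl | rfl
  · rfl
  · rw [chi_apply, ZMod.val_one, one_smul] at hx
    exact absurd hx half_ne_zero

/-- A map on assignments is affine. -/
def IsAffineMap (φ : (V → ZMod 2) → V → ZMod 2) : Prop :=
  ∀ x h, φ (x + h) = φ x + (φ h + φ 0)

/-- A boolean polynomial is affine. -/
def IsAffine (p : BPoly V) : Prop := ∀ x h, val (x + h) p = val x p + (val h p + val 0 p)

/-- The third differences of a function on assignments vanish. -/
def Quadratic (F : (V → ZMod 2) → M) : Prop :=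
  ∀ x h k l, F (x + h + k + l) + F (x + h) + F (x + k) + F (x + l) =
    F (x + h + k) + F (x + h + l) + F (x + k + l) + F x

theorem Quadratic.add {F G : (V → ZMod 2) → M} (hF : Quadratic F) (hG : Quadratic G) :
    Quadratic fun a => F a + G a := fun x h k l => by
  have := congrArg₂ (· + ·) (hF x h k l) (hG x h k l)
  simp only at this ⊢
  rw [show F (x + h + k + l) + G (x + h + k + l) + (F (x + h) + G (x + h)) +
    (F (x + k) + G (x + k)) + (F (x + l) + G (x + l)) = F (x + h + k + l) + F (x + h) +
    F (x + k) + F (x + l) + (G (x + h + k + l) + G (x + h) + G (x + k) + G (x + l)) by abel, this]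
  abel

theorem Quadratic.neg {F : (V → ZMod 2) → M} (hF : Quadratic F) :
    Quadratic fun a => -F a := fun x h k l => by
  have := congrArg Neg.neg (hF x h k l)
  simp only [neg_add] at this ⊢
  exact this

theorem Quadratic.const (c : M) : Quadratic fun _ : V → ZMod 2 => c := fun _ _ _ _ => rfl

theorem Quadratic.sum {ι : Type*} (s : Finset ι) (F : ι → (V → ZMod 2) → M)
    (h : ∀ i ∈ s, Quadratic (F i)) : Quadratic fun a => ∑ i ∈ s, F i a := by
  induction s using Finset.induction_on with
  | empty => simpa using Quadratic.const (V := V) (0 : M)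
  | insert i s hi ih =>
    simp only [Finset.sum_insert hi]
    exact (h i (Finset.mem_insert_self i s)).add
      (ih fun j hj => h j (Finset.mem_insert_of_mem hj))

/-- An affine map sends the cube spanned by `h`, `k`, `l` at `x` to another such cube. This
stability is the reason to work with third differences instead of coefficients. -/
theorem Quadratic.comp {F : (V → ZMod 2) → M} (hF : Quadratic F)
    {φ : (V → ZMod 2) → V → ZMod 2} (hφ : IsAffineMap φ) : Quadratic fun a => F (φ a) :=
  fun x h k l => by
    simp only [hφ (x + h + k) l, hφ (x + h) k, hφ (x + h) l, hφ (x + k) l, hφ x]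
    exact hF _ _ _ _

/-- Reduces third-difference identities for torsion coefficients to congruences between bit
expressions. -/
theorem nsmul_eq_of_mod {c : M} {r A B : ℕ} (hc : r • c = 0) (h : A % r = B % r) :
    A • c = B • c := by
  have key : ∀ N : ℕ, N • c = (N % r) • c := fun N => by
    conv_lhs => rw [← Nat.div_add_mod N r, add_smul, mul_comm, mul_smul, hc, smul_zero, zero_add]
  rw [key A, key B, h]

theorem quadratic_val {c : M} (hc : 4 • c = 0) {p : BPoly V} (hp : IsAffine p) :
    Quadratic fun a => (val a p).val • c := fun x h k l => by
  simp only [hp (x + h + k) l, hp (x + h) k, hp (x + h) l, hp (x + k) l, hp x, ← add_smul]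
  refine nsmul_eq_of_mod hc ?_
  generalize val x p = X
  generalize val h p + val 0 p = H
  generalize val k p + val 0 p = K
  generalize val l p + val 0 p = L
  revert X H K L
  decide

theorem quadratic_mul_val {c : M} (hc : 2 • c = 0) {p q : BPoly V} (hp : IsAffine p)
    (hq : IsAffine q) : Quadratic fun a => ((val a p).val * (val a q).val) • c := fun x h k l => by
  simp only [hp (x + h + k) l, hp (x + h) k, hp (x + h) l, hp (x + k) l, hp x,
    hq (x + h + k) l, hq (x + h) k, hq (x + h) l, hq (x + k) l, hq x, ← add_smul]
  refine nsmul_eq_of_mod hc ?_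
  generalize val x p = X
  generalize val h p + val 0 p = H
  generalize val k p + val 0 p = K
  generalize val l p + val 0 p = L
  generalize val x q = X'
  generalize val h q + val 0 q = H'
  generalize val k q + val 0 q = K'
  generalize val l q + val 0 q = L'
  have hm : ∀ A B : ℕ, (A : ZMod 2) = B → A % 2 = B % 2 := fun A B h =>
    (ZMod.natCast_eq_natCast_iff' A B 2).1 h
  apply hm
  push_cast [ZMod.natCast_val, ZMod.cast_id]
  ring

theorem isAffine_X (v : V) : IsAffine (X v : BPoly V) := fun x h => by
  simp [val_X]

theorem isAffine_zero : IsAffine (0 : BPoly V) := fun x h => by simp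

theorem isAffine_one : IsAffine (1 : BPoly V) := fun x h => by
  simp only [map_one]; decide

theorem IsAffine.add {p q : BPoly V} (hp : IsAffine p) (hq : IsAffine q) : IsAffine (p + q) :=
  fun x h => by
    simp only [map_add, hp x h, hq x h]
    ring

theorem isAffine_update {q : BPoly V} (hq : IsAffine q) (y : V) :
    IsAffineMap fun a => Function.update a y (val a q) := fun x h => by
  funext v
  by_cases hv : v = y
  · subst hv; simp [hq x h]
  · simp [hv]

theorem IsAffine.subst {p q : BPoly V} (hp : IsAffine p) (hq : IsAffine q) (y : V) :
    IsAffine (subst y q p) := fun x h => by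
  have e := isAffine_update hq y x h
  simp only [val_subst]
  simp only at e
  rw [e, hp, hp (Function.update h y (val h q)) (Function.update 0 y (val 0 q))]
  generalize val (Function.update x y (val x q)) p = A
  generalize val (Function.update h y (val h q)) p = B
  generalize val (Function.update 0 y (val 0 q)) p = C
  generalize val 0 p = D
  revert A B C D; decide

theorem isAffine_sum {ι : Type*} (s : Finset ι) (f : ι → BPoly V) (h : ∀ i ∈ s, IsAffine (f i)) :
    IsAffine (∑ i ∈ s, f i) := by
  induction s using Finset.induction_on with
  | empty => simpa using isAffine_zero
  | insert i s hi ih =>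
    rw [Finset.sum_insert hi]
    exact (h i (Finset.mem_insert_self i s)).add
      (ih fun j hj => h j (Finset.mem_insert_of_mem hj))

theorem BPoly.add_self (p : BPoly V) : p + p = 0 :=
  val_injective fun a => by rw [map_add, zmod_two_add_self, map_zero]

theorem BPoly.eq_sum (p : BPoly V) : p = ∑ S ∈ monomials p, MonoidAlgebra.single S 1 :=
  val_injective fun a => by
    rw [BPoly.val_eq_sum, map_sum]
    exact Finset.sum_congr rfl fun S _ => (val_single a S 1).symm

theorem isAffine_of_degreeLE {p : BPoly V} (h : DegreeLE p 1) : IsAffine p := by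
  rw [BPoly.eq_sum p]
  refine isAffine_sum _ _ fun S hS => ?_
  rcases Nat.le_one_iff_eq_zero_or_eq_one.1 (h S hS) with h0 | h1
  · have : S = 1 := Finset.card_eq_zero.1 h0
    rw [this]
    exact isAffine_one
  · obtain ⟨v, hv⟩ := Finset.card_eq_one.1 h1
    have : S = Mon.of {v} := hv
    rw [this]
    exact isAffine_X v

/-- Sums of bits are taken modulo 2, so a degree-one term is quadratic only up to carries, which are
multiples of 4; a product of two bits is quadratic modulo 2. The constant term is unrestricted. -/
theorem quadratic_of_coeff {f : Mon V →₀ M} (h₁ : ∀ S : Mon V, S.vars.card = 1 → 4 • f S = 0)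
    (h₂ : ∀ S : Mon V, S.vars.card = 2 → 2 • f S = 0)
    (h₃ : ∀ S : Mon V, 3 ≤ S.vars.card → f S = 0) : Quadratic fun a => ev a f := by
  refine Quadratic.sum f.support (fun S a => if S.Holds a then f S else 0) fun S hS => ?_
  have e : (fun a : V → ZMod 2 => if S.Holds a then f S else 0) =
      fun a => (∏ v ∈ S.vars, (a v).val) • f S := by
    funext a
    rw [Mon.prod_val]
    split_ifs <;> simp
  have hlt : S.vars.card < 3 := by
    by_contra hge
    exact Finsupp.mem_support_iff.1 hS (h₃ S (not_lt.1 hge))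
  rw [e]
  interval_cases hc : S.vars.card
  · rw [Finset.card_eq_zero.1 hc]
    simpa using Quadratic.const (f S)
  · have h4 := h₁ S hc
    obtain ⟨v, hv⟩ := Finset.card_eq_one.1 hc
    rw [hv]
    simpa [val_X] using quadratic_val h4 (isAffine_X v)
  · have h4 := h₂ S hc
    obtain ⟨v, w, hvw, hv⟩ := Finset.card_eq_two.1 hc
    rw [hv]
    simpa [val_X, Finset.prod_pair hvw] using quadratic_mul_val h4 (isAffine_X v) (isAffine_X w)

theorem update_eq_add_single (a : V → ZMod 2) (v : V) (c : ZMod 2) :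
    Function.update a v c = Function.update a v 0 + Pi.single v c := by
  funext x
  by_cases h : x = v
  · subst h; simp
  · simp [h]

theorem single_add_single_self (v : V) :
    (Pi.single v 1 + Pi.single v 1 : V → ZMod 2) = 0 := by
  rw [← Pi.single_add, zmod_two_add_self, Pi.single_zero]

theorem update_update_eq {u v : V} (huv : u ≠ v) (a : V → ZMod 2) (i j : ZMod 2) :
    Function.update (Function.update a u i) v j =
      Function.update (Function.update a u 0) v 0 + Pi.single u i + Pi.single v j := by
  rw [update_eq_add_single _ v j, Function.update_comm huv, update_eq_add_single _ u i,
    Function.update_comm huv]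

theorem Quadratic.four_nsmul {f : Mon V →₀ M} (h : Quadratic fun a => ev a f) {v : V} {S : Mon V}
    (hv : v ∈ S.vars) : 4 • f S = 0 := by
  have h0 : 4 • deriv v f = 0 := by
    refine eq_zero_of_ev fun a => ?_
    -- With three equal directions, `2h = 0` reduces the identity to `4 F(x + h) = 4 F(x)`.
    have e := h (Function.update a v 0) (Pi.single v 1) (Pi.single v 1) (Pi.single v 1)
    simp only [add_assoc, single_add_single_self, add_zero] at e
    have : ev a (4 • deriv v f) = 4 • ev a (deriv v f) := map_nsmul (evHom a) 4 _
    rw [this, ev_deriv, update_eq_add_single a v 1]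
    rw [← sub_eq_zero] at e
    rw [← e]
    abel
  rw [apply_eq_deriv hv, ← Finsupp.smul_apply, h0]
  rfl

theorem Quadratic.two_nsmul {f : Mon V →₀ M} (h : Quadratic fun a => ev a f) {u v : V} {S : Mon V}
    (huv : u ≠ v) (hu : u ∈ S.vars) (hv : v ∈ S.vars) : 2 • f S = 0 := by
  have h0 : 2 • deriv u (deriv v f) = 0 := by
    refine eq_zero_of_ev fun a => ?_
    -- Repeating the direction `u` makes the third difference twice the mixed second difference in
    -- `u` and `v`, up to sign.
    have e := h (Function.update (Function.update a u 0) v 0) (Pi.single u 1) (Pi.single u 1)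
      (Pi.single v 1)
    have c1 : Function.update (Function.update a u 0) v 0 + Pi.single u 1 + Pi.single u 1 =
        Function.update (Function.update a u 0) v 0 := by
      rw [add_assoc, single_add_single_self, add_zero]
    simp only [c1] at e
    have : ev a (2 • deriv u (deriv v f)) = 2 • ev a (deriv u (deriv v f)) :=
      map_nsmul (evHom a) 2 _
    rw [this, ev_deriv, ev_deriv, ev_deriv, update_update_eq huv a 1 1, update_update_eq huv a 1 0,
      update_update_eq huv a 0 1]
    simp only [Pi.single_zero, add_zero]
    rw [eq_comm, ← sub_eq_zero] at e
    rw [← e]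
    abel
  rw [apply_eq_deriv hv, apply_eq_deriv (v := u) (S := Mon.of (S.vars.erase v))
      (Finset.mem_erase.2 ⟨huv, hu⟩),
    ← Finsupp.smul_apply, h0]
  rfl

theorem Quadratic.eq_zero {f : Mon V →₀ M} (h : Quadratic fun a => ev a f) {S : Mon V}
    (hS : 3 ≤ S.vars.card) : f S = 0 := by
  obtain ⟨u, v, w, hu, hv, hw, huv, huw, hvw⟩ := Finset.two_lt_card_iff.1 hS
  have h0 : deriv u (deriv v (deriv w f)) = 0 := by
    refine eq_zero_of_ev fun a => ?_
    have e := h (Function.update (Function.update (Function.update a u 0) v 0) w 0)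
      (Pi.single u 1) (Pi.single v 1) (Pi.single w 1)
    have c : ∀ i j k : ZMod 2,
        Function.update (Function.update (Function.update a u i) v j) w k =
        Function.update (Function.update (Function.update a u 0) v 0) w 0 + Pi.single u i +
          Pi.single v j + Pi.single w k := by
      intro i j k
      rw [update_update_eq hvw, update_eq_add_single a u i]
      funext x
      by_cases hx : x = u
      · subst hx; simp [huv, huw]
      · by_cases hx' : x = v
        · subst hx'; simp [hvw, huv.symm]
        · by_cases hx'' : x = w
          · subst hx''; simp [hx, hx']
          · simp [hx, hx', hx'']
    rw [ev_deriv, ev_deriv, ev_deriv, ev_deriv, ev_deriv, ev_deriv, ev_deriv, c 1 1 1, c 1 1 0,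
      c 1 0 1, c 1 0 0, c 0 1 1, c 0 1 0, c 0 0 1]
    simp only [Pi.single_zero, add_zero]
    rw [← sub_eq_zero] at e
    rw [← e]
    abel
  rw [apply_eq_deriv hw,
    apply_eq_deriv (v := v) (S := Mon.of (S.vars.erase w)) (Finset.mem_erase.2 ⟨hvw, hv⟩),
    apply_eq_deriv (v := u) (S := Mon.of ((Mon.of (S.vars.erase w)).vars.erase v))
      (Finset.mem_erase.2 ⟨huv, Finset.mem_erase.2 ⟨huw, hu⟩⟩), h0]
  rfl

theorem IsAffine.coeff_eq_zero {p : BPoly V} (hp : IsAffine p) {S : Mon V}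
    (hS : 2 ≤ S.vars.card) : p.coeff S = 0 := by
  obtain ⟨u, v, hu, hv, huv⟩ := Finset.one_lt_card_iff.1 hS
  have h0 : deriv u (deriv v p.coeff) = 0 := by
    refine eq_zero_of_ev fun a => ?_
    rw [ev_deriv, ev_deriv, ev_deriv, update_update_eq huv a 1 1, update_update_eq huv a 1 0,
      update_update_eq huv a 0 1]
    simp only [Pi.single_zero, add_zero, ← val_eq_ev, hp _ (Pi.single v 1),
      hp _ (Pi.single u 1)]
    ring
  rw [apply_eq_deriv hv, apply_eq_deriv (v := u) (S := Mon.of (S.vars.erase v))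
      (Finset.mem_erase.2 ⟨huv, hu⟩), h0]
  rfl

/-- The difference in one variable of a quadratic phase is affine. -/
theorem isAffine_of_slope {F : (V → ZMod 2) → UnitAddCircle} (hF : Quadratic F) {y : V}
    {c : UnitAddCircle} {Q : BPoly V}
    (h : ∀ a, F (Function.update a y 1) - F (Function.update a y 0) = c + chi (val a Q)) :
    IsAffine Q := by
  intro x k
  apply chi_injective
  have key : ∀ a, chi (val a Q) = F (Function.update a y 1) - F (Function.update a y 0) - c :=
    fun a => by rw [h]; abel
  -- One direction is `y` itself and the other two avoid it, so the identity says that the slopes at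
  -- `0` and `x + k` have the same sum as those at `x` and `k`.
  have e := hF 0 (Function.update x y 0) (Function.update k y 0) (Pi.single y 1)
  have hadd : Function.update (x + k) y 0 = Function.update x y 0 + Function.update k y 0 := by
    funext v
    by_cases hv : v = y
    · subst hv; simp
    · simp [hv]
  simp only [zero_add] at e
  have h00 : Function.update (0 : V → ZMod 2) y 0 = 0 := by simp
  rw [map_add, map_add, key, key, key, key, update_eq_add_single (x + k),
    update_eq_add_single x, update_eq_add_single k, update_eq_add_single 0, hadd, h00, zero_add]
  rw [← sub_eq_zero] at e ⊢
  rw [← e]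
  -- The term at `0` appears on the wrong side; being 2-torsion, it may change sign.
  have hc2 : ∀ z, chi z + chi z = 0 := fun z => by rw [← map_add, zmod_two_add_self, map_zero]
  have e0 := hc2 (val 0 Q)
  rw [key, update_eq_add_single 0, h00, zero_add] at e0
  rw [← sub_eq_zero, ← neg_eq_zero, ← e0]
  abel

end Quadratic

/-! ### Sums over one variable and changes of variable -/

section PathSumLemmas

variable {V : Type u}

theorem cis_quarter : cis quarter = Complex.I := by
  rw [cis, quarter, AddCircle.toCircle_apply_mk, Circle.coe_exp]
  rw [show ((2 * Real.pi / 1 * (1 / 4) : ℝ) : ℂ) = Real.pi / 2 by push_cast; ring]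
  exact Complex.exp_pi_div_two_mul_I

theorem cis_eighth : (Real.sqrt 2 : ℂ) * cis eighth = 1 + Complex.I := by
  rw [cis, eighth, AddCircle.toCircle_apply_mk, Circle.coe_exp]
  rw [show (2 * Real.pi / 1 * (1 / 8) : ℝ) = Real.pi / 4 by ring, Complex.exp_mul_I,
    ← Complex.ofReal_cos, ← Complex.ofReal_sin, Real.cos_pi_div_four, Real.sin_pi_div_four]
  have h : (Real.sqrt 2 : ℂ) * Real.sqrt 2 = 2 := by
    rw [← Complex.ofReal_mul, Real.mul_self_sqrt (by norm_num)]; norm_num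
  push_cast
  linear_combination (1 + Complex.I) / 2 * h

/-- The one-variable Gauss sum `1 ± i = √2 e^{±iπ/4}`, which underlies the rule `omega`. -/
theorem one_add_cis_quarter (x : ZMod 2) :
    1 + cis (quarter + chi x) = (Real.sqrt 2 : ℂ) * cis (eighth - x.val • quarter) := by
  rcases zmod_two_cases x with rfl | rfl
  · simp [cis_quarter, cis_eighth]
  · rw [chi_apply, ZMod.val_one, one_smul, one_smul, cis_add, sub_eq_add_neg, cis_add,
      ← mul_assoc, cis_eighth, ← cis_conj, cis_quarter, cis_half, Complex.conj_I]
    linear_combination Complex.I_mul_I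

theorem one_add_cis_chi (x y : ZMod 2) :
    1 + cis (chi (x + y)) = if x = y then 2 else 0 := by
  rcases zmod_two_cases x with rfl | rfl <;> rcases zmod_two_cases y with rfl | rfl <;>
    simp [chi_apply, ZMod.val_one, cis_half, cis_zero, zmod_two_add_self] <;> norm_num

/-- For fixed values of the other variables, `q` is a constant bit and the shift at most exchanges
the two values of `y`. -/
theorem psum_shift {B : Finset V} {y : V} (hy : y ∈ B) {q : BPoly V} (hq : y ∉ vars q)
    (g : (V → ZMod 2) → ℂ) :
    (psum B fun a => g (Function.update a y (a y + val a q))) = psum B g := by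
  rw [psum_erase hy, psum_erase hy g]
  refine psum_congr fun a => ?_
  simp only [notMem_vars_iff.1 hq, Function.update_self, Function.update_idem]
  rcases zmod_two_cases (val a q) with h | h
  · simp [h]
  · rw [h, zero_add, zmod_two_add_self, add_comm]

theorem ev_scale_half_X_mul (a : V → ZMod 2) (y : V) (p : IPoly V) (x : ZMod 2)
    (h : val a p • half = chi x) :
    ev a (Phase.scale half (Poly.X y * p)) = if a y = 1 then chi x else 0 := by
  rw [ev_scale, map_mul, val_X_int]
  rcases zmod_two_cases (a y) with h' | h'
  · simp [h']
  · simp [h', ZMod.val_one, h]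

theorem hat_smul_half (a : V → ZMod 2) (Q : BPoly V) :
    val a (BPoly.hat Q) • half = chi (val a Q) := by
  rw [BPoly.val_hat, natCast_zsmul, chi_apply]

theorem X_add_hat_smul_half (a : V → ZMod 2) (y : V) (Q : BPoly V) :
    val a (Poly.X y + BPoly.hat Q) • half = chi (a y + val a Q) := by
  rw [map_add, val_X_int, add_smul, hat_smul_half, natCast_zsmul, map_add, ← chi_apply]

end PathSumLemmas

/-! ### Criteria for preserving the density -/

namespace DSOP

variable {V : Type u} {n m : ℕ}

/-- What the rewriting system needs of terms of the Clifford fragment: phases are quadratic, all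
other polynomials are affine. -/
structure Good (t : DSOP V n m) : Prop where
  pos : 0 < t.s
  quad : Quadratic fun a => ev a t.P
  legs : ∀ i, IsAffine (t.legs i)
  disc : ∀ d ∈ t.D, IsAffine d

theorem forall_legs {t : DSOP V n m} {p : BPoly V → Prop} :
    (∀ i, p (t.legs i)) ↔ (∀ i, p (t.O i)) ∧ ∀ i, p (t.I i) := by
  rw [Fin.forall_fin_add]
  simp only [legs, Fin.append_left, Fin.append_right]

theorem IsClifford.good {t : DSOP V n m} (h : t.IsClifford) : t.Good := by
  obtain ⟨⟨p, hp⟩, ⟨P₀, P₁, P₂, h₀, h₁, h₂, hP⟩, hO, hD, hI⟩ := h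
  refine ⟨by rw [hp]; positivity, ?_, forall_legs.2
    ⟨fun i => isAffine_of_degreeLE (hO i), fun i => isAffine_of_degreeLE (hI i)⟩,
    fun d hd => isAffine_of_degreeLE (hD d hd)⟩
  have hz : ∀ {p : IPoly V} {k : ℕ} {S : Mon V}, DegreeLE p k → k < S.vars.card → p.coeff S = 0 :=
    fun {p k S} hp hS => by
      by_contra hne
      exact absurd (hp S (mem_monomials.2 hne)) (not_le.2 hS)
  have hS : ∀ S, t.P S = P₀.coeff S • eighth + P₁.coeff S • quarter + P₂.coeff S • half := by
    intro S; rw [hP]; rfl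
  have e2 : (2 : ℕ) • half = 0 := by rw [two_nsmul, half_add_half]
  have e4 : (4 : ℕ) • quarter = 0 := by
    rw [show 4 = 2 * 2 from rfl, mul_smul, two_nsmul quarter, quarter_add_quarter, e2]
  have c2 : ∀ z : ℤ, (2 : ℕ) • z • half = 0 := fun z => by rw [smul_comm, e2, smul_zero]
  have c4 : ∀ z : ℤ, (4 : ℕ) • z • quarter = 0 := fun z => by rw [smul_comm, e4, smul_zero]
  refine quadratic_of_coeff (fun S hc => ?_) (fun S hc => ?_) fun S hc => ?_
  · rw [hS, hz h₀ (by omega), zero_smul, zero_add, smul_add, c4, zero_add,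
      show 4 = 2 * 2 from rfl, mul_smul, c2, smul_zero]
  · rw [hS, hz h₀ (by omega), hz h₁ (by omega), zero_smul, zero_smul, zero_add, zero_add, c2]
  · rw [hS, hz h₀ (by omega), hz h₁ (by omega), hz h₂ (by omega)]
    simp

theorem legs_eq {t t' : DSOP V n m} (hO : t'.O = t.O) (hI : t'.I = t.I) : t'.legs = t.legs := by
  rw [legs, legs, hO, hI]

theorem legs_eq_map {t t' : DSOP V n m} (f : BPoly V → BPoly V) (hO : t'.O = fun i => f (t.O i))
    (hI : t'.I = fun i => f (t.I i)) (i : Fin (m + n)) : t'.legs i = f (t.legs i) := by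
  rw [legs, legs, hO, hI]
  refine Fin.addCases (fun j => ?_) (fun j => ?_) i <;> simp

theorem fresh_legs {t : DSOP V n m} {y : V} (hO : FreshL y t.O) (hI : FreshL y t.I)
    (i : Fin (m + n)) : y ∉ vars (t.legs i) :=
  forall_legs (p := fun p => y ∉ vars p).2 ⟨hO, hI⟩ i

theorem hit_update {t : DSOP V n m} {y : V} (hL : ∀ i, y ∉ vars (t.legs i)) (hD : FreshD y t.D)
    (x₁ x₂ : Fin (m + n) → ZMod 2) (a b : V → ZMod 2) (c c' : ZMod 2) :
    t.Hit x₁ x₂ (Function.update a y c) (Function.update b y c') ↔ t.Hit x₁ x₂ a b := by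
  unfold Hit
  simp only [notMem_vars_iff.1 (hL _)]
  refine and_congr_right fun _ => and_congr_right fun _ => forall₂_congr fun d hd => ?_
  rw [notMem_vars_iff.1 (hD d hd), notMem_vars_iff.1 (hD d hd)]

theorem hit_update_left {t : DSOP V n m} {y : V} (hL : ∀ i, y ∉ vars (t.legs i))
    (hD : FreshD y t.D) (x₁ x₂ : Fin (m + n) → ZMod 2) (a b : V → ZMod 2) (c : ZMod 2) :
    t.Hit x₁ x₂ (Function.update a y c) b ↔ t.Hit x₁ x₂ a b := by
  simpa using hit_update hL hD x₁ x₂ a b c (b y)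

theorem hit_update_right {t : DSOP V n m} {y : V} (hL : ∀ i, y ∉ vars (t.legs i))
    (hD : FreshD y t.D) (x₁ x₂ : Fin (m + n) → ZMod 2) (a b : V → ZMod 2) (c : ZMod 2) :
    t.Hit x₁ x₂ a (Function.update b y c) ↔ t.Hit x₁ x₂ a b := by
  simpa using hit_update hL hD x₁ x₂ a b (a y) c

/-- A summation over one variable that leaves the other factors unchanged can be carried out in
both copies. -/
theorem dens_eq_of_sum {t t' : DSOP V n m} (κ : ℝ) (φ : (V → ZMod 2) → V → ZMod 2) (y : V)
    (hs : t'.s = κ * t.s)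
    (hsum : ∀ g : (V → ZMod 2) → ℂ, (∀ a c, g (Function.update a y c) = g a) →
      psum t.bound (fun a => cis (ev a t.P) * g a) =
        κ * psum t'.bound fun a => cis (ev a t'.P) * g (φ a))
    (hL : ∀ i, y ∉ vars (t.legs i)) (hD : FreshD y t.D)
    (hhit : ∀ x₁ x₂ a b, t'.Hit x₁ x₂ a b ↔ t.Hit x₁ x₂ (φ a) (φ b)) : t'.dens = t.dens := by
  funext x₁ x₂
  have h2 : ∀ a, (psum t.bound fun b => (starRingEnd ℂ) (cis (ev b t.P)) *
      if t.Hit x₁ x₂ a b then 1 else 0) = κ * psum t'.bound fun b =>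
        (starRingEnd ℂ) (cis (ev b t'.P)) * if t.Hit x₁ x₂ a (φ b) then 1 else 0 := by
    intro a
    -- The second copy uses the conjugate identity. Since `κ` is real, the two copies together
    -- produce `κ ^ 2`, which the new scalar absorbs.
    have := congrArg (starRingEnd ℂ) (hsum (fun b => if t.Hit x₁ x₂ a b then 1 else 0)
      fun b c => by simp only [hit_update_right hL hD])
    rw [map_mul, psum_conj, psum_conj, Complex.conj_ofReal] at this
    simpa only [map_mul, apply_ite (starRingEnd ℂ), map_one, map_zero] using this
  have h1 := hsum (fun a => κ * psum t'.bound fun b =>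
        (starRingEnd ℂ) (cis (ev b t'.P)) * if t.Hit x₁ x₂ a (φ b) then 1 else 0)
        fun a c => by simp only [hit_update_left hL hD]
  simp only [← h2] at h1
  unfold dens
  simp only [mul_assoc, psum_mul_left]
  rw [h1]
  simp only [h2, hhit, hs]
  push_cast
  simp only [mul_left_comm _ (κ : ℂ), psum_mul_left]
  ring

theorem dens_eq_zero_of_sum {t : DSOP V n m} (y : V)
    (hsum : ∀ g : (V → ZMod 2) → ℂ, (∀ a c, g (Function.update a y c) = g a) →
      psum t.bound (fun a => cis (ev a t.P) * g a) = 0)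
    (hL : ∀ i, y ∉ vars (t.legs i)) (hD : FreshD y t.D) : t.dens = 0 := by
  funext x₁ x₂
  have h1 := hsum (fun a => psum t.bound fun b =>
        (starRingEnd ℂ) (cis (ev b t.P)) * if t.Hit x₁ x₂ a b then 1 else 0)
        fun a c => by simp only [hit_update_left hL hD]
  unfold dens
  simp only [mul_assoc, psum_mul_left]
  rw [h1, mul_zero]
  rfl

/-- Only phase differences along contributing pairs matter, so a phase common to both copies can be
dropped. -/
theorem dens_eq_of_hit {t t' : DSOP V n m} (hs : t'.s = t.s) (hb : t'.bound = t.bound)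
    (hhit : ∀ x₁ x₂ a b, t'.Hit x₁ x₂ a b ↔ t.Hit x₁ x₂ a b)
    (hP : ∀ x₁ x₂ a b, t.Hit x₁ x₂ a b → ev a t'.P - ev b t'.P = ev a t.P - ev b t.P) :
    t'.dens = t.dens := by
  funext x₁ x₂
  unfold dens
  rw [hs, hb]
  congr 1
  refine psum_congr fun a => psum_congr fun b => ?_
  simp only [hhit, cis_mul_conj]
  split_ifs with h
  · rw [hP x₁ x₂ a b h]
  · simp

/-- The same change of variable is performed independently in both copies. -/
theorem dens_eq_of_shift {t t' : DSOP V n m} {y : V} {q : BPoly V} (hy : y ∈ t.bound)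
    (hq : y ∉ vars q) (hs : t'.s = t.s) (hb : t'.bound = t.bound)
    (hP : ∀ a, ev a t'.P = ev (Function.update a y (a y + val a q)) t.P)
    (hhit : ∀ x₁ x₂ a b, t'.Hit x₁ x₂ a b ↔ t.Hit x₁ x₂
      (Function.update a y (a y + val a q)) (Function.update b y (b y + val b q))) :
    t'.dens = t.dens := by
  funext x₁ x₂
  unfold dens
  rw [hs, hb]
  congr 1
  simp only [hhit, hP]
  rw [← psum_shift hy hq fun a => psum t.bound fun b => cis (ev a t.P) *
    (starRingEnd ℂ) (cis (ev b t.P)) * if t.Hit x₁ x₂ a b then 1 else 0]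
  refine psum_congr fun a => ?_
  exact (psum_shift hy hq fun b => cis (ev (Function.update a y (a y + val a q)) t.P) *
    (starRingEnd ℂ) (cis (ev b t.P)) *
      if t.Hit x₁ x₂ (Function.update a y (a y + val a q)) b then 1 else 0)

end DSOP

/-! ### Soundness of the rules -/

namespace DSOP

variable {V : Type u} {n m : ℕ}

/-- `R` is the restriction of `P` to `y = 0`, and `Q` is, up to the constant `c`, the slope of `P`
in `y`. -/
theorem quadratic_and_isAffine_of_split {P R : Phase V} {Q : BPoly V} {y : V} {c : UnitAddCircle}
    (hP : ∀ a, ev a P = (if a y = 1 then c + chi (val a Q) else 0) + ev a R)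
    (hQ : y ∉ vars Q) (hR : y ∉ R.vars) (h : Quadratic fun a => ev a P) :
    (Quadratic fun a => ev a R) ∧ IsAffine Q := by
  have hR' := notMem_coeffVars_iff.1 hR
  have hQ' := notMem_vars_iff.1 hQ
  constructor
  · have e : (fun a => ev a R) = fun a => ev (Function.update a y (val a (0 : BPoly V))) P := by
      funext a
      rw [hP, hR']
      simp
    rw [e]
    exact h.comp (isAffine_update isAffine_zero y)
  · refine isAffine_of_slope h (y := y) (c := c) fun a => ?_
    simp only [hP, hR', hQ', Function.update_self]
    simp

theorem notMem_vars_add {p q : BPoly V} {y : V} (hp : y ∉ vars p) (hq : y ∉ vars q) :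
    y ∉ vars (p + q) := fun h => by
  rcases Finset.mem_union.1 (Poly.vars_add p q h) with h | h
  · exact hp h
  · exact hq h

theorem notMem_vars_X {x y : V} (h : x ≠ y) : x ∉ vars (X y : BPoly V) := fun hx =>
  h (Finset.mem_singleton.1 (Poly.vars_X y hx))

theorem psum_split {P R : Phase V} {B : Finset V} {Q : BPoly V} {y : V} {c : UnitAddCircle}
    (hy : y ∈ B) (hP : ∀ a, ev a P = (if a y = 1 then c + chi (val a Q) else 0) + ev a R)
    (hQ : y ∉ vars Q) (hR : y ∉ R.vars) (g : (V → ZMod 2) → ℂ)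
    (hg : ∀ a c, g (Function.update a y c) = g a) :
    psum B (fun a => cis (ev a P) * g a) =
      psum (B.erase y) fun a => (1 + cis (c + chi (val a Q))) * cis (ev a R) * g a := by
  rw [psum_erase hy]
  refine psum_congr fun a => ?_
  simp only [hg, hP, notMem_coeffVars_iff.1 hR, notMem_vars_iff.1 hQ, Function.update_self]
  rw [if_neg zero_ne_one, if_pos trivial, zero_add, cis_add]
  ring

theorem Good.elim {t t' : DSOP V n m} (h : t.Good) {y₀ : V} (hy₀ : y₀ ∈ t.bound)
    (freshP : y₀ ∉ t.P.vars) (freshD : FreshD y₀ t.D) (freshL : ∀ i, y₀ ∉ vars (t.legs i))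
    (s' : t'.s = 2 * t.s) (bound' : t'.bound = t.bound.erase y₀)
    (P' : t'.P = t.P) (L' : t'.legs = t.legs) (D' : t'.D = t.D) :
    t'.Good ∧ t'.dens = t.dens := by
  refine ⟨⟨?_, ?_, ?_, ?_⟩, ?_⟩
  · rw [s']; have := h.pos; positivity
  · rw [P']; exact h.quad
  · rw [L']; exact h.legs
  · rw [D']; exact h.disc
  refine dens_eq_of_sum 2 id y₀ s' (fun g hg => ?_) freshL freshD fun x₁ x₂ a b => ?_
  · rw [bound', P', psum_erase hy₀, ← psum_mul_left]
    refine psum_congr fun a => ?_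
    simp only [hg, notMem_coeffVars_iff.1 freshP, id]
    push_cast
    ring
  · simp only [Hit, L', D', id]

theorem Good.hh {t t' : DSOP V n m} (h : t.Good) {y₀ y₁ : V} {Q : BPoly V} {R : Phase V}
    (hy₀ : y₀ ∈ t.bound) (hy₁ : y₁ ∈ t.bound) (hne : y₀ ≠ y₁)
    (hP : t.P = Phase.scale half (Poly.X y₀ * (Poly.X y₁ + BPoly.hat Q)) + R)
    (freshR : y₀ ∉ R.vars) (freshQ : y₀ ∉ Poly.vars Q) (freshD : FreshD y₀ t.D)
    (freshL : ∀ i, y₀ ∉ vars (t.legs i)) (freshQ₁ : y₁ ∉ Poly.vars Q)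
    (s' : t'.s = 2 * t.s) (bound' : t'.bound = (t.bound.erase y₀).erase y₁)
    (P' : t'.P = R.subst y₁ (BPoly.hat Q))
    (L' : ∀ i, t'.legs i = Poly.subst y₁ Q (t.legs i))
    (D' : t'.D = t.D.image (Poly.subst y₁ Q)) :
    t'.Good ∧ t'.dens = t.dens := by
  have hP' : ∀ a, ev a t.P =
      (if a y₀ = 1 then 0 + chi (val a (X y₁ + Q)) else 0) + ev a R := fun a => by
    rw [hP, ev_add, ev_scale_half_X_mul _ _ _ _ (X_add_hat_smul_half a y₁ Q), map_add (val a), val_X,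
      zero_add]
  have hQX : y₀ ∉ vars (X y₁ + Q) := notMem_vars_add (notMem_vars_X hne) freshQ
  obtain ⟨hR, hQ⟩ := quadratic_and_isAffine_of_split hP' hQX freshR h.quad
  have hQ' : IsAffine Q := by
    have := (isAffine_X y₁).add hQ
    rwa [← add_assoc, BPoly.add_self, zero_add] at this
  refine ⟨⟨?_, ?_, ?_, ?_⟩, ?_⟩
  · rw [s']; have := h.pos; positivity
  · rw [P']; simp only [ev_subst]; exact hR.comp (isAffine_update hQ' y₁)
  · intro i; rw [L']; exact (h.legs i).subst hQ' y₁
  · rw [D']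
    intro d hd
    obtain ⟨e, he, rfl⟩ := Finset.mem_image.1 hd
    exact (h.disc e he).subst hQ' y₁
  -- Summing over `y₀` gives `2` when `y₁ = Q` and `0` otherwise, so every surviving path has its
  -- `y₁` prescribed by `Q`.
  refine dens_eq_of_sum 2 (fun a => Function.update a y₁ (val a Q)) y₀ s' (fun g hg => ?_)
    freshL freshD fun x₁ x₂ a b => ?_
  · rw [psum_split hy₀ hP' hQX freshR g hg, bound',
      psum_erase (Finset.mem_erase.2 ⟨hne.symm, hy₁⟩), ← psum_mul_left]
    refine psum_congr fun a => ?_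
    simp only [zero_add, map_add (val _), val_X, one_add_cis_chi, notMem_vars_iff.1 freshQ₁,
      Function.update_self, P', ev_subst]
    rcases zmod_two_cases (val a Q) with hq | hq <;>
      simp [hq, mul_assoc, cis_zero, chi_apply, ZMod.val_one, cis_half, one_add_one_eq_two]
  · simp only [Hit, L', D', val_subst, Finset.forall_mem_image]

theorem Good.omega {t t' : DSOP V n m} (h : t.Good) {y₀ : V} {Q : BPoly V} {R : Phase V}
    (hy₀ : y₀ ∈ t.bound)
    (hP : t.P = Phase.scale quarter (Poly.X y₀) +
        Phase.scale half (Poly.X y₀ * BPoly.hat Q) + R)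
    (freshQ : y₀ ∉ Poly.vars Q) (freshR : y₀ ∉ R.vars) (freshD : FreshD y₀ t.D)
    (freshL : ∀ i, y₀ ∉ vars (t.legs i))
    (s' : t'.s = Real.sqrt 2 * t.s) (bound' : t'.bound = t.bound.erase y₀)
    (P' : t'.P = Phase.scale eighth 1 - Phase.scale quarter (BPoly.hat Q) + R)
    (L' : t'.legs = t.legs) (D' : t'.D = t.D) :
    t'.Good ∧ t'.dens = t.dens := by
  have hP' : ∀ a, ev a t.P =
      (if a y₀ = 1 then quarter + chi (val a Q) else 0) + ev a R := fun a => by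
    rw [hP, ev_add, ev_add, ev_scale_half_X_mul _ _ _ _ (hat_smul_half a Q), ev_scale, val_X_int]
    rcases zmod_two_cases (a y₀) with h | h <;> simp [h, ZMod.val_one]
  obtain ⟨hR, hQ⟩ := quadratic_and_isAffine_of_split hP' freshQ freshR h.quad
  have e4 : (4 : ℕ) • quarter = 0 := by
    rw [show 4 = 2 * 2 from rfl, mul_smul, two_nsmul quarter, quarter_add_quarter, two_nsmul,
      half_add_half]
  have evP' : ∀ a, ev a t'.P = eighth + -((val a Q).val • quarter) + ev a R := fun a => by
    rw [P', ev_add, ev_sub, ev_scale, ev_scale, map_one, one_smul, BPoly.val_hat, natCast_zsmul,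
      sub_eq_add_neg]
  refine ⟨⟨?_, ?_, ?_, ?_⟩, ?_⟩
  · rw [s']; have := h.pos; positivity
  · simp only [evP']
    exact ((Quadratic.const eighth).add (quadratic_val e4 hQ).neg).add hR
  · rw [L']; exact h.legs
  · rw [D']; exact h.disc
  refine dens_eq_of_sum (Real.sqrt 2) id y₀ s' (fun g hg => ?_) freshL freshD fun x₁ x₂ a b => ?_
  · rw [psum_split hy₀ hP' freshQ freshR g hg, bound', ← psum_mul_left]
    refine psum_congr fun a => ?_
    rw [one_add_cis_quarter, evP', cis_add _ (ev a R), sub_eq_add_neg]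
    simp only [id, mul_assoc]
  · simp only [Hit, L', D', id]

theorem ev_scale_half_X (a : V → ZMod 2) (y : V) :
    ev a (Phase.scale half (X y)) = chi (a y) := by
  rw [ev_scale, val_X_int, natCast_zsmul, chi_apply]

theorem dens_eq_zero {t : DSOP V n m} {y₀ : V} {R : Phase V} (hy₀ : y₀ ∈ t.bound)
    (hP : t.P = Phase.scale half (Poly.X y₀) + R) (freshR : y₀ ∉ R.vars)
    (freshD : FreshD y₀ t.D) (freshL : ∀ i, y₀ ∉ vars (t.legs i)) : t.dens = 0 := by
  refine dens_eq_zero_of_sum y₀ (fun g hg => ?_) freshL freshD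
  rw [psum_erase hy₀]
  refine Eq.trans (psum_congr (g' := fun _ => 0) fun a => ?_) (by simp [psum])
  simp only [hg, hP, ev_add, ev_scale_half_X, notMem_coeffVars_iff.1 freshR,
    Function.update_self, cis_add]
  simp [chi_apply, ZMod.val_one, cis_zero, cis_half]

theorem notMem_vars_zero (y : V) : y ∉ vars (0 : BPoly V) := by simp [Poly.vars, coeffVars]

/-- The terminal form of the terms whose interpretation is zero. -/
def IsZeroForm (t : DSOP V n m) (y : V) : Prop :=
  t.s = 1 ∧ t.bound = {y} ∧ t.P = Phase.scale half (X y) ∧ t.O = 0 ∧ t.D = ∅ ∧ t.I = 0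

theorem IsZeroForm.legs_eq_zero {t : DSOP V n m} {y : V} (h : t.IsZeroForm y) :
    ∀ i, t.legs i = 0 := by
  obtain ⟨-, -, -, hO, -, hI⟩ := h
  exact forall_legs (p := fun p => p = 0).2 ⟨fun i => by rw [hO]; rfl, fun i => by rw [hI]; rfl⟩

theorem IsZeroForm.dens_eq_zero {t : DSOP V n m} {y : V} (h : t.IsZeroForm y) : t.dens = 0 := by
  have hL := h.legs_eq_zero
  obtain ⟨-, hb, hP, -, hD, -⟩ := h
  refine DSOP.dens_eq_zero (y₀ := y) (R := 0) (by simp [hb]) (by rw [hP, add_zero])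
    (by simp [Phase.vars, coeffVars])
    (fun d hd => absurd (hD ▸ hd) (Finset.notMem_empty d)) fun i => ?_
  rw [hL]
  exact notMem_vars_zero y

theorem IsZeroForm.good {t : DSOP V n m} {y : V} (h : t.IsZeroForm y) : t.Good := by
  have hL := h.legs_eq_zero
  obtain ⟨hs, -, hP, -, hD, -⟩ := h
  refine ⟨by rw [hs]; exact one_pos, ?_, fun i => by rw [hL]; exact isAffine_zero,
    fun d hd => absurd (hD ▸ hd) (Finset.notMem_empty d)⟩
  simp only [hP, ev_scale_half_X]
  have e4 : (4 : ℕ) • half = 0 := by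
    rw [show 4 = 2 * 2 from rfl, mul_smul, two_nsmul half, half_add_half, smul_zero]
  simpa only [chi_apply, val_X] using quadratic_val e4 (isAffine_X y)

/-- The removed phase depends only on discarded values, so it cancels between the copies.
Disjointness of the monomials makes each coefficient of `R` either zero or a coefficient of `P`, so
the torsion conditions persist. -/
theorem Good.zGround {t t' : DSOP V n m} (h : t.Good) {E : Finset (BPoly V)} {α : UnitAddCircle}
    {R : Phase V} (hE : E ⊆ t.D)
    (hP : t.P = R + Phase.scale α (BPoly.hat (∏ d ∈ E, d)))
    (split : Disjoint R.support (Phase.scale α (BPoly.hat (∏ d ∈ E, d))).support)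
    (s' : t'.s = t.s) (bound' : t'.bound = t.bound)
    (P' : t'.P = R) (L' : t'.legs = t.legs) (D' : t'.D = t.D) :
    t'.Good ∧ t'.dens = t.dens := by
  have hR : ∀ S, R S = 0 ∨ R S = t.P S := fun S => by
    by_cases hS : R S = 0
    · exact Or.inl hS
    · right
      have : S ∉ (Phase.scale α (BPoly.hat (∏ d ∈ E, d))).support :=
        Finset.disjoint_left.1 split (Finsupp.mem_support_iff.2 hS)
      rw [hP, Finsupp.add_apply, Finsupp.notMem_support_iff.1 this, add_zero]
  refine ⟨⟨by rw [s']; exact h.pos, ?_, by rw [L']; exact h.legs, by rw [D']; exact h.disc⟩, ?_⟩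
  · rw [P']
    refine quadratic_of_coeff (fun S hS => ?_) (fun S hS => ?_) fun S hS => ?_
    · rcases hR S with e | e
      · rw [e, smul_zero]
      · obtain ⟨v, hv⟩ := Finset.card_eq_one.1 hS
        rw [e]
        exact h.quad.four_nsmul (v := v) (by rw [hv]; exact Finset.mem_singleton_self v)
    · rcases hR S with e | e
      · rw [e, smul_zero]
      · obtain ⟨u, v, huv, hv⟩ := Finset.card_eq_two.1 hS
        rw [e]
        exact h.quad.two_nsmul huv (by rw [hv]; simp) (by rw [hv]; simp)
    · rcases hR S with e | e
      · exact e
      · rw [e]; exact h.quad.eq_zero hS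
  · refine dens_eq_of_hit s' bound' (fun _ _ _ _ => by simp only [Hit, L', D']) ?_
    intro x₁ x₂ a b hit
    have hE' : val a (∏ d ∈ E, d) = val b (∏ d ∈ E, d) := by
      rw [map_prod, map_prod]
      exact Finset.prod_congr rfl fun d hd => hit.2.2 d (hE hd)
    rw [hP, P', ev_add, ev_add, ev_scale, ev_scale, BPoly.val_hat, BPoly.val_hat, hE']
    abel

/-- Once the copies agree on `E`, agreeing on `d` and on `q` are equivalent. As the splitting has no
cancellation, the monomials of `q` are monomials of the affine `d`. -/
theorem Good.xorGround {t t' : DSOP V n m} (h : t.Good) {E : Finset (BPoly V)} {d q : BPoly V}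
    (hd : d ∈ t.D) (hE : E ⊆ t.D.erase d) (hsum : d = ∏ e ∈ E, e + q)
    (split : Disjoint (Poly.monomials (∏ e ∈ E, e)) (Poly.monomials q))
    (s' : t'.s = t.s) (bound' : t'.bound = t.bound) (P' : t'.P = t.P) (L' : t'.legs = t.legs)
    (D' : t'.D = insert q (t.D.erase d)) :
    t'.Good ∧ t'.dens = t.dens := by
  have hq : IsAffine q := by
    refine isAffine_of_degreeLE fun S hS => ?_
    by_contra hc
    have h0 := (h.disc d hd).coeff_eq_zero (S := S) (by omega)
    have h1 : (∏ e ∈ E, e).coeff S = 0 := by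
      by_contra hne
      exact Finset.disjoint_left.1 split (mem_monomials.2 hne) hS
    rw [hsum, MonoidAlgebra.coeff_add, Finsupp.add_apply, h1, zero_add] at h0
    exact mem_monomials.1 hS h0
  refine ⟨⟨by rw [s']; exact h.pos, by rw [P']; exact h.quad, by rw [L']; exact h.legs, ?_⟩, ?_⟩
  · rw [D']
    intro e he
    rcases Finset.mem_insert.1 he with rfl | he
    · exact hq
    · exact h.disc e (Finset.mem_of_mem_erase he)
  · refine dens_eq_of_hit s' bound' (fun x₁ x₂ a b => ?_) fun _ _ _ _ _ => by rw [P']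
    unfold Hit
    rw [L', D', Finset.forall_mem_insert]
    refine and_congr_right fun _ => and_congr_right fun _ => ?_
    have hprod : (∀ e ∈ t.D.erase d, val a e = val b e) →
        val a (∏ e ∈ E, e) = val b (∏ e ∈ E, e) := fun he => by
      rw [map_prod, map_prod]
      exact Finset.prod_congr rfl fun e h => he e (hE h)
    constructor
    · rintro ⟨hq, he⟩ e hmem
      by_cases hed : e = d
      · rw [hed, hsum, map_add, map_add, hq, hprod he]
      · exact he e (Finset.mem_erase.2 ⟨hed, hmem⟩)
    · intro he
      have he' : ∀ e ∈ t.D.erase d, val a e = val b e := fun e h =>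
        he e (Finset.mem_of_mem_erase h)
      refine ⟨?_, he'⟩
      have := he d hd
      rw [hsum, map_add, map_add, hprod he'] at this
      exact add_left_cancel this

theorem Good.cstGround {t t' : DSOP V n m} (h : t.Good) {c : BPoly V} (hc : c = 0 ∨ c = 1)
    (s' : t'.s = t.s) (bound' : t'.bound = t.bound) (P' : t'.P = t.P) (L' : t'.legs = t.legs)
    (D' : t'.D = t.D.erase c) : t'.Good ∧ t'.dens = t.dens := by
  refine ⟨⟨by rw [s']; exact h.pos, by rw [P']; exact h.quad, by rw [L']; exact h.legs, ?_⟩, ?_⟩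
  · rw [D']; exact fun d hd => h.disc d (Finset.mem_of_mem_erase hd)
  · refine dens_eq_of_hit s' bound' (fun x₁ x₂ a b => ?_) fun _ _ _ _ _ => by rw [P']
    unfold Hit
    rw [L', D']
    refine and_congr_right fun _ => and_congr_right fun _ => ⟨fun hh d hd => ?_, fun hh d hd =>
      hh d (Finset.mem_of_mem_erase hd)⟩
    by_cases hdc : d = c
    · rcases hc with rfl | rfl <;> simp [hdc]
    · exact hh d (Finset.mem_erase.2 ⟨hdc, hd⟩)

/-- Here `y₀` is discarded, so the copies cannot be summed separately. They share the value of `y₀`,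
and summing over it yields `1 + (-1)^{Q(a) + Q(b)}`: twice the condition that the copies agree on
`Q`. -/
theorem Good.hGround {t t' : DSOP V n m} (h : t.Good) {y₀ : V} {Q : BPoly V} {R : Phase V}
    {D₀ : Finset (BPoly V)} (hy₀ : y₀ ∈ t.bound)
    (hP : t.P = R + Phase.scale half (Poly.X y₀ * BPoly.hat Q))
    (hD : t.D = insert (Poly.X y₀) D₀)
    (freshQ : y₀ ∉ Poly.vars Q) (freshR : y₀ ∉ R.vars) (freshL : ∀ i, y₀ ∉ vars (t.legs i))
    (freshD : FreshD y₀ D₀)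
    (s' : t'.s = Real.sqrt 2 * t.s) (bound' : t'.bound = t.bound.erase y₀)
    (P' : t'.P = R) (L' : t'.legs = t.legs) (D' : t'.D = insert Q D₀) :
    t'.Good ∧ t'.dens = t.dens := by
  have hP' : ∀ a, ev a t.P = (if a y₀ = 1 then 0 + chi (val a Q) else 0) + ev a R := fun a => by
    rw [hP, ev_add, ev_scale_half_X_mul _ _ _ _ (hat_smul_half a Q), zero_add, add_comm]
  obtain ⟨hR, hQ⟩ := quadratic_and_isAffine_of_split hP' freshQ freshR h.quad
  refine ⟨⟨?_, by rw [P']; exact hR, by rw [L']; exact h.legs, ?_⟩, ?_⟩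
  · rw [s']; have := h.pos; positivity
  · rw [D']
    intro d hd
    rcases Finset.mem_insert.1 hd with rfl | hd
    · exact hQ
    · exact h.disc d (by rw [hD]; exact Finset.mem_insert_of_mem hd)
  funext x₁ x₂
  have hs2 : ((t'.s : ℝ) : ℂ) ^ 2 = (t.s : ℂ) ^ 2 * 2 := by
    rw [s', ← Complex.ofReal_pow, mul_pow, Real.sq_sqrt (by norm_num)]
    push_cast
    ring
  unfold dens
  rw [hs2, mul_assoc, bound', psum_erase hy₀, ← psum_mul_left]
  congr 1
  refine psum_congr fun a => ?_
  rw [psum_erase hy₀, psum_erase hy₀, ← psum_mul_left]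
  unfold psum
  rw [← Finset.sum_add_distrib]
  refine Finset.sum_congr rfl fun T _ => ?_
  generalize ind T = b
  set H : Prop := (∀ i, val a (t.legs i) = x₁ i) ∧ (∀ i, val b (t.legs i) = x₂ i) ∧
    ∀ d ∈ D₀, val a d = val b d with hH
  have hit : ∀ c c', t.Hit x₁ x₂ (Function.update a y₀ c) (Function.update b y₀ c') ↔
      c = c' ∧ H := by
    intro c c'
    have hD₀ : (∀ d ∈ D₀, val (Function.update a y₀ c) d = val (Function.update b y₀ c') d) ↔
        ∀ d ∈ D₀, val a d = val b d := forall₂_congr fun d hd => by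
      rw [notMem_vars_iff.1 (freshD d hd), notMem_vars_iff.1 (freshD d hd)]
    unfold Hit
    rw [hD, Finset.forall_mem_insert, hD₀]
    simp only [notMem_vars_iff.1 (freshL _), val_X, Function.update_self, hH]
    tauto
  have hit' : t'.Hit x₁ x₂ a b ↔ val a Q = val b Q ∧ H := by
    unfold Hit
    rw [D', Finset.forall_mem_insert, L', hH]
    tauto
  simp only [hit, hit', P', hP', notMem_coeffVars_iff.1 freshR, notMem_vars_iff.1 freshQ,
    Function.update_self, cis_mul_conj]
  by_cases hHt : H
  · have e := one_add_cis_chi (val a Q) (val b Q)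
    have hsub : chi (val a Q) - chi (val b Q) = chi (val a Q + val b Q) := by
      rw [map_add, sub_eq_add_neg, ← map_neg, ZMod.neg_eq_self_mod_two]
    have e1 : chi (val a Q) + ev a R - (chi (val b Q) + ev b R) =
        chi (val a Q + val b Q) + (ev a R - ev b R) := by rw [← hsub]; abel
    simp only [hHt, and_true, zero_add, if_true, zero_ne_one, one_ne_zero, if_false, mul_zero,
      mul_one, add_zero, e1, cis_add]
    -- The factor `2` is the square of the `√2` in the new scalar.
    rw [show (if val a Q = val b Q then (1 : ℂ) else 0) = (1 + cis (chi (val a Q + val b Q))) / 2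
      by rw [e]; split_ifs <;> norm_num]
    ring
  · simp [hHt]

theorem Good.disc_step {t t' : DSOP V n m} (h : t.Good) {y₀ : V} {d q : BPoly V}
    (hy₀ : y₀ ∈ t.bound)
    (hd : d ∈ t.D) (hsum : d = Poly.X y₀ + q) (freshq : y₀ ∉ Poly.vars q)
    (s' : t'.s = t.s) (bound' : t'.bound = t.bound)
    (P' : t'.P = t.P.subst y₀ (BPoly.hat d))
    (L' : ∀ i, t'.legs i = Poly.subst y₀ d (t.legs i))
    (D' : t'.D = t.D.image (Poly.subst y₀ d)) :
    t'.Good ∧ t'.dens = t.dens := by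
  have hda := h.disc d hd
  have hval : ∀ a, val a d = a y₀ + val a q := fun a => by rw [hsum, map_add, val_X]
  refine ⟨⟨by rw [s']; exact h.pos, ?_, ?_, ?_⟩, ?_⟩
  · rw [P']; simp only [ev_subst]; exact h.quad.comp (isAffine_update hda y₀)
  · intro i; rw [L']; exact (h.legs i).subst hda y₀
  · rw [D']
    intro e' he'
    obtain ⟨e, he, rfl⟩ := Finset.mem_image.1 he'
    exact (h.disc e he).subst hda y₀
  · refine dens_eq_of_shift hy₀ freshq s' bound' (fun a => ?_) fun x₁ x₂ a b => ?_
    · rw [P', ev_subst, hval]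
    · simp only [Hit, L', D', val_subst, Finset.forall_mem_image, hval]

/-- A change of variable `y₀ ↦ y₀ + q`. If `y₀` occurs in the discards, these may still stay
unchanged: with `q` discarded or constant, agreement before or after the shift forces agreement on
`q`, and then affine discards move by equal amounts in both copies. -/
theorem Good.leg_step {t t' : DSOP V n m} (h : t.Good) {y₀ : V} {q : BPoly V} (hq : IsAffine q)
    (hy₀ : y₀ ∈ t.bound) (freshq : y₀ ∉ Poly.vars q)
    (hD : FreshD y₀ t.D ∨ (Poly.X y₀ ∈ insert 1 t.D ∧ q ∈ insert 1 t.D))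
    (s' : t'.s = t.s) (bound' : t'.bound = t.bound)
    (P' : t'.P = t.P.subst y₀ (BPoly.hat (Poly.X y₀ + q)))
    (L' : ∀ i, t'.legs i = Poly.subst y₀ (Poly.X y₀ + q) (t.legs i))
    (D' : t'.D = t.D) :
    t'.Good ∧ t'.dens = t.dens := by
  have hda := (isAffine_X y₀).add hq
  have hval : ∀ a, val a (X y₀ + q) = a y₀ + val a q := fun a => by rw [map_add, val_X]
  refine ⟨⟨by rw [s']; exact h.pos, ?_, ?_, by rw [D']; exact h.disc⟩, ?_⟩
  · rw [P']; simp only [ev_subst]; exact h.quad.comp (isAffine_update hda y₀)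
  · intro i; rw [L']; exact (h.legs i).subst hda y₀
  · refine dens_eq_of_shift hy₀ freshq s' bound' (fun a => ?_) fun x₁ x₂ a b => ?_
    · rw [P', ev_subst, hval]
    · simp only [Hit, L', D', val_subst, hval]
      refine and_congr_right fun _ => and_congr_right fun _ => ?_
      rcases hD with hD | ⟨-, hqD⟩
      · refine forall₂_congr fun d hd => ?_
        rw [notMem_vars_iff.1 (hD d hd), notMem_vars_iff.1 (hD d hd)]
      · have shift : ∀ d ∈ t.D, val a q = val b q →
            (val (Function.update a y₀ (a y₀ + val a q)) d =
              val (Function.update b y₀ (b y₀ + val b q)) d ↔ val a d = val b d) := by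
          intro d hd hab
          have e : ∀ a : V → ZMod 2, Function.update a y₀ (a y₀ + val a q) =
              a + Pi.single y₀ (val a q) := fun a => by
            funext v
            by_cases hv : v = y₀
            · subst hv; simp
            · simp [hv]
          rw [e, e, h.disc d hd, h.disc d hd b, hab]
          exact add_left_inj _
        have hcase : (∀ d ∈ t.D, val a d = val b d) → val a q = val b q := fun hh => by
          rcases Finset.mem_insert.1 hqD with rfl | hqD
          · simp
          · exact hh q hqD
        have hcase' : (∀ d ∈ t.D, val (Function.update a y₀ (a y₀ + val a q)) d =
              val (Function.update b y₀ (b y₀ + val b q)) d) → val a q = val b q := fun hh => by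
          rcases Finset.mem_insert.1 hqD with rfl | hqD
          · simp
          · have := hh q hqD
            rwa [notMem_vars_iff.1 freshq, notMem_vars_iff.1 freshq] at this
        exact ⟨fun hh d hd => (shift d hd (hcase hh)).2 (hh d hd),
          fun hh d hd => (shift d hd (hcase' hh)).1 (hh d hd)⟩

theorem isAffine_of_split {y : V} {p q r : BPoly V} (hp : IsAffine p) (hsum : p = X y + q + r)
    (split : Disjoint (Poly.monomials q) (Poly.monomials r)) :
    IsAffine q := by
  refine isAffine_of_degreeLE fun S hS => ?_
  by_contra hc
  have h0 := (hp.add (isAffine_X y)).coeff_eq_zero (S := S) (by omega)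
  have h1 : r.coeff S = 0 := by
    by_contra hne
    exact Finset.disjoint_left.1 split hS (mem_monomials.2 hne)
  have e : X y + q + r + X y = q + r := by
    rw [add_comm, ← add_assoc, ← add_assoc, BPoly.add_self, zero_add]
  rw [hsum, e, MonoidAlgebra.coeff_add, Finsupp.add_apply, h1, add_zero] at h0
  exact mem_monomials.1 hS h0

theorem subst_of_notMem {y : V} {p q : BPoly V} (h : y ∉ vars p) : subst y q p = p :=
  val_injective fun a => by rw [val_subst, notMem_vars_iff.1 h]

theorem Step.good {t t' : DSOP V n m} (hst : Step t t') (h : t.Good) :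
    t'.Good ∧ t'.dens = t.dens := by
  cases hst with
  | elim y₀ hy₀ freshP freshD freshO freshI s' bound' P' O' D' I' =>
    exact h.elim hy₀ freshP freshD (fresh_legs freshO freshI) s' bound' P' (legs_eq O' I') D'
  | hh y₀ y₁ Q R hy₀ hy₁ hne hP freshR freshQ freshD freshO freshI freshQ₁ s' bound' P' O' D' I' =>
    exact h.hh hy₀ hy₁ hne hP freshR freshQ freshD (fresh_legs freshO freshI) freshQ₁ s' bound' P'
      (legs_eq_map _ O' I') D'
  | omega y₀ Q R hy₀ hP freshQ freshR freshD freshO freshI s' bound' P' O' D' I' =>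
    exact h.omega hy₀ hP freshQ freshR freshD (fresh_legs freshO freshI) s' bound' P'
      (legs_eq O' I') D'
  | zGround E α R hE hP hne split s' bound' P' O' D' I' =>
    exact h.zGround hE hP split s' bound' P' (legs_eq O' I') D'
  | hGround y₀ Q R D₀ hy₀ hP hD freshQ freshR freshO freshI freshD s' bound' P' O' D' I' =>
    exact h.hGround hy₀ hP hD freshQ freshR (fresh_legs freshO freshI) freshD s' bound' P'
      (legs_eq O' I') D'
  | xorGround E d q hd hE hsum hne split s' bound' P' O' D' I' =>
    exact h.xorGround hd hE hsum split s' bound' P' (legs_eq O' I') D'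
  | cstGround c hc hcD s' bound' P' O' D' I' =>
    exact h.cstGround hc s' bound' P' (legs_eq O' I') D'
  | disc y₀ d q hy₀ hd hsum hne freshq hcount s' bound' P' O' D' I' =>
    exact h.disc_step hy₀ hd hsum freshq s' bound' P' (legs_eq_map _ O' I') D'
  | ket y₀ i q r hy₀ hsum hne split freshO freshq freshr hD s' bound' P' O' D' I' =>
    exact h.leg_step (isAffine_of_split ((forall_legs.1 h.legs).1 i) hsum split) hy₀ freshq
      hD s' bound' P' (legs_eq_map _ O' I') D'
  | bra y₀ i q r hy₀ hsum hne split freshO freshI freshq freshr hD s' bound' P' O' D' I' =>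
    refine h.leg_step (isAffine_of_split ((forall_legs.1 h.legs).2 i) hsum split) hy₀ freshq
      hD s' bound' P' (legs_eq_map _ ?_ I') D'
    -- The ket does not contain the variable, so substituting in it does nothing; ket and bra are
    -- thus treated alike as legs.
    rw [O']
    exact funext fun j => (subst_of_notMem (freshO j)).symm
  | zero y₀ R hy₀ hP hne freshR freshD freshO freshI s' bound' P' O' D' I' =>
    have hz : t'.IsZeroForm y₀ := ⟨s', bound', P', O', D', I'⟩
    exact ⟨hz.good, hz.dens_eq_zero.trans
      (dens_eq_zero hy₀ hP freshR freshD (fresh_legs freshO freshI)).symm⟩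

theorem Reduces.good {t t' : DSOP V n m} (hr : t.Reduces t') (h : t.Good) :
    t'.Good ∧ t'.dens = t.dens := by
  induction hr with
  | refl => exact ⟨h, rfl⟩
  | tail _ hst ih =>
    obtain ⟨h₁, h₂⟩ := hst.good ih.1
    exact ⟨h₁, h₂.trans ih.2⟩

end DSOP

/-! ### Splitting phases and affine polynomials -/

section PolyLemmas

variable {V : Type u}

theorem two_torsion {c : UnitAddCircle} (h : 2 • c = 0) : c = 0 ∨ c = half := by
  have h2 : cis c * cis c = 1 := by rw [← cis_add, ← two_nsmul, h, cis_zero]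
  rcases mul_self_eq_one_iff.1 h2 with h1 | h1
  · exact Or.inl (cis_injective (h1.trans cis_zero.symm))
  · exact Or.inr (cis_injective (h1.trans cis_half.symm))

theorem coeff_X_self (y : V) : (X y : BPoly V).coeff (Mon.of {y}) = 1 := by
  rw [X, MonoidAlgebra.coeff_single, Finsupp.single_eq_same]

theorem coeff_single_of_ne {S T : Mon V} (h : S ≠ T) :
    (MonoidAlgebra.single S 1 : BPoly V).coeff T = 0 := by
  rw [MonoidAlgebra.coeff_single, Finsupp.single_eq_of_ne h.symm]

theorem X_injective : Function.Injective (X : V → BPoly V) := fun y z h => by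
  by_contra hne
  have h1 := coeff_X_self y
  rw [h, X, coeff_single_of_ne] at h1
  · exact absurd h1 (by decide)
  · intro e
    exact hne (Finset.singleton_injective (show ({z} : Finset V) = {y} from e)).symm

theorem mem_vars_X (y : V) : y ∈ vars (X y : BPoly V) :=
  mem_vars.2 ⟨Mon.of {y}, by rw [coeff_X_self]; decide, Finset.mem_singleton_self y⟩

theorem disjoint_single_of_coeff {p : BPoly V} {S : Mon V} (h : p.coeff S ≠ 0) :
    Disjoint (monomials (MonoidAlgebra.single S 1 : BPoly V))
      (monomials (p + MonoidAlgebra.single S 1)) := by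
  refine Finset.disjoint_left.2 fun T hT hT' => ?_
  have hTS : T = S := by
    by_contra hne
    exact mem_monomials.1 hT (coeff_single_of_ne (Ne.symm hne))
  subst hTS
  refine mem_monomials.1 hT' ?_
  rw [MonoidAlgebra.coeff_add, Finsupp.add_apply, zmod_two_ne_zero.1 h, MonoidAlgebra.coeff_single,
    Finsupp.single_eq_same]
  decide

theorem add_add_cancel_self (p q : BPoly V) : p = q + (p + q) := by
  rw [add_comm p q, ← add_assoc, BPoly.add_self, zero_add]

theorem vars_add_subset {p q : BPoly V} {B : Finset V} (hp : vars p ⊆ B) (hq : vars q ⊆ B) :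
    vars (p + q) ⊆ B := (Poly.vars_add p q).trans (Finset.union_subset hp hq)

theorem vars_X_subset {y : V} {B : Finset V} (hy : y ∈ B) : vars (X y : BPoly V) ⊆ B :=
  (Poly.vars_X y).trans (Finset.singleton_subset_iff.2 hy)

theorem vars_subst_subset {p q : BPoly V} {y : V} {B C : Finset V} (hp : vars p ⊆ B)
    (hq : vars q ⊆ C) (hB : ∀ v ∈ B, v ≠ y → v ∈ C) : vars (subst y q p) ⊆ C := by
  refine vars_subset_iff.2 fun a b hab => ?_
  rw [val_subst, val_subst, vars_subset_iff.1 hq a b hab]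
  refine vars_subset_iff.1 hp _ _ fun v hv => ?_
  by_cases hvy : v = y
  · simp [hvy]
  · simp [hvy, hab v (hB v hv hvy)]

theorem phase_vars_subst_subset {P : Phase V} {q : BPoly V} {y : V} {B C : Finset V}
    (hp : P.vars ⊆ B) (hq : vars q ⊆ C) (hB : ∀ v ∈ B, v ≠ y → v ∈ C) :
    (P.subst y (BPoly.hat q)).vars ⊆ C := by
  refine coeffVars_subset_iff.2 fun a b hab => ?_
  rw [ev_subst, ev_subst, vars_subset_iff.1 hq a b hab]
  refine coeffVars_subset_iff.1 hp _ _ fun v hv => ?_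
  by_cases hvy : v = y
  · simp [hvy]
  · simp [hvy, hab v (hB v hv hvy)]

theorem eq_of_mem_of_card {y : V} {S : Mon V} (hy : y ∈ S.vars) (h : ¬ 2 ≤ S.vars.card) :
    S = Mon.of {y} := by
  obtain ⟨z, hz⟩ := Finset.card_eq_one.1
    (le_antisymm (by omega) (Finset.card_pos.2 ⟨y, hy⟩))
  rw [hz, Finset.mem_singleton] at hy
  subst hy
  exact hz

theorem IsAffine.coeff_of_mem_vars {p : BPoly V} (hp : IsAffine p) {y : V} (hy : y ∈ vars p) :
    p.coeff (Mon.of {y}) ≠ 0 := by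
  obtain ⟨S, hS, hyS⟩ := mem_vars.1 hy
  rwa [← eq_of_mem_of_card hyS fun h => hS (hp.coeff_eq_zero h)]

theorem IsAffine.notMem_vars_add_X {p : BPoly V} (hp : IsAffine p) {y : V} (hy : y ∈ vars p) :
    y ∉ vars (p + X y) := fun h => by
  have h0 := (hp.add (isAffine_X y)).coeff_of_mem_vars h
  rw [MonoidAlgebra.coeff_add, Finsupp.add_apply, coeff_X_self,
    zmod_two_ne_zero.1 (hp.coeff_of_mem_vars hy)] at h0
  exact h0 (by decide)

theorem IsAffine.monomial_cases {p : BPoly V} (hp : IsAffine p) {S : Mon V} (hS : p.coeff S ≠ 0) :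
    S = 1 ∨ ∃ v, S = Mon.of {v} := by
  by_cases h0 : S.vars = ∅
  · exact Or.inl h0
  · obtain ⟨v, hv⟩ := Finset.nonempty_iff_ne_empty.2 h0
    exact Or.inr ⟨v, eq_of_mem_of_card hv fun h => hS (hp.coeff_eq_zero h)⟩

theorem eq_zero_or_one_of_vars {p : BPoly V} (h : vars p = ∅) : p = 0 ∨ p = 1 := by
  have hc : ∀ a, val a p = val 0 p := fun a => val_congr fun v hv => by simp [h] at hv
  rcases zmod_two_cases (val 0 p) with h0 | h0
  · exact Or.inl (val_injective fun a => by rw [hc, h0, map_zero])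
  · exact Or.inr (val_injective fun a => by rw [hc, h0, map_one])

/-- The bit that tells whether a phase is nonzero. -/
def phaseBit (c : UnitAddCircle) : ZMod 2 := if c = 0 then 0 else 1

theorem phaseBit_zero : phaseBit 0 = 0 := if_pos rfl

theorem chi_phaseBit {c : UnitAddCircle} (h : 2 • c = 0) : chi (phaseBit c) = c := by
  rcases two_torsion h with rfl | rfl
  · rw [phaseBit_zero, map_zero]
  · rw [phaseBit, if_neg half_ne_zero, chi_apply, ZMod.val_one, one_smul]

/-- A phase polynomial whose coefficients are `0` or `1 / 2` is half a boolean polynomial. -/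
theorem exists_chi_eq {f : Phase V} (hf : ∀ S, 2 • f S = 0) :
    ∃ Q : BPoly V, (∀ a, chi (val a Q) = ev a f) ∧ vars Q ⊆ coeffVars f := by
  refine ⟨MonoidAlgebra.ofCoeff (f.mapRange phaseBit phaseBit_zero),
    fun a => ?_, fun v hv => ?_⟩
  · rw [val_eq_ev]
    unfold ev
    rw [MonoidAlgebra.coeff_ofCoeff, Finsupp.sum_mapRange_index (by simp), Finsupp.sum,
      Finsupp.sum, map_sum]
    refine Finset.sum_congr rfl fun S _ => ?_
    split_ifs
    · exact chi_phaseBit (hf S)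
    · exact map_zero chi
  · obtain ⟨S, hS, hvS⟩ := mem_vars.1 hv
    refine mem_coeffVars.2 ⟨S, fun h => hS ?_, hvS⟩
    simp [h, phaseBit_zero]

/-- Puts a quadratic phase in the form required by the rules that eliminate `y`. The cofactor of `y`
has 2-torsion coefficients apart from its constant term, and `c` absorbs what is not 2-torsion
there; the rest is half a boolean polynomial. -/
theorem exists_split {P : Phase V} {y : V} {c : UnitAddCircle} (hP : Quadratic fun a => ev a P)
    (hc : 2 • (P (Mon.of {y}) - c) = 0) :
    ∃ (Q : BPoly V) (R : Phase V), y ∉ vars Q ∧ vars Q ⊆ P.vars ∧ y ∉ R.vars ∧ R.vars ⊆ P.vars ∧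
      (∀ a, ev a P = (if a y = 1 then c + chi (val a Q) else 0) + ev a R) ∧
      P = Phase.scale c (X y) + Phase.scale half (X y * BPoly.hat Q) + R := by
  obtain ⟨Q, hQ, hQv⟩ := exists_chi_eq (f := deriv y P - Finsupp.single 1 c) fun S => by
    rw [Finsupp.sub_apply]
    by_cases hyS : y ∈ S.vars
    · rw [deriv_apply_of_mem hyS, Finsupp.single_eq_of_ne, sub_zero, smul_zero]
      rintro rfl
      exact absurd hyS (Finset.notMem_empty y)
    · rw [deriv_apply hyS]
      by_cases hS : S = 1
      · subst hS
        rw [Finsupp.single_eq_same]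
        exact hc
      · rw [Finsupp.single_eq_of_ne hS, sub_zero]
        obtain ⟨u, hu⟩ := Finset.nonempty_iff_ne_empty.2 (show S.vars ≠ ∅ from hS)
        exact hP.two_nsmul (u := u) (v := y) (fun h => hyS (h ▸ hu))
          (Finset.mem_insert_of_mem hu) (Finset.mem_insert_self y _)
  have hQv' : vars Q ⊆ coeffVars (deriv y P) := by
    refine hQv.trans fun v hv => ?_
    rw [sub_eq_add_neg] at hv
    rcases Finset.mem_union.1 (coeffVars_add _ _ hv) with h | h
    · exact h
    · rw [coeffVars_neg] at h
      obtain ⟨S, hS, hvS⟩ := mem_coeffVars.1 h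
      by_cases hS1 : S = 1
      · subst hS1; exact absurd hvS (Finset.notMem_empty v)
      · exact absurd (Finsupp.single_eq_of_ne hS1) hS
  have hchi : ∀ a, c + chi (val a Q) =
      ev (Function.update a y 1) P - ev (Function.update a y 0) P := fun a => by
    rw [hQ, ev_sub, ev_deriv, ev_single, if_pos (Mon.holds_one a)]
    abel
  have hev : ∀ a, ev a (Phase.scale c (X y) + Phase.scale half (X y * BPoly.hat Q)) =
      if a y = 1 then c + chi (val a Q) else 0 := fun a => by
    rw [ev_add, ev_scale_half_X_mul _ _ _ _ (hat_smul_half a Q), ev_scale, val_X_int]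
    rcases zmod_two_cases (a y) with h | h <;> simp [h, ZMod.val_one]
  -- The remainder evaluates as `P` at `y = 0`, whence it does not involve `y`.
  have hR : ∀ a, ev a (P - (Phase.scale c (X y) + Phase.scale half (X y * BPoly.hat Q))) =
      ev (Function.update a y 0) P := fun a => by
    rw [ev_sub, hev]
    rcases zmod_two_cases (a y) with h | h
    · rw [if_neg (by rw [h]; decide), sub_zero, ← h, Function.update_eq_self]
    · have : Function.update a y 1 = a := by rw [← h, Function.update_eq_self]
      rw [if_pos h, hchi, this, sub_sub_cancel]
  refine ⟨Q, P - (Phase.scale c (X y) + Phase.scale half (X y * BPoly.hat Q)),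
    fun h => notMem_coeffVars_deriv y P (hQv' h), hQv'.trans (coeffVars_deriv_subset y P),
    notMem_coeffVars_iff.2 fun a c => ?_, coeffVars_subset_iff.2 fun a b hab => ?_, fun a => ?_,
    by abel⟩
  · rw [hR, hR, Function.update_idem]
  · rw [hR, hR]
    refine ev_congr fun v hv => ?_
    by_cases hvy : v = y
    · simp [hvy]
    · simp [hvy, hab v hv]
  · rw [← hev, ← ev_add]
    congr 1
    abel

theorem prod_X (S : Mon V) :
    ∏ d ∈ S.vars.image X, d = (MonoidAlgebra.single S 1 : BPoly V) := by
  rw [Finset.prod_image fun x _ y _ h => X_injective h]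
  refine val_injective fun a => ?_
  rw [map_prod, val_single]
  simp only [val_X]
  have h := congrArg (Nat.cast : ℕ → ZMod 2) (Mon.prod_val a S)
  push_cast at h
  simpa using h

theorem hat_single (S : Mon V) :
    BPoly.hat (MonoidAlgebra.single S 1) = (MonoidAlgebra.single S 1 : IPoly V) := by
  refine val_injective fun a => ?_
  rw [BPoly.val_hat, val_single, val_single]
  split_ifs <;> simp [ZMod.val_one]

theorem scale_single (S : Mon V) (α : UnitAddCircle) :
    Phase.scale α (MonoidAlgebra.single S 1) = Finsupp.single S α := by
  refine ev_injective fun a => ?_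
  rw [ev_scale, val_single, ev_single]
  split_ifs <;> simp

end PolyLemmas

/-! ### The shape of terminal terms -/

namespace DSOP

variable {V : Type u} {n m : ℕ} {t : DSOP V n m}

theorem vars_legs (t : DSOP V n m) : ∀ i, vars (t.legs i) ⊆ t.bound :=
  forall_legs (p := fun p => vars p ⊆ t.bound).2 ⟨t.vars_O, t.vars_I⟩

theorem IsTerminal.const_notMem (ht : t.IsTerminal) {c : BPoly V} (hc : c = 0 ∨ c = 1) :
    c ∉ t.D := fun h =>
  ht ⟨t.s, t.bound, t.P, t.O, t.D.erase c, t.I, t.vars_P, t.vars_O,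
    fun d hd => t.vars_D d (Finset.mem_of_mem_erase hd), t.vars_I⟩
    (Step.cstGround _ _ c hc h rfl rfl rfl rfl rfl rfl)

theorem IsTerminal.not_xor (ht : t.IsTerminal) {E : Finset (BPoly V)} {d : BPoly V} {S : Mon V}
    (hd : d ∈ t.D) (hE : E ⊆ t.D.erase d) (hS : ∏ e ∈ E, e = MonoidAlgebra.single S 1) :
    d.coeff S = 0 := by
  by_contra hne
  have hv : S.vars ⊆ t.bound := (Finset.subset_biUnion_of_mem Mon.vars
    (mem_monomials.2 hne)).trans (t.vars_D d hd)
  refine ht ⟨t.s, t.bound, t.P, t.O, insert (d + MonoidAlgebra.single S 1) (t.D.erase d), t.I,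
    t.vars_P, t.vars_O, fun e he => ?_, t.vars_I⟩
    (Step.xorGround _ _ E d (d + MonoidAlgebra.single S 1) hd hE ?_ ?_ ?_ rfl rfl rfl rfl rfl rfl)
  · rcases Finset.mem_insert.1 he with rfl | he
    · exact vars_add_subset (t.vars_D d hd) ((Poly.vars_single S 1).trans hv)
    · exact t.vars_D e (Finset.mem_of_mem_erase he)
  · rw [hS]; exact add_add_cancel_self _ _
  · rw [hS]
    intro h
    have := congrArg (fun p : BPoly V => p.coeff S) h
    simp at this
  · rw [hS]; exact disjoint_single_of_coeff hne

/-- The rules `xorGround` and `cstGround` exclude constant terms and zero. If `d` had a variable `y`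
and another monomial, `y` itself would not be discarded, and `disc` would apply at `y`. -/
theorem IsTerminal.discard_eq_X (hg : t.Good) (ht : t.IsTerminal) {d : BPoly V} (hd : d ∈ t.D) :
    ∃ y, d = X y := by
  have hone : ∀ d ∈ t.D, d.coeff 1 = 0 := fun d hd =>
    -- The empty product is `1`, so the constant term can always be removed.
    ht.not_xor (E := ∅) hd (Finset.empty_subset _) (by simp [MonoidAlgebra.one_def])
  have hmono : ∀ d ∈ t.D, ∀ S, d.coeff S ≠ 0 → ∃ v, S = Mon.of {v} := fun d hd S hS => by
    rcases (hg.disc d hd).monomial_cases hS with rfl | h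
    · exact absurd (hone d hd) hS
    · exact h
  have hnz : d ≠ 0 := fun h => ht.const_notMem (Or.inl rfl) (h ▸ hd)
  obtain ⟨S, hS⟩ : ∃ S, d.coeff S ≠ 0 := by
    by_contra hall
    push Not at hall
    exact hnz (MonoidAlgebra.coeff_injective (Finsupp.ext hall))
  obtain ⟨y, rfl⟩ := hmono d hd S hS
  by_cases hq : d + X y = 0
  · refine ⟨y, ?_⟩
    rw [add_add_cancel_self d (X y), hq, add_zero]
  exfalso
  have hyd : y ∈ vars d := mem_vars.2 ⟨_, hS, Finset.mem_singleton_self y⟩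
  have hyb : y ∈ t.bound := t.vars_D d hd hyd
  have hXy : X y ∉ t.D := fun h => by
    refine hS (ht.not_xor (E := {X y}) hd ?_ (by rw [Finset.prod_singleton]; rfl))
    refine Finset.singleton_subset_iff.2 (Finset.mem_erase.2 ⟨?_, h⟩)
    rintro rfl
    exact hq (BPoly.add_self _)
  have hsub : ∀ {p : BPoly V}, vars p ⊆ t.bound → vars (subst y d p) ⊆ t.bound := fun hp =>
    vars_subst_subset hp (t.vars_D d hd) fun v hv _ => hv
  refine ht ⟨t.s, t.bound, t.P.subst y (BPoly.hat d), fun i => subst y d (t.O i),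
    t.D.image (subst y d), fun i => subst y d (t.I i),
    phase_vars_subst_subset t.vars_P (t.vars_D d hd) fun v hv _ => hv,
    fun i => hsub (t.vars_O i), fun e he => ?_, fun i => hsub (t.vars_I i)⟩
    (Step.disc _ _ y d (d + X y) hyb hd (add_add_cancel_self _ _) hq
      ((hg.disc d hd).notMem_vars_add_X hyd) ?_ rfl rfl rfl rfl rfl rfl)
  · obtain ⟨e, he', rfl⟩ := Finset.mem_image.1 he
    exact hsub (t.vars_D e he')
  -- An element with at most one monomial does not contain `y`: being affine, it would be `y`
  -- itself, which is not discarded. Such elements are unchanged, so the substitution creates no new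
  -- compound element.
  · unfold compound
    refine le_trans (Finset.card_le_card (t := ((t.D.erase d).filter
      fun d => 2 ≤ Poly.mon d).image (subst y d)) fun e he => ?_) Finset.card_image_le
    obtain ⟨he, h2⟩ := Finset.mem_filter.1 he
    obtain ⟨e, he', rfl⟩ := Finset.mem_image.1 he
    refine Finset.mem_image_of_mem _ (Finset.mem_filter.2 ⟨he', ?_⟩)
    by_contra hlt
    have heD := Finset.mem_of_mem_erase he'
    have hyv : y ∉ vars e := fun hyv => by
      have hc := (hg.disc e heD).coeff_of_mem_vars hyv
      have hcard : ¬ 2 ≤ (monomials e).card := hlt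
      obtain ⟨S, hS'⟩ := Finset.card_eq_one.1
        (le_antisymm (by omega) (Finset.card_pos.2 ⟨_, mem_monomials.2 hc⟩))
      have hSy : Mon.of {y} = S := by
        rw [← Finset.mem_singleton, ← hS']
        exact mem_monomials.2 hc
      have heX : e = X y := by
        rw [BPoly.eq_sum e, hS', Finset.sum_singleton, ← hSy]
        rfl
      exact hXy (heX ▸ heD)
    rw [subst_of_notMem hyv] at h2
    exact hlt h2

/-- The product of the discarded variables of `S` is the monomial `S`, which `zGround` would remove.
For empty `S` this is the global phase. -/
theorem IsTerminal.phase_eq_zero (ht : t.IsTerminal) {S : Mon V}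
    (hS : ∀ v ∈ S.vars, X v ∈ t.D) : t.P S = 0 := by
  by_contra hne
  have hE : Phase.scale (t.P S) (BPoly.hat (∏ d ∈ S.vars.image X, d)) =
      Finsupp.single S (t.P S) := by rw [prod_X, hat_single, scale_single]
  refine ht ⟨t.s, t.bound, t.P.erase S, t.O, t.D, t.I, fun v hv => ?_, t.vars_O, t.vars_D,
    t.vars_I⟩ (Step.zGround _ _ (S.vars.image X) (t.P S) (t.P.erase S) ?_ ?_ ?_ ?_
      rfl rfl rfl rfl rfl rfl)
  · obtain ⟨T, hT, hvT⟩ := mem_coeffVars.1 hv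
    refine t.vars_P (mem_coeffVars.2 ⟨T, fun h => hT ?_, hvT⟩)
    by_cases hTS : T = S
    · subst hTS; exact Finsupp.erase_same
    · rw [Finsupp.erase_ne hTS, h]
  · intro d hd
    obtain ⟨v, hv, rfl⟩ := Finset.mem_image.1 hd
    exact hS v hv
  · rw [hE, Finsupp.erase_add_single]
  · rw [hE]; exact Finsupp.single_ne_zero.2 hne
  · rw [hE, Finsupp.support_erase]
    exact Finset.disjoint_of_subset_right Finsupp.support_single_subset
      (Finset.disjoint_singleton_right.2 (Finset.notMem_erase S _))

theorem IsTerminal.fresh_discard (hg : t.Good) (ht : t.IsTerminal) {y : V} {D : Finset (BPoly V)}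
    (hD : D ⊆ t.D) (hy : X y ∉ D) : FreshD y D := fun d hd => by
  obtain ⟨z, rfl⟩ := ht.discard_eq_X hg (hD hd)
  refine notMem_vars_X ?_
  rintro rfl
  exact hy hd

/-- The linear coefficient of a discarded `y` already vanishes, so the phase splits as `y Q / 2 +
R`; without an occurrence in the legs, `hGround` would apply. -/
theorem IsTerminal.exists_leg_of_discard (hg : t.Good) (ht : t.IsTerminal) {y : V}
    (hy : X y ∈ t.D) : ∃ i, y ∈ vars (t.legs i) := by
  by_contra hall
  push Not at hall
  obtain ⟨hO, hI⟩ := forall_legs (p := fun p => y ∉ vars p).1 hall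
  have hyb : y ∈ t.bound := t.vars_D _ hy (mem_vars_X y)
  have hP0 : t.P (Mon.of {y}) = 0 := ht.phase_eq_zero fun v hv => by
    rwa [Finset.mem_singleton.1 hv]
  obtain ⟨Q, R, hQ, hQP, hR, hRP, -, hP⟩ := exists_split (y := y) (c := 0) hg.quad (by simp [hP0])
  have hz : Phase.scale 0 (X y : IPoly V) = 0 := eq_zero_of_ev fun a => by
    rw [ev_scale, smul_zero]
  have hD₀ : FreshD y (t.D.erase (X y)) :=
    ht.fresh_discard hg (Finset.erase_subset _ _) (Finset.notMem_erase _ _)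
  have mk : ∀ {A : Finset V}, A ⊆ t.bound → y ∉ A → A ⊆ t.bound.erase y := fun h h' v hv =>
    Finset.mem_erase.2 ⟨fun e => h' (e ▸ hv), h hv⟩
  refine ht ⟨Real.sqrt 2 * t.s, t.bound.erase y, R, t.O, insert Q (t.D.erase (X y)), t.I,
    mk (hRP.trans t.vars_P) hR, fun i => mk (t.vars_O i) (hO i), fun d hd => ?_,
    fun i => mk (t.vars_I i) (hI i)⟩ (Step.hGround _ _ y Q R (t.D.erase (X y)) hyb ?_
      (Finset.insert_erase hy).symm hQ hR hO hI hD₀ rfl rfl rfl rfl rfl rfl)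
  · rcases Finset.mem_insert.1 hd with rfl | hd
    · exact mk (hQP.trans t.vars_P) hQ
    · exact mk (t.vars_D d (Finset.mem_of_mem_erase hd)) (hD₀ d hd)
  · rw [hz, zero_add] at hP
    rw [add_comm]
    exact hP

/-- A variable absent from the legs, hence from the discards, is internal. Its linear coefficient is
a multiple of `1/4`. For `0` or `1/2` the cofactor is `Q / 2`, and `elim`, `zero` or `hh` applies
according to whether `Q` is `0`, `1` or not constant; for `1/4` or `3/4`, `omega` applies. -/
theorem IsTerminal.exists_leg (hg : t.Good) (ht : t.IsTerminal) (hz : ∀ y, ¬ t.IsZeroForm y) {y : V}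
    (hyb : y ∈ t.bound) : ∃ i, y ∈ vars (t.legs i) := by
  by_contra hall
  push Not at hall
  have hyD : X y ∉ t.D := fun h => by
    obtain ⟨i, hi⟩ := ht.exists_leg_of_discard hg h
    exact hall i hi
  have elim : ∀ {y}, y ∈ t.bound → (∀ i, y ∉ vars (t.legs i)) → X y ∉ t.D → y ∈ t.P.vars := by
    intro y hyb hL hyD
    by_contra hP
    obtain ⟨hO, hI⟩ := forall_legs (p := fun p => y ∉ vars p).1 hL
    have hD := ht.fresh_discard hg subset_rfl hyD
    have mk : ∀ {A : Finset V}, A ⊆ t.bound → y ∉ A → A ⊆ t.bound.erase y := fun h h' v hv =>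
      Finset.mem_erase.2 ⟨fun e => h' (e ▸ hv), h hv⟩
    exact ht ⟨2 * t.s, t.bound.erase y, t.P, t.O, t.D, t.I, mk t.vars_P hP,
      fun i => mk (t.vars_O i) (hO i), fun d hd => mk (t.vars_D d hd) (hD d hd),
      fun i => mk (t.vars_I i) (hI i)⟩
      (Step.elim _ _ y hyb hP hD hO hI rfl rfl rfl rfl rfl rfl)
  obtain ⟨hO, hI⟩ := forall_legs (p := fun p => y ∉ vars p).1 hall
  have hD := ht.fresh_discard hg subset_rfl hyD
  have mk : ∀ {A : Finset V}, A ⊆ t.bound → y ∉ A → A ⊆ t.bound.erase y := fun h h' v hv =>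
    Finset.mem_erase.2 ⟨fun e => h' (e ▸ hv), h hv⟩
  have h4 : 4 • t.P (Mon.of {y}) = 0 := hg.quad.four_nsmul (v := y) (Finset.mem_singleton_self y)
  by_cases h2 : 2 • t.P (Mon.of {y}) = 0
  · obtain ⟨Q, R, hQ, hQP, hR, hRP, hev, hP⟩ := exists_split (y := y) (c := 0) hg.quad
      (by rwa [sub_zero])
    have hscale : Phase.scale 0 (X y : IPoly V) = 0 := eq_zero_of_ev fun a => by
      rw [ev_scale, smul_zero]
    rw [hscale, zero_add] at hP
    by_cases hQv : vars Q = ∅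
    · rcases eq_zero_or_one_of_vars hQv with rfl | rfl
      · refine absurd (elim hyb hall hyD) ?_
        have : t.P = R := ev_injective fun a => by rw [hev]; simp
        rwa [this]
      · have hP' : t.P = Phase.scale half (X y) + R := ev_injective fun a => by
          rw [hev, ev_add, ev_scale, val_X_int, map_one, chi_apply]
          rcases zmod_two_cases (a y) with h | h <;> simp [h, ZMod.val_one]
        by_cases hne : t.s ≠ 1 ∨ R ≠ 0 ∨ t.O ≠ 0 ∨ t.I ≠ 0
        · have h0 : ∀ B : Finset V, vars (0 : BPoly V) ⊆ B := fun B => by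
            simp [Poly.vars, coeffVars]
          exact ht ⟨1, {y}, Phase.scale half (X y), 0, ∅, 0,
            (Phase.vars_scale _ _).trans (Poly.vars_X y), fun _ => h0 _,
            fun d hd => absurd hd (Finset.notMem_empty d), fun _ => h0 _⟩
            (Step.zero _ _ y R hyb hP' hne hR hD hO hI rfl rfl rfl rfl rfl rfl)
        -- When `zero` would change nothing else, the term is the zero form: any discarded variable
        -- would need a leg, and any second summation variable would be removed by `elim`.
        · push Not at hne
          obtain ⟨hs, hR0, hO0, hI0⟩ := hne
          have hL0 : ∀ i, ∀ z, z ∉ vars (t.legs i) := forall_legs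
            (p := fun p => ∀ z, z ∉ vars p).2
            ⟨fun i z => by rw [hO0]; simp [Poly.vars, coeffVars],
              fun i z => by rw [hI0]; simp [Poly.vars, coeffVars]⟩
          have hD0 : t.D = ∅ := by
            refine Finset.eq_empty_of_forall_notMem fun d hd => ?_
            obtain ⟨z, rfl⟩ := ht.discard_eq_X hg hd
            obtain ⟨i, hi⟩ := ht.exists_leg_of_discard hg hd
            exact hL0 i z hi
          rw [hR0, add_zero] at hP'
          refine hz y ⟨hs, ?_, hP', hO0, hD0, hI0⟩
          refine Finset.eq_singleton_iff_unique_mem.2 ⟨hyb, fun z hzb => ?_⟩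
          have := elim hzb (fun i => hL0 i z) (by rw [hD0]; exact Finset.notMem_empty _)
          rw [hP'] at this
          exact Finset.mem_singleton.1 (Poly.vars_X y (Phase.vars_scale _ _ this))
    · obtain ⟨y₁, hy₁⟩ := Finset.nonempty_iff_ne_empty.2 hQv
      -- As `Q` is affine, any of its variables `y₁` can be isolated: `Q = y₁ + (Q + y₁)` with `y₁`
      -- absent from the second summand.
      have hQa := (quadratic_and_isAffine_of_split hev hQ hR hg.quad).2
      have hne : y ≠ y₁ := fun h => hQ (h ▸ hy₁)
      have hy₁b : y₁ ∈ t.bound := t.vars_P (hQP hy₁)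
      have hQ₁ : y₁ ∉ vars (Q + X y₁) := hQa.notMem_vars_add_X hy₁
      have hQ₀ : y ∉ vars (Q + X y₁) := notMem_vars_add hQ (notMem_vars_X hne)
      have mk₁ : ∀ {A : Finset V}, A ⊆ t.bound.erase y → y₁ ∉ A →
          A ⊆ (t.bound.erase y).erase y₁ := fun h h' v hv =>
        Finset.mem_erase.2 ⟨fun e => h' (e ▸ hv), h hv⟩
      have hQ' : vars (Q + X y₁) ⊆ (t.bound.erase y).erase y₁ :=
        mk₁ (mk (vars_add_subset (hQP.trans t.vars_P) (vars_X_subset hy₁b)) hQ₀) hQ₁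
      have hsub : ∀ {p : BPoly V}, vars p ⊆ t.bound → y ∉ vars p →
          vars (subst y₁ (Q + X y₁) p) ⊆ (t.bound.erase y).erase y₁ := fun hp hyp =>
        vars_subst_subset (mk hp hyp) hQ' fun v hv hne => Finset.mem_erase.2 ⟨hne, hv⟩
      refine ht ⟨2 * t.s, (t.bound.erase y).erase y₁, R.subst y₁ (BPoly.hat (Q + X y₁)),
        fun i => subst y₁ (Q + X y₁) (t.O i), t.D.image (subst y₁ (Q + X y₁)),
        fun i => subst y₁ (Q + X y₁) (t.I i),
        phase_vars_subst_subset (mk (hRP.trans t.vars_P) hR) hQ'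
          fun v hv hne => Finset.mem_erase.2 ⟨hne, hv⟩,
        fun i => hsub (t.vars_O i) (hO i), fun d hd => ?_, fun i => hsub (t.vars_I i) (hI i)⟩
        (Step.hh _ _ y y₁ (Q + X y₁) R hyb hy₁b hne ?_ hR hQ₀ hD hO hI hQ₁
          rfl rfl rfl rfl rfl rfl)
      · obtain ⟨e, he, rfl⟩ := Finset.mem_image.1 hd
        exact hsub (t.vars_D e he) (hD e he)
      · refine ev_injective fun a => ?_
        rw [hev, ev_add, ev_scale_half_X_mul _ _ _ _ (X_add_hat_smul_half a y₁ (Q + X y₁)),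
          map_add (val a), val_X, zero_add, add_left_comm, zmod_two_add_self, add_zero]
  · have h2' : 2 • t.P (Mon.of {y}) = half := by
      refine (two_torsion ?_).resolve_left h2
      rw [← mul_smul]
      exact h4
    -- A coefficient `3/4` is `1/4 + 1/2`, the extra half going into the constant term of `Q`.
    obtain ⟨Q, R, hQ, hQP, hR, hRP, -, hP⟩ := exists_split (y := y) (c := quarter) hg.quad
      (by rw [smul_sub, h2', two_nsmul, quarter_add_quarter, sub_self])
    refine ht ⟨Real.sqrt 2 * t.s, t.bound.erase y,
      Phase.scale eighth 1 - Phase.scale quarter (BPoly.hat Q) + R, t.O, t.D, t.I, ?_,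
      fun i => mk (t.vars_O i) (hO i), fun d hd => mk (t.vars_D d hd) (hD d hd),
      fun i => mk (t.vars_I i) (hI i)⟩
      (Step.omega _ _ y Q R hyb hP hQ hR hD hO hI rfl rfl rfl rfl rfl rfl)
    refine coeffVars_subset_iff.2 fun a b hab => ?_
    rw [ev_add, ev_sub, ev_add, ev_sub, ev_scale, ev_scale, ev_scale, ev_scale, map_one, map_one,
      BPoly.val_hat, BPoly.val_hat, vars_subset_iff.1 (mk (hQP.trans t.vars_P) hQ) a b hab,
      coeffVars_subset_iff.1 (mk (hRP.trans t.vars_P) hR) a b hab]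

/-- A variable occurs in a leg, and in no earlier one. -/
def NewAt (t : DSOP V n m) (y : V) (i : Fin (m + n)) : Prop :=
  y ∈ vars (t.legs i) ∧ ∀ j < i, y ∉ vars (t.legs j)

theorem IsTerminal.not_leg_split (ht : t.IsTerminal) {y : V} {i : Fin (m + n)}
    (hy : t.NewAt y i) {q r : BPoly V} (hsum : t.legs i = X y + q + r) (hne : q ≠ 0)
    (split : Disjoint (Poly.monomials q) (Poly.monomials r))
    (hqv : vars q ⊆ t.bound)
    (freshq : y ∉ vars q) (freshr : y ∉ vars r)
    (hD : FreshD y t.D ∨ (Poly.X y ∈ insert 1 t.D ∧ q ∈ insert 1 t.D)) : False := by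
  have hyb : y ∈ t.bound := t.vars_legs i hy.1
  have hq' : vars (X y + q) ⊆ t.bound := vars_add_subset (vars_X_subset hyb) hqv
  have hsub : ∀ {p : BPoly V}, vars p ⊆ t.bound → vars (subst y (X y + q) p) ⊆ t.bound := fun hp =>
    vars_subst_subset hp hq' fun v hv _ => hv
  have hP : (t.P.subst y (BPoly.hat (X y + q))).vars ⊆ t.bound :=
    phase_vars_subst_subset t.vars_P hq' fun v hv _ => hv
  revert hy hsum
  refine Fin.addCases (fun k => ?_) (fun k => ?_) i
  · intro hy hsum
    rw [legs, Fin.append_left] at hsum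
    refine ht ⟨t.s, t.bound, t.P.subst y (BPoly.hat (X y + q)),
      fun j => subst y (X y + q) (t.O j), t.D, fun j => subst y (X y + q) (t.I j), hP,
      fun i => hsub (t.vars_O i), t.vars_D, fun i => hsub (t.vars_I i)⟩
      (Step.ket _ _ y k q r hyb hsum hne split (fun j hj => ?_) freshq freshr hD
        rfl rfl rfl rfl rfl rfl)
    have := hy.2 (Fin.castAdd n j) (show (j : ℕ) < k from hj)
    rwa [legs, Fin.append_left] at this
  · intro hy hsum
    rw [legs, Fin.append_right] at hsum
    refine ht ⟨t.s, t.bound, t.P.subst y (BPoly.hat (X y + q)),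
      t.O, t.D, fun j => subst y (X y + q) (t.I j), hP,
      t.vars_O, t.vars_D, fun i => hsub (t.vars_I i)⟩
      (Step.bra _ _ y k q r hyb hsum hne split (fun j => ?_) (fun j hj => ?_) freshq freshr hD
        rfl rfl rfl rfl rfl rfl)
    · have := hy.2 (Fin.castAdd n j) (by
        rw [Fin.lt_def, Fin.val_castAdd, Fin.val_natAdd]; omega)
      rwa [legs, Fin.append_left] at this
    · have := hy.2 (Fin.natAdd m j) (by simpa using hj)
      rwa [legs, Fin.append_right] at this

/-- The shape of the terminal terms with a nonzero interpretation. -/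
structure IsNormal (t : DSOP V n m) : Prop where
  pos : 0 < t.s
  affine : ∀ i, IsAffine (t.legs i)
  discard : ∀ d ∈ t.D, ∃ y, d = X y
  phase : ∀ S : Mon V, (∀ v ∈ S.vars, X v ∈ t.D) → t.P S = 0
  occurs : ∀ y ∈ t.bound, ∃ i, y ∈ vars (t.legs i)
  free : ∀ y i, t.NewAt y i → X y ∉ t.D → t.legs i = X y
  tied : ∀ y i, t.NewAt y i → X y ∈ t.D → ∀ S, (t.legs i).coeff S ≠ 0 → S ≠ Mon.of {y} →
    ∃ z, S = Mon.of {z} ∧ X z ∉ t.D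

/-- For `free`, the whole remainder of the leg is absorbed into `y` at once. For `tied`, one
offending monomial at a time suffices: a constant or a discarded variable is exactly what the side
condition of `ket` and `bra` admits. -/
theorem IsTerminal.isNormal (hg : t.Good) (ht : t.IsTerminal) (hz : ∀ y, ¬ t.IsZeroForm y) :
    t.IsNormal where
  pos := hg.pos
  affine := hg.legs
  discard _ hd := ht.discard_eq_X hg hd
  phase _ hS := ht.phase_eq_zero hS
  occurs _ hy := ht.exists_leg hg hz hy
  free y i hy hyD := by
    by_contra hne
    refine ht.not_leg_split hy (q := t.legs i + X y) (r := 0) ?_ ?_ ?_ ?_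
      ((hg.legs i).notMem_vars_add_X hy.1) ?_ (Or.inl (ht.fresh_discard hg subset_rfl hyD))
    · rw [add_zero]; exact add_add_cancel_self _ _
    · intro h
      apply hne
      rw [add_add_cancel_self (t.legs i) (X y), h, add_zero]
    · simp [monomials]
    · exact vars_add_subset (t.vars_legs i) (vars_X_subset (t.vars_legs i hy.1))
    · simp [Poly.vars, coeffVars]
  tied y i hy hyD S hS hSy := by
    by_contra hno
    have hqD : (MonoidAlgebra.single S 1 : BPoly V) ∈ insert 1 t.D := by
      rcases (hg.legs i).monomial_cases hS with rfl | ⟨z, rfl⟩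
      · exact Finset.mem_insert_self _ _
      · refine Finset.mem_insert_of_mem ?_
        by_contra hzD
        exact hno ⟨z, rfl, hzD⟩
    have hyS : y ∉ S.vars := fun h =>
      hSy (eq_of_mem_of_card h fun h2 => hS ((hg.legs i).coeff_eq_zero h2))
    have hyS' : y ∉ vars (MonoidAlgebra.single S 1 : BPoly V) := fun h =>
      hyS (Poly.vars_single S 1 h)
    have hc : (t.legs i + X y).coeff S ≠ 0 := by
      rw [MonoidAlgebra.coeff_add, Finsupp.add_apply, X, coeff_single_of_ne (Ne.symm hSy),
        add_zero]
      exact hS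
    refine ht.not_leg_split hy (q := MonoidAlgebra.single S 1)
      (r := t.legs i + X y + MonoidAlgebra.single S 1) ?_ ?_ (disjoint_single_of_coeff hc) ?_ hyS'
      (notMem_vars_add ((hg.legs i).notMem_vars_add_X hy.1) hyS')
      (Or.inr ⟨Finset.mem_insert_of_mem hyD, hqD⟩)
    · rw [add_assoc, ← add_add_cancel_self]
      exact add_add_cancel_self _ _
    · intro h
      have := congrArg (fun p : BPoly V => p.coeff S) h
      simp at this
    · exact (Poly.vars_single S 1).trans ((Finset.subset_biUnion_of_mem Mon.vars
        (mem_monomials.2 hS)).trans (t.vars_legs i))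

end DSOP

/-! ### Single-path sums and extension of bijections -/

section Extension

variable {V : Type u}

theorem psum_eq_of_unique {B : Finset V} {a : V → ZMod 2} {g : (V → ZMod 2) → ℂ}
    (h₀ : ∀ b, ¬ (∀ v ∈ B, b v = a v) → g b = 0)
    (h₁ : ∀ b, (∀ v ∈ B, b v = a v) → g b = g a) : psum B g = g a := by
  have hm : ∀ v, v ∈ B.filter (fun v => a v = 1) ↔ v ∈ B ∧ a v = 1 := fun v => Finset.mem_filter
  unfold psum
  rw [Finset.sum_eq_single (B.filter fun v => a v = 1)]
  · refine h₁ _ fun v hv => ?_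
    rcases zmod_two_cases (a v) with h | h <;> simp [ind, hm, hv, h]
  · intro T hT hne
    refine h₀ _ fun h => hne (Finset.ext fun v => ?_)
    rw [hm]
    constructor
    · intro hv
      have hvB := Finset.mem_powerset.1 hT hv
      exact ⟨hvB, by rw [← h v hvB]; simp [ind, hv]⟩
    · rintro ⟨hvB, hv⟩
      by_contra hvT
      have := h v hvB
      rw [hv] at this
      simp [ind, hvT] at this
  · intro h
    exact absurd (Finset.mem_powerset.2 (Finset.filter_subset _ _)) h

/-- An injection between finite sets of the same size extends to a permutation. -/
theorem exists_perm_extending {A B : Finset V} {f : V → V} (hf : Set.BijOn f A B) :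
    ∃ σ : Equiv.Perm V, ∀ v ∈ A, σ v = f v := by
  -- `V` may be infinite, so the bijection is extended inside the finite set `A ∪ B`, and by the
  -- identity outside.
  let U := {x // x ∈ A ∪ B}
  have hU : ∀ v ∈ A, v ∈ A ∪ B := fun v hv => Finset.mem_union_left B hv
  have hU' : ∀ v ∈ A, f v ∈ A ∪ B := fun v hv => Finset.mem_union_right A (hf.mapsTo hv)
  let F : {x : U // x.1 ∈ A} → {x : U // x.1 ∈ B} := fun x =>
    ⟨⟨f x.1.1, hU' _ x.2⟩, hf.mapsTo x.2⟩
  have hF : Function.Bijective F := by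
    constructor
    · intro x y hxy
      have : f x.1.1 = f y.1.1 := congrArg (fun z => z.1.1) hxy
      exact Subtype.ext (Subtype.ext (hf.injOn x.2 y.2 this))
    · intro y
      obtain ⟨x, hx, hxy⟩ := hf.surjOn y.2
      exact ⟨⟨⟨x, hU x hx⟩, hx⟩, Subtype.ext (Subtype.ext hxy)⟩
  refine ⟨Equiv.Perm.ofSubtype (Equiv.extendSubtype (Equiv.ofBijective F hF)), fun v hv => ?_⟩
  rw [Equiv.Perm.ofSubtype_apply_of_mem _ (hU v hv)]
  exact congrArg Subtype.val
    (Equiv.extendSubtype_apply_of_mem (Equiv.ofBijective F hF) ⟨v, hU v hv⟩ hv)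

end Extension

/-! ### Uniqueness of normal terms -/

namespace DSOP

variable {V : Type u} {n m : ℕ} {t t₁ t₂ : DSOP V n m}

/-- The value of the legs along a path. -/
def out (t : DSOP V n m) (a : V → ZMod 2) : Fin (m + n) → ZMod 2 := fun i => val a (t.legs i)

/-- Two paths agree on the discarded variables. -/
def Agree (t : DSOP V n m) (a b : V → ZMod 2) : Prop := ∀ y, X y ∈ t.D → a y = b y

theorem NewAt.mem_bound {y : V} {i : Fin (m + n)} (h : t.NewAt y i) : y ∈ t.bound :=
  t.vars_legs i h.1

theorem NewAt.index_unique {y : V} {i j : Fin (m + n)} (hi : t.NewAt y i) (hj : t.NewAt y j) :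
    i = j := by
  rcases lt_trichotomy i j with h | h | h
  · exact absurd hi.1 (hj.2 i h)
  · exact h
  · exact absurd hj.1 (hi.2 j h)

theorem exists_newAt_le {y : V} {i : Fin (m + n)} (h : y ∈ vars (t.legs i)) :
    ∃ j ≤ i, t.NewAt y j := by
  induction i using WellFoundedLT.induction with
  | ind i ih =>
    by_cases hn : t.NewAt y i
    · exact ⟨i, le_rfl, hn⟩
    · have : ∃ j < i, y ∈ vars (t.legs j) := by
        by_contra hno
        push Not at hno
        exact hn ⟨h, hno⟩
      obtain ⟨j, hj, hy⟩ := this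
      obtain ⟨k, hk, hyk⟩ := ih j hj hy
      exact ⟨k, hk.trans hj.le, hyk⟩

namespace IsNormal

theorem agree_iff (h : t.IsNormal) {a b : V → ZMod 2} :
    (∀ d ∈ t.D, val a d = val b d) ↔ t.Agree a b := by
  constructor
  · intro hd y hy
    simpa [val_X] using hd _ hy
  · intro hd d hdD
    obtain ⟨y, rfl⟩ := h.discard d hdD
    rw [val_X, val_X]
    exact hd y hdD

/-- A leg that introduces a variable which is not discarded consists of it alone; one that
introduces a discarded variable contains no other discarded one. -/
theorem newAt_unique (h : t.IsNormal) {y z : V} {i : Fin (m + n)} (hy : t.NewAt y i)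
    (hz : t.NewAt z i) : y = z := by
  have key : ∀ {y z}, t.NewAt y i → t.NewAt z i → X y ∉ t.D → y = z := fun hy hz hyD => by
    by_contra hne
    have := hz.1
    rw [h.free _ i hy hyD] at this
    exact notMem_vars_X (Ne.symm hne) this
  by_cases hyD : X y ∈ t.D
  · by_cases hzD : X z ∈ t.D
    · by_contra hne
      obtain ⟨w, hw, hwD⟩ := h.tied y i hy hyD _ ((h.affine i).coeff_of_mem_vars hz.1)
        fun e => hne (Finset.singleton_injective (show ({z} : Finset V) = {y} from e)).symm
      rw [← Finset.singleton_injective (show ({z} : Finset V) = {w} from hw)] at hwD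
      exact hwD hzD
    · exact (key hz hy hzD).symm
  · exact key hy hz hyD

theorem exists_newAt (h : t.IsNormal) {y : V} (hy : y ∈ t.bound) : ∃ i, t.NewAt y i := by
  obtain ⟨i, hi⟩ := h.occurs y hy
  obtain ⟨j, -, hj⟩ := exists_newAt_le hi
  exact ⟨j, hj⟩

/-- Triangular solving: besides its new variable, leg `i` only involves variables introduced
earlier, which are determined by induction. -/
theorem eq_of_out_eq (h : t.IsNormal) {a b : V → ZMod 2} {i : Fin (m + n)}
    (hab : ∀ j ≤ i, t.out a j = t.out b j) {v : V} (hv : t.NewAt v i) : a v = b v := by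
  induction i using WellFoundedLT.induction generalizing v with
  | ind i ih =>
    have hr : val a (t.legs i + X v) = val b (t.legs i + X v) := by
      refine val_congr fun w hw => ?_
      have hwv : w ≠ v := by
        rintro rfl
        exact (h.affine i).notMem_vars_add_X hv.1 hw
      have hwi : w ∈ vars (t.legs i) := by
        rcases Finset.mem_union.1 (Poly.vars_add _ _ hw) with hw | hw
        · exact hw
        · exact absurd (Finset.mem_singleton.1 (Poly.vars_X v hw)) hwv
      obtain ⟨j, hj, hwj⟩ := exists_newAt_le hwi
      have hne : j ≠ i := by
        rintro rfl
        exact hwv (h.newAt_unique hwj hv)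
      exact ih j (lt_of_le_of_ne hj hne) (fun k hk => hab k (hk.trans hj)) hwj
    rw [map_add, map_add, val_X, val_X] at hr
    have hi : val a (t.legs i) = val b (t.legs i) := hab i le_rfl
    rw [hi] at hr
    exact add_left_cancel hr

theorem eq_on_bound (h : t.IsNormal) {a b : V → ZMod 2} (hab : t.out a = t.out b) :
    ∀ v ∈ t.bound, a v = b v := fun v hv => by
  obtain ⟨i, hi⟩ := h.exists_newAt hv
  exact h.eq_of_out_eq (fun j _ => congrFun hab j) hi

/-- Outputs determine paths on the summation variables, so at most the pair `a`, `b` itself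
contributes. -/
theorem dens_out (h : t.IsNormal) (a b : V → ZMod 2) :
    t.dens (t.out a) (t.out b) =
      (t.s : ℂ) ^ 2 * if t.Agree a b then cis (ev a t.P - ev b t.P) else 0 := by
  have hitcongr : ∀ x₁ x₂, ∀ {a a' b b' : V → ZMod 2}, (∀ v ∈ t.bound, a' v = a v) →
      (∀ v ∈ t.bound, b' v = b v) → (t.Hit x₁ x₂ a' b' ↔ t.Hit x₁ x₂ a b) := by
    intro x₁ x₂ a a' b b' ha hb
    unfold Hit
    have e1 : ∀ i, val a' (t.legs i) = val a (t.legs i) := fun i =>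
      val_congr fun v hv => ha v (t.vars_legs i hv)
    have e2 : ∀ i, val b' (t.legs i) = val b (t.legs i) := fun i =>
      val_congr fun v hv => hb v (t.vars_legs i hv)
    simp only [e1, e2]
    refine and_congr_right fun _ => and_congr_right fun _ => forall₂_congr fun d hd => ?_
    rw [val_congr fun v hv => ha v (t.vars_D d hd hv), val_congr fun v hv => hb v (t.vars_D d hd hv)]
  have evcongr : ∀ {a a' : V → ZMod 2}, (∀ v ∈ t.bound, a' v = a v) → ev a' t.P = ev a t.P :=
    fun ha => ev_congr fun v hv => ha v (t.vars_P hv)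
  unfold dens
  congr 1
  rw [psum_eq_of_unique (a := a), psum_eq_of_unique (a := b)]
  · have hh : t.Hit (t.out a) (t.out b) a b ↔ t.Agree a b := by
      rw [← h.agree_iff]
      exact ⟨fun hh => hh.2.2, fun hh => ⟨fun _ => rfl, fun _ => rfl, hh⟩⟩
    simp only [hh, cis_mul_conj]
    split_ifs <;> simp
  · intro b' hb'
    rw [if_neg, mul_zero]
    exact fun hh => hb' (h.eq_on_bound (funext hh.2.1))
  · intro b' hb'
    simp only [evcongr hb', hitcongr _ _ (fun v _ => rfl : ∀ v ∈ t.bound, a v = a v) hb']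
  · intro a' ha'
    refine Finset.sum_eq_zero fun T _ => ?_
    show _ * (if t.Hit _ _ a' _ then _ else _) = (0 : ℂ)
    rw [if_neg, mul_zero]
    exact fun hh => ha' (h.eq_on_bound (funext hh.1))
  · intro a' ha'
    refine psum_congr fun b' => ?_
    simp only [evcongr ha', hitcongr _ _ ha' (fun v _ => rfl : ∀ v ∈ t.bound, b' v = b' v)]

theorem dens_self (h : t.IsNormal) (a : V → ZMod 2) :
    t.dens (t.out a) (t.out a) = (t.s : ℂ) ^ 2 := by
  rw [h.dens_out, if_pos (show t.Agree a a from fun _ _ => rfl), sub_self, cis_zero, mul_one]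

theorem dens_self_ne_zero (h : t.IsNormal) (a : V → ZMod 2) :
    t.dens (t.out a) (t.out a) ≠ 0 := by
  rw [h.dens_self]
  exact pow_ne_zero 2 (Complex.ofReal_ne_zero.2 h.pos.ne')

/-- Diagonal coefficients at outputs of a normal term are nonzero, so the common density detects
which outputs are reached. -/
theorem exists_out_eq (h₂ : t₂.IsNormal) (hd : t₁.dens = t₂.dens) (a : V → ZMod 2) :
    ∃ c, t₁.out c = t₂.out a := by
  by_contra hno
  push Not at hno
  refine h₂.dens_self_ne_zero a ?_
  rw [← hd]
  unfold dens
  refine mul_eq_zero_of_right _ (Finset.sum_eq_zero fun T _ => Finset.sum_eq_zero fun T' _ => ?_)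
  show _ * (if t₁.Hit _ _ _ _ then _ else _) = (0 : ℂ)
  rw [if_neg, mul_zero]
  exact fun hh => hno _ (funext hh.1)

theorem s_eq (h₁ : t₁.IsNormal) (h₂ : t₂.IsNormal) (hd : t₁.dens = t₂.dens) : t₁.s = t₂.s := by
  obtain ⟨c, hc⟩ := exists_out_eq h₂ hd 0
  have e := h₁.dens_self c
  rw [hc, hd, h₂.dens_self] at e
  have e' : t₂.s ^ 2 = t₁.s ^ 2 := by exact_mod_cast e
  exact ((pow_left_inj₀ h₂.pos.le h₁.pos.le two_ne_zero).1 e').symm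

/-- Agreement on the discarded variables is the nonvanishing of the coefficient at the two outputs.
-/
theorem agree_iff_of_out_eq (h₁ : t₁.IsNormal) (h₂ : t₂.IsNormal) (hd : t₁.dens = t₂.dens)
    {a b c e : V → ZMod 2} (hac : t₁.out c = t₂.out a) (hbe : t₁.out e = t₂.out b) :
    t₁.Agree c e ↔ t₂.Agree a b := by
  have key := h₁.dens_out c e
  have hs : ∀ {t : DSOP V n m}, t.IsNormal → (t.s : ℂ) ^ 2 ≠ 0 := fun h =>
    pow_ne_zero 2 (Complex.ofReal_ne_zero.2 h.pos.ne')
  rw [hac, hbe, hd, h₂.dens_out] at key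
  constructor
  · intro hc
    by_contra ha
    rw [if_neg ha, if_pos hc, mul_zero] at key
    exact mul_ne_zero (hs h₁) (cis_ne_zero _) key.symm
  · intro ha
    by_contra hc
    rw [if_pos ha, if_neg hc, mul_zero] at key
    exact mul_ne_zero (hs h₂) (cis_ne_zero _) key

theorem phase_sub_eq (h₁ : t₁.IsNormal) (h₂ : t₂.IsNormal) (hd : t₁.dens = t₂.dens)
    {a b c e : V → ZMod 2} (hac : t₁.out c = t₂.out a) (hbe : t₁.out e = t₂.out b)
    (hab : t₂.Agree a b) : ev c t₁.P - ev e t₁.P = ev a t₂.P - ev b t₂.P := by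
  have key := h₁.dens_out c e
  rw [hac, hbe, hd, h₂.dens_out, if_pos hab,
    if_pos ((agree_iff_of_out_eq h₁ h₂ hd hac hbe).2 hab), h₁.s_eq h₂ hd] at key
  have hs : (t₂.s : ℂ) ^ 2 ≠ 0 := pow_ne_zero 2 (Complex.ofReal_ne_zero.2 h₂.pos.ne')
  exact (cis_injective (mul_left_cancel₀ hs key)).symm

/-- Describes new variables through outputs alone, so that they can be compared between terms:
flipping a variable new at `i` first alters output `i`. Taking `K` empty detects any new variable,
and `K` the discarded variables detects one that is not discarded. -/
theorem exists_newAt_iff (h : t.IsNormal) (K : Set V) (i : Fin (m + n)) :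
    (∃ v, t.NewAt v i ∧ v ∉ K) ↔ ∃ a b : V → ZMod 2, (∀ v ∈ K, a v = b v) ∧
      (∀ j < i, t.out a j = t.out b j) ∧ t.out a i ≠ t.out b i := by
  constructor
  · rintro ⟨v, hv, hvK⟩
    refine ⟨0, Function.update 0 v 1, fun w hw => ?_, fun j hj => ?_, ?_⟩
    · rw [Function.update_of_ne]
      rintro rfl; exact hvK hw
    · exact (notMem_vars_iff.1 (hv.2 j hj) 0 1).symm
    · have e := notMem_vars_iff.1 ((h.affine i).notMem_vars_add_X hv.1) 0 1
      intro heq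
      have heq' : val 0 (t.legs i) = val (Function.update 0 v 1) (t.legs i) := heq
      rw [map_add, map_add, val_X, val_X, ← heq', Function.update_self] at e
      exact absurd (add_left_cancel e) (by simp)
  · rintro ⟨a, b, hK, hlt, hne⟩
    by_contra hno
    refine hne (val_congr fun v hv => ?_)
    obtain ⟨j, hj, hvj⟩ := exists_newAt_le hv
    rcases hj.lt_or_eq with hj | rfl
    · exact h.eq_of_out_eq (fun k hk => hlt k (hk.trans_lt hj)) hvj
    · by_contra hab
      exact hno ⟨v, hvj, fun hvK => hab (hK v hvK)⟩

theorem newAt_transfer (h₁ : t₁.IsNormal) (h₂ : t₂.IsNormal) (hd : t₁.dens = t₂.dens)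
    {v : V} {i : Fin (m + n)} (hv : t₁.NewAt v i) :
    ∃ w, t₂.NewAt w i ∧ (X v ∉ t₁.D → X w ∉ t₂.D) := by
  by_cases hvD : X v ∈ t₁.D
  · obtain ⟨a, b, -, hlt, hne⟩ := (h₁.exists_newAt_iff ∅ i).1 ⟨v, hv, id⟩
    obtain ⟨a', ha⟩ := exists_out_eq h₁ hd.symm a
    obtain ⟨b', hb⟩ := exists_out_eq h₁ hd.symm b
    rw [← ha, ← hb] at hlt hne
    obtain ⟨w, hw, -⟩ := (h₂.exists_newAt_iff ∅ i).2 ⟨a', b', fun _ h => absurd h id, hlt, hne⟩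
    exact ⟨w, hw, fun h => absurd hvD h⟩
  · obtain ⟨a, b, hK, hlt, hne⟩ := (h₁.exists_newAt_iff {y | X y ∈ t₁.D} i).1 ⟨v, hv, hvD⟩
    obtain ⟨a', ha⟩ := exists_out_eq h₁ hd.symm a
    obtain ⟨b', hb⟩ := exists_out_eq h₁ hd.symm b
    have hag := (agree_iff_of_out_eq h₂ h₁ hd.symm ha hb).2 hK
    rw [← ha, ← hb] at hlt hne
    obtain ⟨w, hw, hwD⟩ := (h₂.exists_newAt_iff {y | X y ∈ t₂.D} i).2 ⟨a', b', hag, hlt, hne⟩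
    exact ⟨w, hw, fun _ => hwD⟩

/-- The other monomials of the leg are variables that are not discarded, here set to zero. -/
theorem val_tied (h : t.IsNormal) {y : V} {i : Fin (m + n)} (hy : t.NewAt y i) (hyD : X y ∈ t.D)
    {a : V → ZMod 2} (ha : ∀ z ∈ vars (t.legs i), X z ∉ t.D → a z = 0) :
    t.out a i = a y := by
  have hr : val a (t.legs i + X y) = 0 := by
    rw [BPoly.val_eq_sum]
    refine Finset.sum_eq_zero fun S hS => if_neg fun hold => ?_
    have hS' := mem_monomials.1 hS
    have hSy : S ≠ Mon.of {y} := by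
      rintro rfl
      exact (h.affine i).notMem_vars_add_X hy.1
        (mem_vars.2 ⟨_, hS', Finset.mem_singleton_self y⟩)
    rw [MonoidAlgebra.coeff_add, Finsupp.add_apply, X, coeff_single_of_ne (Ne.symm hSy),
      add_zero] at hS'
    obtain ⟨z, rfl, hzD⟩ := h.tied y i hy hyD S hS' hSy
    have h1 := hold z (Finset.mem_singleton_self z)
    rw [ha z (mem_vars.2 ⟨_, hS', Finset.mem_singleton_self z⟩) hzD] at h1
    exact absurd h1 (by decide)
  rw [map_add, val_X] at hr
  show val a (t.legs i) = a y
  rw [← sub_eq_zero, sub_eq_add_neg, ZMod.neg_eq_self_mod_two]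
  exact hr

/-- Each summation variable is new at exactly one leg, which introduces no other; variables
introduced by the same leg of the two terms are matched. -/
theorem exists_renaming (h₁ : t₁.IsNormal) (h₂ : t₂.IsNormal) (hd : t₁.dens = t₂.dens) :
    ∃ σ : Equiv.Perm V, t₂.bound = t₁.bound.image σ ∧
      (∀ v i, t₁.NewAt v i → t₂.NewAt (σ v) i) ∧ ∀ v, X v ∈ t₁.D ↔ X (σ v) ∈ t₂.D := by
  have hex : ∀ v, ∃ w, ∀ i, t₁.NewAt v i → t₂.NewAt w i := fun v => by
    by_cases hv : ∃ i, t₁.NewAt v i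
    · obtain ⟨i, hi⟩ := hv
      obtain ⟨w, hw, -⟩ := newAt_transfer h₁ h₂ hd hi
      exact ⟨w, fun j hj => hi.index_unique hj ▸ hw⟩
    · exact ⟨v, fun i hi => absurd ⟨i, hi⟩ hv⟩
  choose f hf using hex
  have hbij : Set.BijOn f t₁.bound t₂.bound := by
    refine ⟨fun v hv => ?_, fun v hv w hw hvw => ?_, fun w hw => ?_⟩
    · obtain ⟨i, hi⟩ := h₁.exists_newAt hv
      exact (hf v i hi).mem_bound
    · obtain ⟨i, hi⟩ := h₁.exists_newAt hv
      obtain ⟨j, hj⟩ := h₁.exists_newAt hw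
      have e := hf v i hi
      rw [hvw] at e
      have hij := e.index_unique (hf w j hj)
      subst hij
      exact h₁.newAt_unique hi hj
    · obtain ⟨i, hi⟩ := h₂.exists_newAt hw
      obtain ⟨v, hv, -⟩ := newAt_transfer h₂ h₁ hd.symm hi
      exact ⟨v, hv.mem_bound, h₂.newAt_unique (hf v i hv) hi⟩
  obtain ⟨σ, hσ⟩ := exists_perm_extending hbij
  have hb : t₂.bound = t₁.bound.image σ := by
    refine Finset.ext fun w => ?_
    rw [Finset.mem_image]
    constructor
    · intro hw
      obtain ⟨v, hv, rfl⟩ := hbij.surjOn hw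
      exact ⟨v, hv, hσ v hv⟩
    · rintro ⟨v, hv, rfl⟩
      rw [hσ v hv]
      exact hbij.mapsTo hv
  have hnew : ∀ v i, t₁.NewAt v i → t₂.NewAt (σ v) i := fun v i hi => by
    rw [hσ v hi.mem_bound]
    exact hf v i hi
  have hmem : ∀ {t : DSOP V n m} {v}, X v ∈ t.D → v ∈ t.bound := fun {t v} h =>
    t.vars_D _ h (mem_vars_X v)
  refine ⟨σ, hb, hnew, fun v => ?_⟩
  by_cases hv : v ∈ t₁.bound
  · obtain ⟨i, hi⟩ := h₁.exists_newAt hv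
    constructor
    · intro hD
      by_contra hD'
      obtain ⟨w, hw, hwD⟩ := newAt_transfer h₂ h₁ hd.symm (hnew v i hi)
      rw [h₁.newAt_unique hi hw] at hD
      exact hwD hD' hD
    · intro hD
      by_contra hD'
      obtain ⟨w, hw, hwD⟩ := newAt_transfer h₁ h₂ hd hi
      rw [h₂.newAt_unique (hnew v i hi) hw] at hD
      exact hwD hD' hD
  · refine ⟨fun h => absurd (hmem h) hv, fun h => absurd (hmem h) ?_⟩
    rw [hb, Finset.mem_image]
    rintro ⟨w, hw, he⟩
    exact hv (σ.injective he ▸ hw)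

/-- Normal terms with the same interpretation are equal up to renaming. -/
theorem alphaEq (h₁ : t₁.IsNormal) (h₂ : t₂.IsNormal) (hd : t₁.dens = t₂.dens) :
    t₁.AlphaEq t₂ := by
  obtain ⟨σ, hb, hnew, hD⟩ := exists_renaming h₁ h₂ hd
  have hfree : ∀ {a c : V → ZMod 2}, t₁.out c = t₂.out a → ∀ v ∈ t₁.bound, X v ∉ t₁.D →
      c v = a (σ v) := by
    intro a c hac v hv hvD
    obtain ⟨i, hi⟩ := h₁.exists_newAt hv
    have e := congrFun hac i
    rw [out, out, h₁.free v i hi hvD, h₂.free _ i (hnew v i hi) fun h => hvD ((hD v).2 h), val_X,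
      val_X] at e
    exact e
  -- A reference path agreeing with `a` on the discarded variables and zero elsewhere. On it, tied
  -- legs reveal their discarded variable and the phase vanishes.
  let cut : (V → ZMod 2) → V → ZMod 2 := fun a w => if X w ∈ t₂.D then a w else 0
  have hcut : ∀ a, t₂.Agree a (cut a) := fun a y hy => (if_pos hy).symm
  have hout : ∀ a : V → ZMod 2, t₁.out (fun v => a (σ v)) = t₂.out a := by
    intro a
    obtain ⟨c, hc⟩ := exists_out_eq h₂ hd a
    obtain ⟨c', hc'⟩ := exists_out_eq h₂ hd (cut a)
    -- The discarded values of `c` equal those of `c'`, and the latter can be read off the outputs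
    -- because the remaining variables of `c'` are zero.
    have hag := (agree_iff_of_out_eq h₁ h₂ hd hc hc').2 (hcut a)
    have hcv : ∀ v ∈ t₁.bound, a (σ v) = c v := fun v hv => by
      by_cases hvD : X v ∈ t₁.D
      · obtain ⟨i, hi⟩ := h₁.exists_newAt hv
        have hvD' := (hD v).1 hvD
        have e₁ : t₁.out c' i = c' v := h₁.val_tied hi hvD fun z hz hzD => by
          rw [hfree hc' z (t₁.vars_legs i hz) hzD]
          exact if_neg fun h => hzD ((hD z).2 h)
        have e₂ : t₂.out (cut a) i = cut a (σ v) :=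
          h₂.val_tied (hnew v i hi) hvD' fun z _ hzD => if_neg hzD
        rw [hag v hvD, ← e₁, hc', e₂]
        exact (if_pos hvD').symm
      · exact (hfree hc v hv hvD).symm
    rw [← hc]
    funext i
    exact val_congr fun v hv => hcv v (t₁.vars_legs i hv)
  have hlegs : ∀ i, t₂.legs i = rename σ (t₁.legs i) := fun i => val_injective fun a => by
    rw [val_rename]
    exact (congrFun (hout a) i).symm
  refine ⟨σ, (h₁.s_eq h₂ hd).symm, hb, ?_, ?_, ?_, ?_⟩
  · refine ev_injective fun a => ?_
    rw [ev_rename]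
    -- The density gives only phase differences between paths that agree on the discarded variables;
    -- the reference path has phase zero in both terms.
    have e := phase_sub_eq h₁ h₂ hd (hout a) (hout (cut a)) (hcut a)
    have hone : ∀ w, cut a w = 1 → X w ∈ t₂.D := fun w hw => by
      by_contra hno
      have : cut a w = 0 := if_neg hno
      rw [this] at hw
      exact absurd hw (by decide)
    have z₂ : ev (cut a) t₂.P = 0 := ev_eq_zero hone h₂.phase
    have z₁ : ev (fun v => cut a (σ v)) t₁.P = 0 :=
      ev_eq_zero (fun v hv => (hD v).2 (hone _ hv)) h₁.phase
    rw [z₁, z₂, sub_zero, sub_zero] at e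
    exact e.symm
  · funext i
    simpa [legs] using hlegs (Fin.castAdd n i)
  · have hX : ∀ v, rename σ (X v : BPoly V) = X (σ v) := fun v => val_injective fun a => by
      rw [val_rename, val_X, val_X]
    refine Finset.ext fun d => ?_
    rw [Finset.mem_image]
    constructor
    · intro hdD
      obtain ⟨w, rfl⟩ := h₂.discard d hdD
      refine ⟨X (σ.symm w), (hD _).2 (by rwa [Equiv.apply_symm_apply]), ?_⟩
      rw [hX, Equiv.apply_symm_apply]
    · rintro ⟨e, he, rfl⟩
      obtain ⟨v, rfl⟩ := h₁.discard e he
      rw [hX]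
      exact (hD v).1 he
  · funext i
    simpa [legs] using hlegs (Fin.natAdd m i)

end IsNormal

theorem IsZeroForm.alphaEq {y₁ y₂ : V} (h₁ : t₁.IsZeroForm y₁) (h₂ : t₂.IsZeroForm y₂) :
    t₁.AlphaEq t₂ := by
  obtain ⟨s₁, b₁, P₁, O₁, D₁, I₁⟩ := h₁
  obtain ⟨s₂, b₂, P₂, O₂, D₂, I₂⟩ := h₂
  have h0 : (0 : BPoly V) = rename (Equiv.swap y₁ y₂) 0 := val_injective fun a => by
    rw [val_rename, map_zero, map_zero]
  refine ⟨Equiv.swap y₁ y₂, by rw [s₁, s₂], by simp [b₁, b₂], ?_, ?_, by simp [D₁, D₂], ?_⟩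
  · refine ev_injective fun a => ?_
    rw [P₁, P₂, ev_rename, ev_scale_half_X, ev_scale_half_X, Equiv.swap_apply_left]
  · rw [O₁, O₂]; exact funext fun _ => h0
  · rw [I₁, I₂]; exact funext fun _ => h0

theorem IsTerminal.alphaEq (g₁ : t₁.Good) (g₂ : t₂.Good) (e₁ : t₁.IsTerminal)
    (e₂ : t₂.IsTerminal) (hd : t₁.dens = t₂.dens) : t₁.AlphaEq t₂ := by
  by_cases z₁ : ∃ y, t₁.IsZeroForm y
  · obtain ⟨y₁, z₁⟩ := z₁
    by_cases z₂ : ∃ y, t₂.IsZeroForm y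
    · obtain ⟨y₂, z₂⟩ := z₂
      exact z₁.alphaEq z₂
    · refine absurd ?_ ((e₂.isNormal g₂ (not_exists.1 z₂)).dens_self_ne_zero 0)
      rw [← hd, z₁.dens_eq_zero]
      rfl
  · have n₁ := e₁.isNormal g₁ (not_exists.1 z₁)
    by_cases z₂ : ∃ y, t₂.IsZeroForm y
    · obtain ⟨y₂, z₂⟩ := z₂
      refine absurd ?_ (n₁.dens_self_ne_zero 0)
      rw [hd, z₂.dens_eq_zero]
      rfl
    · exact n₁.alphaEq (e₂.isNormal g₂ (not_exists.1 z₂)) hd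

end DSOP

end SumOverPaths

end

theorem mainTheorem2 {V : Type*} {n m : ℕ} (t₁ t₂ t₁' t₂' : SumOverPaths.DSOP V n m)
    (h₁ : t₁.IsClifford) (h₂ : t₂.IsClifford) (h : t₁.interp = t₂.interp)
    (r₁ : t₁.Reduces t₁') (r₂ : t₂.Reduces t₂')
    (e₁ : t₁'.IsTerminal) (e₂ : t₂'.IsTerminal) :
    t₁'.AlphaEq t₂' := by
  obtain ⟨g₁, d₁⟩ := SumOverPaths.DSOP.Reduces.good r₁ h₁.good
  obtain ⟨g₂, d₂⟩ := SumOverPaths.DSOP.Reduces.good r₂ h₂.good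
  refine SumOverPaths.DSOP.IsTerminal.alphaEq g₁ g₂ e₁ e₂ ?_
  rw [d₁, d₂, SumOverPaths.DSOP.dens_eq_of_interp_eq h]
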